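/- Let $\eta(\tau)=e^{2\pi i\tau/24}\prod_{n\ge1}(1-e^{2\pi i n\tau})$ and $B(a,b)=\int_0^1x^{a-1}(1-x)^{b-1}\,dx$, and let $K=\mathbb Q(\sqrt{-1})$. For an idèle class character $\xi$ of $K$ (a continuous homomorphism from the idèle group of $K$ to $\mathbb C^\times$, trivial on $K^\times$) that is unitary, $L(\xi,s)$ denotes the Euler product $\prod_v(1-\xi_v(\pi_v)(Nv)^{-s})^{-1}$ over the finite places $v$ of $K$ at which $\xi$ is unramified ($\operatorname{Re}s>1$), and its analytic continuation; for a cusp form $f=\sum_{n\ge1}a_nq^n$, $q=e^{2\pi i\tau}$, $L(f,s)$ denotes $\sum_{n\ge 1} a_nn^{-s}$ and its analytic continuation. The character $\xi$ has algebraic type $k$ if $\xi_\infty(z)=(z/|z|)^n$ on $K_\infty^\times=\mathbb C^\times$ for some integer $n$ with $|n|=k-1$. There is an idèle class character $\psi$ of $K$ of algebraic type $2$ with $L(\psi,s-\tfrac12)=L\big(\eta(4\tau)^2\eta(8\tau)^2,s\big)$. The function $\eta(4\tau)^6$ is a cusp form of weight $3$ and level $16$ (that is, for $\Gamma_1(16)$),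 and for every such $\psi$: (1) $L(\psi^2,s-1)=L\big(\eta(4\tau)^6,s\big)$; both sides are entire functions of $s$; (2) $\eta(4\tau)^6$ is the weight-$3$ form attached to $\psi^2$: every cusp form $g$ of weight $3$ and level $16$ with $L(g,s)=L(\psi^2,s-1)$ satisfies $g(\tau)=\eta(4\tau)^6$. Moreover $$L\big(\eta(4\tau)^6,2\big)=\frac{1}{64}\,B\big(\tfrac14,\tfrac14\big)^2 .$$ -/

import Mathlib

open NumberField IsDedekindDomain UpperHalfPlane CongruenceSubgroup Matrix.SpecialLinearGroup

noncomputable section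

/-- The group of idèles of a number field, with its usual (units) topology. -/
abbrev IdeleGroup (K : Type*) [Field K] [NumberField K] : Type _ := (AdeleRing (𝓞 K) K)ˣ

section LocalEmbeddings

variable {K : Type*} [Field K] [NumberField K]

open Classical in
/-- The embedding of `K_v` (as a multiplicative monoid) in the adèles for a finite place `v`:
the component at `v` is `x`, all other components are `1`. -/
def finiteLocalAdele (v : HeightOneSpectrum (𝓞 K)) :
    v.adicCompletion K →* AdeleRing (𝓞 K) K where
  toFun x := ((1 : InfiniteAdeleRing K),
    (RestrictedProduct.mulSingle (fun w : HeightOneSpectrum (𝓞 K) ↦ w.adicCompletionIntegers K) v x :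
      FiniteAdeleRing (𝓞 K) K))
  map_one' := Prod.ext rfl (RestrictedProduct.mulSingle_one _ _)
  map_mul' x y := Prod.ext (mul_one (1 : InfiniteAdeleRing K)).symm
    (RestrictedProduct.mulSingle_mul _ v x y)

/-- The embedding `K_vˣ → I_K` for a finite place `v`. -/
def finiteLocalIdele (v : HeightOneSpectrum (𝓞 K)) : (v.adicCompletion K)ˣ →* IdeleGroup K :=
  Units.map (finiteLocalAdele v)

open Classical in
/-- The embedding of `K_w` (as a multiplicative monoid) in the adèles for an infinite place `w`:
the component at `w` is `z`, all other components are `1`. -/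
def infiniteLocalAdele (w : InfinitePlace K) : w.Completion →* AdeleRing (𝓞 K) K where
  toFun z := ((Pi.mulSingle w z : (u : InfinitePlace K) → u.Completion),
    (1 : FiniteAdeleRing (𝓞 K) K))
  map_one' := Prod.ext (Pi.mulSingle_one w) rfl
  map_mul' x y := Prod.ext (Pi.mulSingle_mul w x y) (mul_one (1 : FiniteAdeleRing (𝓞 K) K)).symm

/-- The embedding `K_wˣ → I_K` for an infinite place `w`. -/
def infiniteLocalIdele (w : InfinitePlace K) : (w.Completion)ˣ →* IdeleGroup K :=
  Units.map (infiniteLocalAdele w)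

end LocalEmbeddings

section IdeleClassCharacters

variable {K : Type*} [Field K] [NumberField K]

/-- A character of the idèle group (a continuous homomorphism to `ℂˣ`) is an idèle class character
if it is trivial on the diagonally embedded group `Kˣ`. -/
def IsIdeleClassCharacter (ξ : IdeleGroup K →ₜ* ℂˣ) : Prop :=
  ∀ x : Kˣ, ξ (Units.map (algebraMap K (AdeleRing (𝓞 K) K)).toMonoidHom x) = 1

/-- `ξ` is unramified at the finite place `v`: `ξ_v` is trivial on the units of `𝒪_v`. -/
def IsUnramifiedAt (ξ : IdeleGroup K →ₜ* ℂˣ) (v : HeightOneSpectrum (𝓞 K)) : Prop :=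
  ∀ u : (v.adicCompletion K)ˣ, Valued.v (u : v.adicCompletion K) = 1 →
    ξ (finiteLocalIdele v u) = 1

/-- A uniformizer of `K_v`, chosen in `K`. -/
def globalUniformizer (v : HeightOneSpectrum (𝓞 K)) : Kˣ :=
  Units.mk0 (v.valuation_exists_uniformizer K).choose fun h ↦ by
    have := (v.valuation_exists_uniformizer K).choose_spec
    rw [h, map_zero] at this
    exact WithZero.coe_ne_zero this.symm

/-- The value `ξ_v(π_v)` at a uniformizer; it does not depend on the uniformizer
when `ξ` is unramified at `v`, which is the only case where it is used. -/
def uniformizerValue (ξ : IdeleGroup K →ₜ* ℂˣ) (v : HeightOneSpectrum (𝓞 K)) : ℂ :=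
  (ξ (finiteLocalIdele v
    (Units.map (algebraMap K (v.adicCompletion K)).toMonoidHom (globalUniformizer v))) : ℂ)

open Classical in
/-- The Euler factor of `L(ξ, s)` at the finite place `v`: it is `(1 - ξ_v(π_v) (Nv)^{-s})⁻¹` if `ξ`
is unramified at `v`, and there is no factor at the ramified places. -/
def heckeEulerFactor (ξ : IdeleGroup K →ₜ* ℂˣ) (s : ℂ) (v : HeightOneSpectrum (𝓞 K)) : ℂ :=
  if IsUnramifiedAt ξ v then
    (1 - uniformizerValue ξ v * (Ideal.absNorm v.asIdeal : ℂ) ^ (-s))⁻¹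
  else 1

/-- The function `L` is the `L`-function of the (unitary) idèle class character `ξ`: it is entire and
for `Re s > 1` the Euler product over the finite places converges to `L s`. By the identity theorem
at most one function has this property. -/
def IsHeckeLFunction (ξ : IdeleGroup K →ₜ* ℂˣ) (L : ℂ → ℂ) : Prop :=
  Differentiable ℂ L ∧ ∀ s : ℂ, 1 < s.re → HasProd (heckeEulerFactor ξ s) (L s)

/-- A character of the idèles of an imaginary quadratic field is algebraic of type `k`: there is an
integer `n` with `|n| = k - 1` such that `ξ_∞(z) = (z/|z|)^n` on `K_∞ˣ = ℂˣ`. -/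
def IsAlgebraicOfType (ξ : IdeleGroup K →ₜ* ℂˣ) (k : ℕ) : Prop :=
  ∃ n : ℤ, |n| = (k : ℤ) - 1 ∧ ∀ (w : InfinitePlace K) (z : (w.Completion)ˣ),
    (ξ (infiniteLocalIdele w z) : ℂ) =
      (InfinitePlace.Completion.extensionEmbedding w (z : w.Completion) /
        (‖InfinitePlace.Completion.extensionEmbedding w (z : w.Completion)‖ : ℂ)) ^ n

/-- The function `η(4τ)² η(8τ)²` on the upper half-plane. -/
def etaQuotient32 (τ : ℍ) : ℂ := ModularForm.eta (4 * (τ : ℂ)) ^ 2 * ModularForm.eta (8 * (τ : ℂ)) ^ 2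

/-- `ψ` is an idèle class character of algebraic type `2` with `L(ψ, s - 1/2) = L(η(4τ)²η(8τ)², s)`.
Both sides are written as the convergent expressions that define them on `Re s > 3/2`:
the Euler product on the left, the Dirichlet series `∑ aₙ n^{-s}` of the `q`-expansion on the right. -/
structure IsPsi (ψ : IdeleGroup K →ₜ* ℂˣ) : Prop where
  isIdeleClassCharacter : IsIdeleClassCharacter ψ
  isAlgebraic : IsAlgebraicOfType ψ 2
  lFunction : ∀ s : ℂ, 3 / 2 < s.re →
    HasProd (heckeEulerFactor ψ (s - 1 / 2)) (LSeries (fun n ↦ (qExpansion 1 etaQuotient32).coeff n) s)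

end IdeleClassCharacters

/-- Cusp forms of weight `3` and level `16`, i.e. for `Γ₁(16)`. -/
abbrev CuspFormsWeightThreeLevelSixteen : Type :=
  CuspForm ((Gamma1 16).map (mapGL ℝ)) 3

/-- The (entire) `L`-function of a cusp form of weight `3` and level `16`,
the continuation of `∑ aₙ n^{-s}`. -/
def cuspL (g : CuspFormsWeightThreeLevelSixteen) : ℂ → ℂ :=
  ModularForm.L (by norm_num : (0 : ℤ) < 3) g

end

/-! Both eta quotients are theta series of `ℤ[i]`. Call `α` primary if `α ≡ 1 mod 2 + 2i`. Jacobi's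
series for `η³` and Gauss's series for `η(z)²/η(2z)` are limits of the finite `q`-binomial theorem
(`hasSum_jacobi`, `hasSum_gauss`). Multiplying two of them and averaging over complex conjugation
gives `η(4τ)⁶ = ∑ α² q^{Nα}` and `η(4τ)²η(8τ)² = ∑ α q^{Nα}`, summed over primary `α`
(`hasSum_eta_pow_six`, `hasSum_eta_sq_mul_eta_sq`). Every ideal prime to `1 + i` has exactly one
primary generator, so both Dirichlet series have Euler products over the odd primes of `ℤ[i]`, with
local values `π/|π|` and `(π/|π|)²` after normalization.

An arbitrary admissible `ψ` is known only through its `L`-function. The coefficient at the norm of a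
prime gives `ψ_v(π_v)` when the prime is its own conjugate, and otherwise only the sum of the values
at the two conjugate primes. Each local value is `0` (ramified) or of modulus one. Because `2 Re
π/|π|` is neither `0` nor `±1` for primary `π`, the sum determines the pair of values up to order
(`eq_or_eq_of_add_eq`, `IsPrimary.gaussSign_add_conj`). Thus `ψ` has the standard local values up to
exchanging conjugate primes (`IsPrimeSystem.exists_perm`), and squaring gives the Euler product of
`η(4τ)⁶`. At `1 + i` it must still be shown that `ψ²` is ramified; triviality of `ψ` on the global
unit `i` yields this (`not_isUnramifiedAt_sq_lam`). Entirety of `L` comes from the cusp form, and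
uniqueness of the form from uniqueness of Dirichlet coefficients.

Existence of `ψ`: since `ℤ[i]` has class number one and its units map bijectively onto
`(ℤ[i]/(2+2i))ˣ`, the idèle group is the direct product of `Kˣ` and the open group
`primarySubgroup`. A sign character at infinity therefore extends uniquely to the idèle classes.

`η(4τ)⁶` is a cusp form because `η⁶` transforms under `SL₂(ℤ)` by a power of `i` depending only on
the matrix modulo `4`, and because its fourth power is the discriminant.

The value at `2`: primary `α` are `1 + w` with `w ∈ Λ = (2+2i)ℤ[i]`. The sum of `w̄²|w|^{-2σ}` over
`Λ` vanishes by the symmetry `w ↦ iw`; subtracting it makes the series converge up to `σ = 2`, where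
it becomes `℘_Λ(1)` (`cuspL_etaCuspForm_two`). Here `℘'² = 4℘³ - g₂℘`, with a pole at `0` and a zero
at `2`. A substitution turns this equation into the differential of `B(1/4, 1/4)`, and `t = 1` is
the midpoint of the symmetric beta integral (`IsLemniscatic.apply_one`). -/

open Filter Topology

/-! ### Gaussian binomials and the finite `q`-binomial theorem -/

section QBinomial

variable {R : Type*} [CommRing R]

/-- The Gaussian binomial coefficient, evaluated at `q`. -/
def gaussBinom (q : R) : ℕ → ℕ → R
  | _, 0 => 1
  | 0, _ + 1 => 0
  | n + 1, k + 1 => gaussBinom q n k + q ^ (k + 1) * gaussBinom q n (k + 1)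

/-- The finite `q`-Pochhammer symbol `(q; q)_n`. -/
def qPoch (q : R) (n : ℕ) : R := ∏ j ∈ Finset.range n, (1 - q ^ (j + 1))

lemma qPoch_succ (q : R) (n : ℕ) : qPoch q (n + 1) = qPoch q n * (1 - q ^ (n + 1)) :=
  Finset.prod_range_succ _ _

@[simp] lemma gaussBinom_zero_right (q : R) (n : ℕ) : gaussBinom q n 0 = 1 := by
  cases n <;> rfl

lemma gaussBinom_succ_succ (q : R) (n k : ℕ) :
    gaussBinom q (n + 1) (k + 1) = gaussBinom q n k + q ^ (k + 1) * gaussBinom q n (k + 1) := rfl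

lemma gaussBinom_eq_zero (q : R) : ∀ {n k : ℕ}, n < k → gaussBinom q n k = 0
  | _, 0, h => absurd h (Nat.not_lt_zero _)
  | 0, _ + 1, _ => rfl
  | n + 1, k + 1, h => by
    rw [gaussBinom_succ_succ, gaussBinom_eq_zero q (by lia : n < k),
      gaussBinom_eq_zero q (by lia : n < k + 1)]
    simp

/-- The quotient formula in division-free form, so that it holds in every commutative ring. Pascal's
recurrence at `(k+1, l+1)` calls on `(k, l+1)` and `(k+1, l)`, hence the nested induction. -/
lemma gaussBinom_mul_qPoch (q : R) (k l : ℕ) :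
    gaussBinom q (k + l) k * (qPoch q k * qPoch q l) = qPoch q (k + l) := by
  induction k generalizing l with
  | zero => simp [qPoch]
  | succ k ihk =>
    induction l with
    | zero =>
      have h := ihk 0
      simp only [add_zero] at h ⊢
      rw [gaussBinom_succ_succ, gaussBinom_eq_zero q (Nat.lt_succ_self k), qPoch_succ]
      simp only [qPoch, Finset.range_zero, Finset.prod_empty, mul_one] at h ⊢
      linear_combination (1 - q ^ (k + 1)) * h
    | succ l ihl =>
      have h1 := ihk (l + 1)
      rw [show k + 1 + (l + 1) = (k + (l + 1)) + 1 by ring, gaussBinom_succ_succ, qPoch_succ q k,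
        qPoch_succ q (k + (l + 1)), ← h1]
      rw [show k + 1 + l = k + (l + 1) by ring] at ihl
      rw [qPoch_succ q l]
      rw [qPoch_succ q k, ← h1, qPoch_succ q l] at ihl
      linear_combination (q ^ (k + 1) * (1 - q ^ (l + 1))) * ihl

/-- The `q`-binomial theorem. -/
lemma prod_one_add_mul_pow (q x : R) (n : ℕ) :
    ∏ j ∈ Finset.range n, (1 + x * q ^ j) =
      ∑ k ∈ Finset.range (n + 1), q ^ (k.choose 2) * gaussBinom q n k * x ^ k := by
  induction n generalizing x with
  | zero => simp
  | succ n ih =>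
    have h : ∏ j ∈ Finset.range n, (1 + x * q ^ (j + 1)) =
        ∏ j ∈ Finset.range n, (1 + (x * q) * q ^ j) :=
      Finset.prod_congr rfl fun j _ ↦ by ring
    -- Split off the factor `j = 0`; the rest is the same product at `x q`, and the two shifted sums
    -- recombine by Pascal's recurrence.
    rw [Finset.prod_range_succ', h, ih, pow_zero, mul_one, mul_add, mul_one]
    have h2 : ∑ k ∈ Finset.range (n + 1), q ^ (k.choose 2) * gaussBinom q n k * (x * q) ^ k =
        ∑ k ∈ Finset.range (n + 1),
          q ^ ((k + 1).choose 2) * gaussBinom q n (k + 1) * (x * q) ^ (k + 1) + 1 := by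
      have h3 := Finset.sum_range_succ
        (fun k ↦ q ^ (k.choose 2) * gaussBinom q n k * (x * q) ^ k) (n + 1)
      rw [gaussBinom_eq_zero q (Nat.lt_succ_self n), mul_zero, zero_mul, add_zero] at h3
      rw [← h3, Finset.sum_range_succ']
      simp
    nth_rw 1 [h2]
    rw [Finset.sum_range_succ' _ (n + 1), Finset.sum_mul, add_right_comm, ← Finset.sum_add_distrib]
    simp only [Nat.choose_zero_succ, pow_zero, gaussBinom_zero_right, mul_one]
    congr 1
    refine Finset.sum_congr rfl fun k _ ↦ ?_
    rw [gaussBinom_succ_succ, Nat.choose_succ_succ' k 1, Nat.choose_one_right]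
    ring

end QBinomial

/-! ### Passage to the limit in centred `q`-binomial sums -/

section Limits

variable {q : ℂ}

lemma qPoch_ne_zero (hq : ‖q‖ < 1) (n : ℕ) : qPoch q n ≠ 0 := by
  refine Finset.prod_ne_zero_iff.mpr fun j _ h ↦ ?_
  have h1 : ‖q ^ (j + 1)‖ < 1 := by
    rw [norm_pow]; exact pow_lt_one₀ (norm_nonneg _) hq (Nat.succ_ne_zero j)
  rw [← sub_eq_zero.mp h, norm_one] at h1
  exact lt_irrefl _ h1

/-- The infinite `q`-Pochhammer symbol `(q; q)_∞`. -/
noncomputable def qPochInf (q : ℂ) : ℂ := ∏' n : ℕ, (1 - q ^ (n + 1))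

lemma qPochInf_ne_zero (hq : ‖q‖ < 1) : qPochInf q ≠ 0 := by
  refine tprod_one_add_ne_zero_of_summable (f := fun n : ℕ ↦ -q ^ (n + 1)) (fun n h ↦ ?_) ?_
  · have := qPoch_ne_zero hq (n + 1)
    rw [qPoch_succ, sub_eq_add_neg, h, mul_zero] at this
    exact this rfl
  · simpa using (summable_nat_add_iff 1).mpr (summable_geometric_of_lt_one (norm_nonneg _) hq)

lemma tendsto_qPoch (hq : ‖q‖ < 1) : Tendsto (qPoch q) atTop (𝓝 (qPochInf q)) :=
  (ModularForm.multipliable_one_sub_pow hq).hasProd.tendsto_prod_nat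

lemma gaussBinom_eq_div (hq : ‖q‖ < 1) (k l : ℕ) :
    gaussBinom q (k + l) k = qPoch q (k + l) / (qPoch q k * qPoch q l) := by
  rw [← gaussBinom_mul_qPoch q k l, mul_div_cancel_right₀]
  exact mul_ne_zero (qPoch_ne_zero hq k) (qPoch_ne_zero hq l)

/-- The sequences `(q;q)_n` and `1/(q;q)_n` converge, hence are bounded. This is the domination
needed below. -/
lemma exists_norm_gaussBinom_le (hq : ‖q‖ < 1) : ∃ C : ℝ, ∀ n k, ‖gaussBinom q n k‖ ≤ C := by
  obtain ⟨A, hA⟩ := (tendsto_qPoch hq).norm.bddAbove_range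
  obtain ⟨B, hB⟩ := ((tendsto_qPoch hq).inv₀ (qPochInf_ne_zero hq)).norm.bddAbove_range
  have hA' n : ‖qPoch q n‖ ≤ A := hA ⟨n, rfl⟩
  have hB' n : ‖(qPoch q n)⁻¹‖ ≤ B := hB ⟨n, rfl⟩
  have hA0 : 0 ≤ A := (norm_nonneg _).trans (hA' 0)
  have hB0 : 0 ≤ B := (norm_nonneg _).trans (hB' 0)
  refine ⟨A * (B * B), fun n k ↦ ?_⟩
  rcases lt_or_ge n k with h | h
  · rw [gaussBinom_eq_zero q h, norm_zero]; positivity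
  · obtain ⟨l, rfl⟩ := Nat.exists_eq_add_of_le h
    rw [gaussBinom_eq_div hq, div_eq_mul_inv, mul_inv, norm_mul, norm_mul]
    exact mul_le_mul (hA' _) (mul_le_mul (hB' _) (hB' _) (norm_nonneg _) hB0) (by positivity) hA0

lemma tendsto_gaussBinom (hq : ‖q‖ < 1) {a b : ℕ → ℕ} (ha : Tendsto a atTop atTop)
    (hb : Tendsto b atTop atTop) :
    Tendsto (fun N ↦ gaussBinom q (a N + b N) (a N)) atTop (𝓝 (qPochInf q)⁻¹) := by
  simp_rw [gaussBinom_eq_div hq]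
  have h0 := qPochInf_ne_zero hq
  have := ((tendsto_qPoch hq).comp (ha.atTop_add_atTop hb)).div
    (((tendsto_qPoch hq).comp ha).mul ((tendsto_qPoch hq).comp hb)) (mul_ne_zero h0 h0)
  rwa [div_mul_cancel_left₀ h0] at this

/-- Tannery's theorem: after centring by `k = j + N + e`, each binomial tends to `1/(q;q)_∞` while
staying bounded. Gauss's identity uses `e = 0`, Jacobi's uses `e = 1`. -/
lemma tendsto_sum_gaussBinom (hq : ‖q‖ < 1) {c : ℤ → ℂ} (hc : Summable fun j ↦ ‖c j‖) (e : ℕ) :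
    Tendsto (fun N : ℕ ↦ ∑ k ∈ Finset.range (2 * N + e + 1),
      c ((k : ℤ) - (N + e : ℕ)) * gaussBinom q (2 * N + e) k) atTop
      (𝓝 ((∑' j, c j) * (qPochInf q)⁻¹)) := by
  obtain ⟨C, hC⟩ := exists_norm_gaussBinom_le hq
  have hC0 : 0 ≤ C := (norm_nonneg _).trans (hC 0 0)
  -- Extension by zero to all `j`. Indices beyond the top of the row vanish by themselves; the test
  -- is needed only below, where `toNat` would return `0`.
  let f (N : ℕ) (j : ℤ) : ℂ :=
    if 0 ≤ j + (N + e : ℕ) then c j * gaussBinom q (2 * N + e) (j + (N + e : ℕ)).toNat else 0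
  have hf (N : ℕ) : ∑' j, f N j = ∑ k ∈ Finset.range (2 * N + e + 1),
      c ((k : ℤ) - (N + e : ℕ)) * gaussBinom q (2 * N + e) k := by
    have hinj : Function.Injective (fun k : ℕ ↦ (k : ℤ) - (N + e : ℕ)) := fun a b h ↦ by
      simpa using h
    refine (HasSum.tsum_eq ((hinj.hasSum_iff fun j hj ↦ ?_).mp ?_))
    · simp only [f]
      rw [if_neg]
      exact fun h ↦ hj ⟨(j + (N + e : ℕ)).toNat, by simp only; lia⟩
    · have : f N ∘ (fun k : ℕ ↦ (k : ℤ) - (N + e : ℕ)) =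
          fun k : ℕ ↦ c ((k : ℤ) - (N + e : ℕ)) * gaussBinom q (2 * N + e) k := by
        ext k
        simp [f]
      rw [this]
      refine hasSum_sum_of_ne_finset_zero fun k hk ↦ ?_
      rw [gaussBinom_eq_zero q (by simpa [Nat.lt_succ_iff] using hk), mul_zero]
  simp_rw [← hf, ← tsum_mul_right]
  refine tendsto_tsum_of_dominated_convergence (hc.mul_right C) (fun j ↦ ?_)
    (Eventually.of_forall fun N j ↦ ?_)
  · have ha : Tendsto (fun N : ℕ ↦ (j + (N + e : ℕ)).toNat) atTop atTop :=
      tendsto_atTop_atTop.mpr fun b ↦ ⟨b + j.natAbs, fun n hn ↦ by lia⟩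
    have hb : Tendsto (fun N : ℕ ↦ ((N : ℤ) - j).toNat) atTop atTop :=
      tendsto_atTop_atTop.mpr fun b ↦ ⟨b + j.natAbs, fun n hn ↦ by lia⟩
    refine ((tendsto_gaussBinom hq ha hb).const_mul (c j)).congr' ?_
    filter_upwards [eventually_ge_atTop j.natAbs] with N hN
    simp only [f]
    rw [if_pos (by lia)]
    congr 2
    lia
  · simp only [f]
    split_ifs
    · rw [norm_mul]
      exact mul_le_mul_of_nonneg_left (hC _ _) (norm_nonneg _)
    · rw [norm_zero]; positivity

end Limits

/-! ### Finite forms of the identities of Gauss and Jacobi -/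

section ThetaProducts

variable {q : ℂ}

lemma summable_norm_mul_pow_of_natAbs_le (hq : ‖q‖ < 1) {e : ℤ → ℕ}
    (he : ∀ j : ℤ, j.natAbs ≤ e j + 1) {c : ℤ → ℂ} (hc : ∀ j, ‖c j‖ ≤ j.natAbs + 1) :
    Summable fun j ↦ ‖c j * q ^ e j‖ := by
  have hr := norm_nonneg q
  have hle (j : ℤ) : ‖c j * q ^ e j‖ ≤ (j.natAbs + 1) * ‖q‖ ^ (j.natAbs - 1) := by
    rw [norm_mul, norm_pow]
    exact mul_le_mul (hc j) (pow_le_pow_of_le_one hr hq.le (by have := he j; lia))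
      (by positivity) (by positivity)
  have hs : Summable fun n : ℕ ↦ (n + 1 : ℝ) * ‖q‖ ^ (n - 1) := by
    rw [← summable_nat_add_iff 1]
    simp only [Nat.cast_add, Nat.cast_one, Nat.add_sub_cancel, add_mul, one_mul]
    refine (Summable.add ?_ (summable_geometric_of_lt_one hr hq)).add
      (summable_geometric_of_lt_one hr hq)
    simpa using summable_pow_mul_geometric_of_norm_lt_one 1 (r := ‖q‖) (by simpa using hq)
  refine Summable.of_nonneg_of_le (fun _ ↦ norm_nonneg _) hle ?_
  refine Summable.of_nat_of_neg ?_ ?_ <;> simpa using hs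

lemma prod_odd_eq (hq : ‖q‖ < 1) (N : ℕ) :
    ∏ i ∈ Finset.range N, (1 - q ^ (2 * i + 1)) = qPoch q (2 * N) / qPoch (q ^ 2) N := by
  have hq2 : ‖q ^ 2‖ < 1 := by
    rw [norm_pow]; exact pow_lt_one₀ (norm_nonneg _) hq two_ne_zero
  rw [eq_div_iff (qPoch_ne_zero hq2 N)]
  induction N with
  | zero => simp [qPoch]
  | succ N ih =>
    rw [Finset.prod_range_succ, show 2 * (N + 1) = 2 * N + 1 + 1 by ring, qPoch_succ, qPoch_succ,
      qPoch_succ, ← ih]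
    ring

lemma int_choose_two_mul_two (k : ℕ) : (k.choose 2 : ℤ) * 2 = k * (k - 1) := by
  have h := Nat.div_two_mul_two_of_even (Nat.even_mul_pred_self k)
  rw [← Nat.choose_two_right] at h
  rcases k with _ | k
  · simp
  · push_cast [← Int.natCast_inj] at h ⊢
    simpa using h

/-- The finite form of Gauss's identity. -/
lemma prod_odd_sq_eq_sum (h0 : q ≠ 0) (N : ℕ) :
    (∏ i ∈ Finset.range N, (1 - q ^ (2 * i + 1))) ^ 2 =
      ∑ k ∈ Finset.range (2 * N + 0 + 1), ((-1) ^ ((k : ℤ) - (N + 0 : ℕ)).natAbs *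
        q ^ ((k : ℤ) - (N + 0 : ℕ)).natAbs ^ 2) * gaussBinom (q ^ 2) (2 * N + 0) k := by
  obtain ⟨p, hp⟩ : ∃ p, q * p = 1 := ⟨q⁻¹, mul_inv_cancel₀ h0⟩
  have hpow (n : ℕ) : q ^ n * p ^ n = 1 := by rw [← mul_pow, hp, one_pow]
  -- With `p = q⁻¹` and `x = -q^{1-2N}` the factors are `1 - q^{2j+1-2N}`, whose exponents are
  -- symmetric about `0`. Pulling `-p^{2i+1}` out of the lower half makes both halves equal.
  have h := prod_one_add_mul_pow (q ^ 2) (-(q * p ^ (2 * N))) (2 * N)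
  have hl : ∏ j ∈ Finset.range (2 * N), (1 + -(q * p ^ (2 * N)) * (q ^ 2) ^ j) =
      (-1) ^ N * p ^ (N ^ 2) * (∏ i ∈ Finset.range N, (1 - q ^ (2 * i + 1))) ^ 2 := by
    rw [two_mul, Finset.prod_range_add, sq (∏ i ∈ Finset.range N, _), ← mul_assoc]
    congr 1
    · rw [← Finset.prod_range_reflect]
      have : (-1 : ℂ) ^ N * p ^ N ^ 2 = ∏ i ∈ Finset.range N, (-p ^ (2 * i + 1)) := by
        clear h
        induction N with
        | zero => simp
        | succ N ih => rw [Finset.prod_range_succ, ← ih]; ring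
      rw [this, ← Finset.prod_mul_distrib]
      refine Finset.prod_congr rfl fun i hi ↦ ?_
      have hi := Finset.mem_range.mp hi
      have e : N + N = (2 * (N - 1 - i)) + 1 + (2 * i + 1) := by lia
      rw [e, ← pow_mul, pow_add, pow_succ]
      linear_combination -(q * p * p ^ (2 * i + 1)) * hpow (2 * (N - 1 - i)) -
        p ^ (2 * i + 1) * hp - hpow (2 * i + 1)
    · refine Finset.prod_congr rfl fun i hi ↦ ?_
      rw [← pow_mul, mul_add, pow_add, two_mul]
      linear_combination -(q * q ^ (2 * i)) * hpow (N + N)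
  rw [hl] at h
  have h' := congrArg ((-1) ^ N * q ^ (N ^ 2) * ·) h
  simp only [Finset.mul_sum] at h'
  have hs : (-1 : ℂ) ^ N * (-1) ^ N = 1 := by rw [← mul_pow]; simp
  rw [show ∀ x : ℂ, (-1 : ℂ) ^ N * q ^ N ^ 2 * ((-1) ^ N * p ^ N ^ 2 * x) = x by
    intro x
    linear_combination x * hs + x * (-1 : ℂ) ^ N * (-1) ^ N * hpow (N ^ 2)] at h'
  rw [h']
  refine Finset.sum_congr rfl fun k hk ↦ ?_
  have e1 : (-1 : ℂ) ^ ((k : ℤ) - (N + 0 : ℕ)).natAbs = (-1) ^ N * (-1) ^ k := by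
    rw [← pow_add]
    rcases neg_one_pow_eq_or ℂ (N + k) with h | h <;> rw [h]
    · exact Even.neg_one_pow (by rw [neg_one_pow_eq_one_iff_even (by norm_num)] at h; grind)
    · exact Odd.neg_one_pow (by rw [neg_one_pow_eq_neg_one_iff_odd (by norm_num)] at h; grind)
  have e2 : q ^ ((k : ℤ) - (N + 0 : ℕ)).natAbs ^ 2 =
      q ^ N ^ 2 * ((q ^ 2) ^ k.choose 2 * (q ^ k * p ^ (2 * N * k))) := by
    -- Completing the square, stated without subtraction in the exponents.
    have e3 : ((k : ℤ) - (N + 0 : ℕ)).natAbs ^ 2 + 2 * N * k = N ^ 2 + (2 * k.choose 2 + k) := by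
      zify
      rw [sq_abs]
      linear_combination -int_choose_two_mul_two k
    have e4 := congrArg (q ^ ·) e3
    simp only [pow_add, pow_mul q 2] at e4
    linear_combination p ^ (2 * N * k) * e4 - q ^ ((k : ℤ) - (N + 0 : ℕ)).natAbs ^ 2 * hpow (2 * N * k)
  rw [e1, e2, neg_pow (q * _), mul_pow, ← pow_mul, add_zero]
  ring

/-- The finite form of Jacobi's identity. -/
lemma qPoch_sq_eq_sum (h0 : q ≠ 0) (N : ℕ) :
    qPoch q N ^ 2 = ∑ k ∈ Finset.range (2 * N + 1 + 1), ((-1) ^ ((k : ℤ) - (N + 1 : ℕ)).natAbs *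
      ((k : ℤ) - (N + 1 : ℕ) : ℤ) *
        q ^ ((((k : ℤ) - (N + 1 : ℕ)) * ((k : ℤ) - (N + 1 : ℕ) + 1) / 2).toNat)) *
        gaussBinom q (2 * N + 1) k := by
  obtain ⟨p, hp⟩ : ∃ p, q * p = 1 := ⟨q⁻¹, mul_inv_cancel₀ h0⟩
  have hpow (n : ℕ) : q ^ n * p ^ n = 1 := by rw [← mul_pow, hp, one_pow]
  have hs : (-1 : ℂ) ^ N * (-1) ^ N = 1 := by rw [← mul_pow]; simp
  set T := (N + 1).choose 2 with hT
  -- Isolates the middle factor, which vanishes at `x = -p^N`. The derivative of the product at that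
  -- point is therefore the product of the other factors times `q^N`.
  have hsplit (x : ℂ) : ∏ j ∈ Finset.range (2 * N + 1), (1 + x * q ^ j) =
      (1 + x * q ^ N) * ((∏ j ∈ Finset.range N, (1 + x * q ^ j)) *
        ∏ j ∈ Finset.range N, (1 + x * q ^ (N + 1 + j))) := by
    rw [show 2 * N + 1 = N + 1 + N by ring, Finset.prod_range_add, Finset.prod_range_succ]
    ring
  have hx : -p ^ N * q ^ N = -1 := by linear_combination -hpow N
  have hA : ∏ j ∈ Finset.range N, (1 + -p ^ N * q ^ j) = (-1) ^ N * p ^ T * qPoch q N := by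
    have : (-1 : ℂ) ^ N * p ^ T = ∏ i ∈ Finset.range N, (-p ^ (i + 1)) := by
      clear_value T
      subst hT
      clear hsplit hs hx
      induction N with
      | zero => simp
      | succ N ih =>
        rw [Finset.prod_range_succ, ← ih, Nat.choose_succ_succ' (N + 1) 1, Nat.choose_one_right]
        ring
    rw [this, qPoch, ← Finset.prod_range_reflect, ← Finset.prod_mul_distrib]
    refine Finset.prod_congr rfl fun i hi ↦ ?_
    have hi := Finset.mem_range.mp hi
    have e : p ^ N = p ^ (N - 1 - i) * p ^ (i + 1) := by rw [← pow_add]; congr 1; lia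
    rw [e]
    linear_combination -p ^ (i + 1) * hpow (N - 1 - i) - hpow (i + 1)
  have hB : ∏ j ∈ Finset.range N, (1 + -p ^ N * q ^ (N + 1 + j)) = qPoch q N := by
    refine Finset.prod_congr rfl fun i _ ↦ ?_
    rw [add_assoc, pow_add]
    linear_combination -q ^ (1 + i) * hpow N
  have h1 : ∑ k ∈ Finset.range (2 * N + 1 + 1),
      q ^ (k.choose 2) * gaussBinom q (2 * N + 1) k * (-p ^ N) ^ k = 0 := by
    rw [← prod_one_add_mul_pow, hsplit, hx]
    ring
  have h2 : ∑ k ∈ Finset.range (2 * N + 1 + 1),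
      q ^ (k.choose 2) * gaussBinom q (2 * N + 1) k * (k * (-p ^ N) ^ (k - 1)) =
        q ^ N * ((-1) ^ N * p ^ T * qPoch q N * qPoch q N) := by
    have d1 : HasDerivAt (fun x ↦ ∑ k ∈ Finset.range (2 * N + 1 + 1),
        q ^ (k.choose 2) * gaussBinom q (2 * N + 1) k * x ^ k) _ (-p ^ N) :=
      HasDerivAt.fun_sum fun k _ ↦ (hasDerivAt_pow k (-p ^ N)).const_mul _
    simp_rw [← prod_one_add_mul_pow, hsplit] at d1
    have d2 : DifferentiableAt ℂ (fun x : ℂ ↦ (∏ j ∈ Finset.range N, (1 + x * q ^ j)) *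
        ∏ j ∈ Finset.range N, (1 + x * q ^ (N + 1 + j))) (-p ^ N) := by
      fun_prop
    have d3 := (((hasDerivAt_id' (-p ^ N)).mul_const (q ^ N)).const_add 1).mul d2.hasDerivAt
    rw [← d3.unique d1, hA, hB, hx]
    ring
  have h3 : ∑ k ∈ Finset.range (2 * N + 1 + 1),
      q ^ (k.choose 2) * gaussBinom q (2 * N + 1) k * (k * (-p ^ N) ^ k) =
        -((-1) ^ N * p ^ T * qPoch q N * qPoch q N) := by
    have h4 := congrArg (-p ^ N * ·) h2
    simp only [Finset.mul_sum] at h4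
    rw [← mul_assoc, hx, neg_one_mul] at h4
    rw [← h4]
    refine Finset.sum_congr rfl fun k _ ↦ ?_
    rcases k with _ | k
    · simp
    · rw [Nat.add_sub_cancel, pow_succ (-p ^ N)]; ring
  -- The undifferentiated sum is zero, so `N + 1` times it may be subtracted to replace the weight
  -- `k` by the centred `k - (N + 1)`.
  have h4 : qPoch q N ^ 2 = -((-1) ^ N * q ^ T) * (∑ k ∈ Finset.range (2 * N + 1 + 1),
      q ^ (k.choose 2) * gaussBinom q (2 * N + 1) k * (k * (-p ^ N) ^ k) -
      (N + 1) * ∑ k ∈ Finset.range (2 * N + 1 + 1),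
      q ^ (k.choose 2) * gaussBinom q (2 * N + 1) k * (-p ^ N) ^ k) := by
    rw [h3, h1]
    linear_combination -qPoch q N ^ 2 * hs - qPoch q N ^ 2 * (-1) ^ N * (-1) ^ N * hpow T
  rw [h4, Finset.mul_sum, ← Finset.sum_sub_distrib, Finset.mul_sum]
  refine Finset.sum_congr rfl fun k _ ↦ ?_
  have e1 : (-1 : ℂ) ^ ((k : ℤ) - (N + 1 : ℕ)).natAbs = -((-1) ^ N * (-1) ^ k) := by
    rw [← pow_add]
    rcases neg_one_pow_eq_or ℂ (N + k) with h | h <;> rw [h]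
    · exact Odd.neg_one_pow (by rw [neg_one_pow_eq_one_iff_even (by norm_num)] at h; grind)
    · rw [neg_neg]
      exact Even.neg_one_pow (by rw [neg_one_pow_eq_neg_one_iff_odd (by norm_num)] at h; grind)
  have e2 : q ^ ((((k : ℤ) - (N + 1 : ℕ)) * ((k : ℤ) - (N + 1 : ℕ) + 1) / 2).toNat) =
      q ^ T * (q ^ k.choose 2 * p ^ (N * k)) := by
    have e3 : (((k : ℤ) - (N + 1 : ℕ)) * ((k : ℤ) - (N + 1 : ℕ) + 1) / 2).toNat + N * k =
        T + k.choose 2 := by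
      have h5 : ((k : ℤ) - (N + 1 : ℕ)) * ((k : ℤ) - (N + 1 : ℕ) + 1) =
          2 * (T + k.choose 2 - N * k) := by
        have h6 := int_choose_two_mul_two (N + 1)
        rw [← hT] at h6
        push_cast at h6 ⊢
        linear_combination -int_choose_two_mul_two k - h6
      have h7 : 0 ≤ ((k : ℤ) - (N + 1 : ℕ)) * ((k : ℤ) - (N + 1 : ℕ) + 1) := by
        rcases le_or_gt 0 ((k : ℤ) - (N + 1 : ℕ)) with h | h <;> nlinarith
      have h8 : ((N * k : ℕ) : ℤ) = N * k := by push_cast; ring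
      rw [h5] at h7 ⊢
      lia
    have e4 := congrArg (q ^ ·) e3
    simp only [pow_add] at e4
    linear_combination p ^ (N * k) * e4 -
      q ^ ((((k : ℤ) - (N + 1 : ℕ)) * ((k : ℤ) - (N + 1 : ℕ) + 1) / 2).toNat) * hpow (N * k)
  rw [e1, e2, neg_pow (p ^ N), ← pow_mul]
  push_cast
  ring

end ThetaProducts

open Filter Topology UpperHalfPlane

/-! ### The theta identities of Gauss and Jacobi as infinite series -/

section ThetaSeries

variable {q : ℂ}

/-- Gauss's identity. -/
lemma hasSum_gauss (h0 : q ≠ 0) (hq : ‖q‖ < 1) :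
    HasSum (fun j : ℤ ↦ (-1 : ℂ) ^ j.natAbs * q ^ j.natAbs ^ 2)
      (qPochInf q ^ 2 / qPochInf (q ^ 2)) := by
  have hq2 : ‖q ^ 2‖ < 1 := by
    rw [norm_pow]; exact pow_lt_one₀ (norm_nonneg _) hq two_ne_zero
  have hs : Summable fun j : ℤ ↦ ‖(-1 : ℂ) ^ j.natAbs * q ^ j.natAbs ^ 2‖ :=
    summable_norm_mul_pow_of_natAbs_le hq (fun j ↦ by nlinarith) (fun j ↦ by simp)
  have h1 := tendsto_sum_gaussBinom hq2 hs 0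
  simp_rw [← prod_odd_sq_eq_sum h0, prod_odd_eq hq] at h1
  have h2 := (((tendsto_qPoch hq).comp (tendsto_id.const_mul_atTop' (two_pos : (0 : ℕ) < 2))).div
    (tendsto_qPoch hq2) (qPochInf_ne_zero hq2)).pow 2
  have h3 := tendsto_nhds_unique h1 h2
  rw [← div_eq_mul_inv, div_eq_iff (qPochInf_ne_zero hq2)] at h3
  have h4 := hs.of_norm.hasSum
  rw [h3] at h4
  refine (congrArg (HasSum _) ?_).mp h4
  have := qPochInf_ne_zero hq2
  field_simp

lemma hasSum_jacobi_aux (h0 : q ≠ 0) (hq : ‖q‖ < 1) :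
    HasSum (fun j : ℤ ↦ (-1 : ℂ) ^ j.natAbs * j * q ^ (j * (j + 1) / 2).toNat)
      (qPochInf q ^ 3) := by
  have hs : Summable fun j : ℤ ↦ ‖(-1 : ℂ) ^ j.natAbs * j * q ^ (j * (j + 1) / 2).toNat‖ := by
    refine summable_norm_mul_pow_of_natAbs_le hq (fun j ↦ ?_) (fun j ↦ ?_)
    · have : j.natAbs - 1 ≤ j * (j + 1) / 2 := by
        rw [Int.le_ediv_iff_mul_le two_pos]
        rcases le_or_gt 0 j with h | h
        · rw [Int.natAbs_of_nonneg h]; nlinarith [sq_nonneg (2 * j - 1)]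
        · rw [Int.ofNat_natAbs_of_nonpos h.le]
          rcases eq_or_ne j (-1) with rfl | h1
          · norm_num
          · nlinarith [show j + 2 ≤ 0 by lia]
      lia
    · simp [Complex.norm_intCast, Nat.cast_natAbs]
  have h1 := tendsto_sum_gaussBinom hq hs 1
  simp_rw [← qPoch_sq_eq_sum h0] at h1
  have h3 := tendsto_nhds_unique h1 ((tendsto_qPoch hq).pow 2)
  rw [← div_eq_mul_inv, div_eq_iff (qPochInf_ne_zero hq)] at h3
  have h4 := hs.of_norm.hasSum
  rw [h3] at h4
  exact (congrArg (HasSum _) (by ring)).mp h4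

/-- Jacobi's identity for the cube of the Euler product. -/
lemma hasSum_jacobi (h0 : q ≠ 0) (hq : ‖q‖ < 1) :
    HasSum (fun k : ℤ ↦ (4 * k + 1 : ℂ) * q ^ (k * (2 * k + 1)).toNat) (qPochInf q ^ 3) := by
  have h := hasSum_jacobi_aux h0 hq
  -- The indices `2k` and `-1 - 2k` share the exponent `k(2k+1)` and together exhaust `ℤ`; their
  -- signed coefficients `2k` and `2k + 1` add up to `4k + 1`.
  have hinj1 : Function.Injective fun k : ℤ ↦ 2 * k := fun a b h ↦ by simpa using h
  have hinj2 : Function.Injective fun k : ℤ ↦ -1 - 2 * k := fun a b h ↦ by simpa using h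
  have hc : IsCompl (Set.range fun k : ℤ ↦ 2 * k) (Set.range fun k : ℤ ↦ -1 - 2 * k) := by
    refine (compl_eq_iff_isCompl.mp ?_).symm
    ext x
    simp only [Set.mem_compl_iff, Set.mem_range, not_exists]
    constructor
    · intro hx
      exact ⟨x / 2, by have := hx ((-1 - x) / 2); lia⟩
    · rintro ⟨y, rfl⟩ z
      lia
  set f := fun j : ℤ ↦ (-1 : ℂ) ^ j.natAbs * j * q ^ (j * (j + 1) / 2).toNat with hf
  have h1 : HasSum (fun k : ℤ ↦ f (2 * k)) (∑' k : ℤ, f (2 * k)) :=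
    (h.summable.comp_injective hinj1).hasSum
  have h2 : HasSum (fun k : ℤ ↦ f (-1 - 2 * k)) (∑' k : ℤ, f (-1 - 2 * k)) :=
    (h.summable.comp_injective hinj2).hasSum
  have h3 : HasSum f (∑' k : ℤ, f (2 * k) + ∑' k : ℤ, f (-1 - 2 * k)) :=
    HasSum.add_isCompl hc (hinj1.hasSum_range_iff.mpr h1) (hinj2.hasSum_range_iff.mpr h2)
  have h4 := h1.add h2
  rw [h3.unique h] at h4
  have h5 : (fun k : ℤ ↦ f (2 * k) + f (-1 - 2 * k)) =
      fun k : ℤ ↦ (4 * k + 1 : ℂ) * q ^ (k * (2 * k + 1)).toNat := by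
    funext k
    have e1 : 2 * k * (2 * k + 1) / 2 = k * (2 * k + 1) := by
      rw [mul_assoc]; exact Int.mul_ediv_cancel_left _ two_ne_zero
    have e2 : (-1 - 2 * k) * (-1 - 2 * k + 1) / 2 = k * (2 * k + 1) := by
      rw [← e1]; congr 1; ring
    have e3 : (-1 : ℂ) ^ (2 * k).natAbs = 1 := Even.neg_one_pow (Nat.even_iff.mpr (by lia))
    have e4 : (-1 : ℂ) ^ (-1 - 2 * k).natAbs = -1 := Odd.neg_one_pow (Nat.odd_iff.mpr (by lia))
    simp only [hf, e1, e2, e3, e4]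
    push_cast
    ring
  rwa [h5] at h4

end ThetaSeries

/-! ### Theta expansions of eta quotients -/

section EtaIdentities

open Complex

lemma eta_eq_qPochInf (z : ℂ) :
    ModularForm.eta z = cexp (2 * Real.pi * Complex.I * (z / 24)) * qPochInf (cexp (2 * Real.pi * Complex.I * z)) := by
  simp only [ModularForm.eta, ModularForm.eta_q, qPochInf, Function.Periodic.qParam]
  congr 2
  · push_cast; ring
  · simp

lemma norm_cexp_lt_one {z : ℂ} (hz : 0 < z.im) : ‖cexp (2 * Real.pi * Complex.I * z)‖ < 1 :=
  UpperHalfPlane.norm_exp_two_pi_I_lt_one ⟨z, hz⟩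

/-- The prefactor of `η³` completes the square: `8k(2k+1) + 1 = (4k+1)²`. -/
lemma hasSum_eta_cube {z : ℂ} (hz : 0 < z.im) :
    HasSum (fun k : ℤ ↦ (4 * k + 1 : ℂ) * cexp (2 * Real.pi * Complex.I * (z / 8) * (4 * k + 1) ^ 2))
      (ModularForm.eta z ^ 3) := by
  have h := (hasSum_jacobi (exp_ne_zero _) (norm_cexp_lt_one hz)).mul_left
    (cexp (2 * Real.pi * Complex.I * (z / 24)) ^ 3)
  rw [← mul_pow, ← eta_eq_qPochInf] at h
  refine (congrArg (HasSum · _) (funext fun k ↦ ?_)).mp h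
  rw [mul_left_comm, ← exp_nat_mul, ← exp_nat_mul, ← exp_add]
  congr 2
  have h0 : 0 ≤ k * (2 * k + 1) := by
    rcases le_or_gt 0 k with h | h <;> nlinarith
  have h1 : (((k * (2 * k + 1)).toNat : ℤ) : ℂ) = ((k * (2 * k + 1) : ℤ) : ℂ) := by
    rw [Int.toNat_of_nonneg h0]
  push_cast at h1 ⊢
  rw [h1]
  ring

lemma hasSum_eta_sq_div {z : ℂ} (hz : 0 < z.im) :
    HasSum (fun n : ℤ ↦ (-1 : ℂ) ^ n.natAbs * cexp (2 * Real.pi * Complex.I * z * n ^ 2))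
      (ModularForm.eta z ^ 2 / ModularForm.eta (2 * z)) := by
  have h := hasSum_gauss (exp_ne_zero _) (norm_cexp_lt_one hz)
  have e : ModularForm.eta z ^ 2 / ModularForm.eta (2 * z) =
      qPochInf (cexp (2 * Real.pi * Complex.I * z)) ^ 2 / qPochInf (cexp (2 * Real.pi * Complex.I * z) ^ 2) := by
    rw [eta_eq_qPochInf, eta_eq_qPochInf, mul_pow, ← exp_nat_mul, ← exp_nat_mul,
      show ((2 : ℕ) : ℂ) * (2 * Real.pi * Complex.I * (z / 24)) = 2 * Real.pi * Complex.I * (2 * z / 24) by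
        push_cast; ring,
      show ((2 : ℕ) : ℂ) * (2 * Real.pi * Complex.I * z) = 2 * Real.pi * Complex.I * (2 * z) by push_cast; ring,
      mul_div_mul_left _ _ (exp_ne_zero _)]
  rw [e]
  refine (congrArg (HasSum · _) (funext fun n ↦ ?_)).mp h
  rw [← exp_nat_mul]
  congr 2
  have h1 : (n.natAbs : ℂ) ^ 2 = (n : ℂ) ^ 2 := by
    rw [← Int.cast_natCast, ← Int.cast_pow, Int.natAbs_sq, Int.cast_pow]
  push_cast
  rw [h1]
  ring

end EtaIdentities

/-! ### Primary Gaussian integers and their two coordinate systems -/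

section Primary

/-- A Gaussian integer is primary if it is congruent to `1` modulo `2 + 2i`. -/
def IsPrimary (α : GaussianInt) : Prop := 2 ∣ α.im ∧ 4 ∣ α.re + α.im - 1

/-- The type of primary Gaussian integers. -/
abbrev PrimaryGaussian : Type := {α : GaussianInt // IsPrimary α}

/-- The norm of a Gaussian integer as a natural number. -/
def gaussNorm (α : GaussianInt) : ℕ := α.norm.natAbs

lemma coe_gaussNorm (α : GaussianInt) : (gaussNorm α : ℤ) = α.re ^ 2 + α.im ^ 2 := by
  rw [gaussNorm, Int.natAbs_of_nonneg (GaussianInt.norm_nonneg α), Zsqrtd.norm_def]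
  ring

lemma IsPrimary.star {α : GaussianInt} (h : IsPrimary α) : IsPrimary (star α) := by
  obtain ⟨h1, h2⟩ := h
  constructor <;> simp only [Zsqrtd.re_star, Zsqrtd.im_star] <;> lia

/-- Complex conjugation on primary Gaussian integers. -/
def PrimaryGaussian.conj : PrimaryGaussian ≃ PrimaryGaussian where
  toFun α := ⟨star α.1, α.2.star⟩
  invFun α := ⟨star α.1, α.2.star⟩
  left_inv α := by simp
  right_inv α := by simp

lemma gaussNorm_star (α : GaussianInt) : gaussNorm (star α) = gaussNorm α := by
  zify; rw [coe_gaussNorm, coe_gaussNorm]; simp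

/-- Primary Gaussian integers `a + b i` in terms of `a + b = 4 k + 1`, `a - b = 4 l + 1`. -/
def primaryEquivSumDiff : ℤ × ℤ ≃ PrimaryGaussian where
  -- These coordinates suit a product of two copies of Jacobi's series: `Re α² = (a+b)(a-b)` and
  -- `2Nα = (a+b)² + (a-b)²`.
  toFun x := ⟨⟨2 * x.1 + 2 * x.2 + 1, 2 * (x.1 - x.2)⟩, by constructor <;> simp only <;> lia⟩
  invFun α := ((α.1.re + α.1.im - 1) / 4, (α.1.re - α.1.im - 1) / 4)
  left_inv x := by
    ext <;> simp only <;> lia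
  right_inv α := by
    obtain ⟨⟨a, b⟩, h1, h2⟩ := α
    simp only at h1 h2
    refine Subtype.ext (Zsqrtd.ext ?_ ?_) <;> simp only <;> lia

/-- Primary Gaussian integers `± (4 k + 1) + 2 n i`. -/
def primaryEquivSigned : ℤ × ℤ ≃ PrimaryGaussian where
  -- For imaginary part `2n` the real part must be `≡ 1 - 2n mod 4`. The sign so forced is the
  -- `(-1)^n` of Gauss's series.
  toFun x := ⟨⟨(if 2 ∣ x.2 then 1 else -1) * (4 * x.1 + 1), 2 * x.2⟩, by
    refine ⟨Dvd.intro _ rfl, ?_⟩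
    simp only
    split_ifs <;> lia⟩
  invFun α := (((if 4 ∣ α.1.im then 1 else -1) * α.1.re - 1) / 4, α.1.im / 2)
  left_inv x := by
    refine Prod.ext ?_ ?_ <;> simp only
    · split_ifs <;> lia
    · lia
  right_inv α := by
    obtain ⟨⟨a, b⟩, h1, h2⟩ := α
    simp only at h1 h2
    refine Subtype.ext (Zsqrtd.ext ?_ ?_) <;> simp only
    · split_ifs <;> lia
    · lia

end Primary

/-! ### Convergence of sums over Gaussian integers -/

section LatticeSums

/-- Comparison with the sup norm on `ℤ²` raised to `-2σ`, an exponent beyond the critical one for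
rank two. The term at `0` is `0 ^ (-σ) = 0` by convention. -/
lemma summable_gaussNorm_rpow {σ : ℝ} (hσ : 1 < σ) :
    Summable fun α : GaussianInt ↦ (gaussNorm α : ℝ) ^ (-σ) := by
  let f : GaussianInt → (Fin 2 → ℤ) := fun α ↦ ![α.re, α.im]
  have hf : Function.Injective f := fun α β h ↦
    Zsqrtd.ext (by simpa [f] using congrFun h 0) (by simpa [f] using congrFun h 1)
  have h := (EisensteinSeries.summable_one_div_norm_rpow
    (k := 2 * σ) (by linarith)).comp_injective hf
  refine Summable.of_nonneg_of_le (fun α ↦ by positivity) (fun α ↦ ?_) h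
  rcases eq_or_ne α 0 with rfl | hα
  · simp only [gaussNorm, Zsqrtd.norm_zero, Int.natAbs_zero, Nat.cast_zero]
    rw [Real.zero_rpow (by linarith)]
    exact Real.rpow_nonneg (norm_nonneg _) _
  · have h0 : 0 < ‖f α‖ := norm_pos_iff.mpr fun h0 ↦ hα (hf (h0.trans (by ext i; fin_cases i <;> rfl)))
    have h1 : ‖f α‖ ^ 2 ≤ gaussNorm α := by
      have h2 : (gaussNorm α : ℝ) = α.re ^ 2 + α.im ^ 2 := by exact_mod_cast coe_gaussNorm α
      rw [h2]
      refine (pow_le_pow_left₀ h0.le ((pi_norm_le_iff_of_nonneg (Real.sqrt_nonneg _)).mpr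
        (fun i ↦ Real.le_sqrt_of_sq_le ?_)) 2).trans_eq (Real.sq_sqrt (by positivity))
      fin_cases i
      · simp [f, Int.norm_eq_abs, sq_nonneg]
      · simp [f, Int.norm_eq_abs, sq_nonneg]
    simp only [Function.comp_apply]
    rw [show -(2 * σ) = 2 * -σ by ring, Real.rpow_mul h0.le, Real.rpow_two]
    exact Real.rpow_le_rpow_of_nonpos (by positivity) h1 (by linarith)

/-- Since `n^{k+2} rⁿ` is bounded, the terms are dominated by a multiple of `N(α)^{-2}`. -/
lemma summable_gaussNorm_pow_mul (k : ℕ) {r : ℝ} (h0 : 0 ≤ r) (h1 : r < 1) :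
    Summable fun α : GaussianInt ↦ (gaussNorm α : ℝ) ^ k * r ^ gaussNorm α := by
  obtain ⟨C, hC⟩ := (tendsto_pow_const_mul_const_pow_of_lt_one (k + 2) h0 h1).bddAbove_range
  have hs := (summable_gaussNorm_rpow one_lt_two).mul_left C
  rw [← summable_norm_iff] at hs ⊢
  refine Summable.of_norm_bounded_eventually hs ?_
  filter_upwards [(Set.finite_singleton (0 : GaussianInt)).compl_mem_cofinite] with α hα
  have hN : 0 < gaussNorm α := Int.natAbs_pos.mpr fun h ↦
    hα ((Zsqrtd.norm_eq_zero_iff (by norm_num) α).mp h)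
  have hN' : (0 : ℝ) < gaussNorm α := Nat.cast_pos.mpr hN
  have h2 : (gaussNorm α : ℝ) ^ (k + 2) * r ^ gaussNorm α ≤ C := hC ⟨gaussNorm α, rfl⟩
  rw [norm_norm, Real.norm_of_nonneg (by positivity)]
  refine le_trans ?_ (le_abs_self _)
  rw [Real.rpow_neg hN'.le, Real.rpow_two, ← div_eq_mul_inv, le_div_iff₀ (by positivity)]
  refine le_trans (le_of_eq ?_) h2
  ring

end LatticeSums

/-! ### The two eta quotients as theta series with powers of `α` -/

section EtaGaussian

open Complex

lemma HasSum.mul_complex {ι κ : Type*} {f : ι → ℂ} {g : κ → ℂ} {a b : ℂ} (hf : HasSum f a)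
    (hg : HasSum g b) : HasSum (fun x : ι × κ ↦ f x.1 * g x.2) (a * b) :=
  hf.mul hg (summable_mul_of_summable_norm hf.summable.norm hg.summable.norm)

/-- Conjugation permutes the primary integers and fixes the weight `e`, so the imaginary parts of
`g` cancel. Products of theta series give the real parts of `α` or `α²`; this restores the
multiplicative coefficients `α` and `α²`. -/
lemma hasSum_primary_of_conj {f : PrimaryGaussian → ℂ} {g : PrimaryGaussian → ℂ}
    (hg : ∀ α, g (PrimaryGaussian.conj α) = (starRingEnd ℂ) (g α)) {e : PrimaryGaussian → ℂ} {a : ℂ}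
    (he : ∀ α, e (PrimaryGaussian.conj α) = e α)
    (hf : ∀ α, f α = (g α).re * e α) (hs : Summable fun α ↦ g α * e α) (h : HasSum f a) :
    HasSum (fun α ↦ g α * e α) a := by
  have h1 := hs.hasSum
  have h2 := (PrimaryGaussian.conj.hasSum_iff.mpr h1)
  have h3 := (h1.add h2).div_const 2
  have h4 : f = fun α ↦ (g α * e α + ((fun α ↦ g α * e α) ∘ PrimaryGaussian.conj) α) / 2 := by
    ext α
    simp only [Function.comp_apply, hf, hg, he, re_eq_add_conj]
    ring
  rw [← h4] at h3
  rw [h.unique h3]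
  convert h1 using 1
  ring

lemma norm_toComplex_sq (α : GaussianInt) : ‖(α : ℂ)‖ ^ 2 = gaussNorm α := by
  rw [← Complex.normSq_eq_norm_sq, ← GaussianInt.intCast_real_norm, gaussNorm, Nat.cast_natAbs,
    abs_of_nonneg (GaussianInt.norm_nonneg α)]

lemma summable_primary_theta (k : ℕ) {z : ℂ} (hz : 0 < z.im) :
    Summable fun α : PrimaryGaussian ↦ (α.1 : ℂ) ^ k * cexp (2 * Real.pi * Complex.I * z) ^ gaussNorm α.1 := by
  refine Summable.of_norm_bounded_eventually
    (g := fun α : PrimaryGaussian ↦ (gaussNorm α.1 : ℝ) ^ k * ‖cexp (2 * Real.pi * Complex.I * z)‖ ^ gaussNorm α.1)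
    ((summable_gaussNorm_pow_mul k (norm_nonneg _) (norm_cexp_lt_one hz)).comp_injective
      Subtype.val_injective) (Eventually.of_forall fun α ↦ ?_)
  rw [norm_mul, norm_pow, norm_pow]
  gcongr
  rw [← norm_toComplex_sq]
  have h1 : (1 : ℝ) ≤ ‖(α.1 : ℂ)‖ ^ 2 := by
    rw [norm_toComplex_sq, Nat.one_le_cast]
    refine Int.natAbs_pos.mpr fun h ↦ ?_
    rw [Zsqrtd.norm_eq_zero_iff (by norm_num)] at h
    have := α.2.2
    rw [h] at this
    norm_num at this
  nlinarith [norm_nonneg (α.1 : ℂ), (one_le_sq_iff₀ (norm_nonneg (α.1 : ℂ))).mp h1]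

lemma toComplex_conj (α : PrimaryGaussian) :
    ((PrimaryGaussian.conj α).1 : ℂ) = (starRingEnd ℂ) (α.1 : ℂ) :=
  GaussianInt.toComplex_star _

/-- `η(4z)^6` as a theta series of the Gaussian integers. -/
lemma hasSum_eta_pow_six {z : ℂ} (hz : 0 < z.im) :
    HasSum (fun α : PrimaryGaussian ↦
      (α.1 : ℂ) ^ 2 * cexp (2 * Real.pi * Complex.I * z) ^ gaussNorm α.1)
      (ModularForm.eta (4 * z) ^ 6) := by
  have h := hasSum_eta_cube (z := 4 * z) (by simpa using hz)
  have h2 := h.mul_complex h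
  rw [show ModularForm.eta (4 * z) ^ 3 * ModularForm.eta (4 * z) ^ 3 = ModularForm.eta (4 * z) ^ 6 by ring,
    ← primaryEquivSumDiff.symm.hasSum_iff] at h2
  refine hasSum_primary_of_conj (fun α ↦ ?_) (fun α ↦ ?_) (fun α ↦ ?_)
    (summable_primary_theta 2 hz) h2
  · rw [toComplex_conj, map_pow]
  · simp only [PrimaryGaussian.conj, Equiv.coe_fn_mk, gaussNorm_star]
  · obtain ⟨⟨k, l⟩, rfl⟩ := primaryEquivSumDiff.surjective α
    simp only [Function.comp_apply, Equiv.symm_apply_apply]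
    have hN : ((gaussNorm (primaryEquivSumDiff (k, l)).1 : ℤ) : ℂ) =
      (((primaryEquivSumDiff (k, l)).1.re ^ 2 + (primaryEquivSumDiff (k, l)).1.im ^ 2 : ℤ) : ℂ) := by
      rw [coe_gaussNorm]
    have hre : ((((primaryEquivSumDiff (k, l)).1 : ℂ) ^ 2).re : ℂ) =
        (((primaryEquivSumDiff (k, l)).1.re ^ 2 - (primaryEquivSumDiff (k, l)).1.im ^ 2 : ℤ) : ℂ) := by
      rw [GaussianInt.toComplex_def₂, sq, Complex.mul_re]
      push_cast
      ring
    rw [hre, ← exp_nat_mul, mul_mul_mul_comm, ← exp_add]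
    rw [Int.cast_natCast] at hN
    rw [hN]
    simp only [primaryEquivSumDiff, Equiv.coe_fn_mk]
    push_cast
    congr 2 <;> ring

/-- `η(4z)²η(8z)²` as a theta series of the Gaussian integers. -/
lemma hasSum_eta_sq_mul_eta_sq {z : ℂ} (hz : 0 < z.im) :
    HasSum (fun α : PrimaryGaussian ↦
      (α.1 : ℂ) ^ 1 * cexp (2 * Real.pi * Complex.I * z) ^ gaussNorm α.1)
      (ModularForm.eta (4 * z) ^ 2 * ModularForm.eta (8 * z) ^ 2) := by
  -- Jacobi at `8z` times Gauss at `4z` has exponent `(4k+1)² + (2n)² = N(α)` and coefficient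
  -- `(-1)^n (4k+1) = Re α`.
  have h := hasSum_eta_cube (z := 8 * z) (by simpa using hz)
  have h' := hasSum_eta_sq_div (z := 4 * z) (by simpa using hz)
  have h2 := h.mul_complex h'
  have hne : ModularForm.eta (8 * z) ≠ 0 := ModularForm.eta_ne_zero (show 0 < (8 * z).im by simpa using hz)
  rw [show 2 * (4 * z) = 8 * z by ring,
    show ModularForm.eta (8 * z) ^ 3 * (ModularForm.eta (4 * z) ^ 2 / ModularForm.eta (8 * z)) =
      ModularForm.eta (4 * z) ^ 2 * ModularForm.eta (8 * z) ^ 2 by field_simp,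
    ← primaryEquivSigned.symm.hasSum_iff] at h2
  refine hasSum_primary_of_conj (fun α ↦ ?_) (fun α ↦ ?_) (fun α ↦ ?_)
    (summable_primary_theta 1 hz) h2
  · rw [toComplex_conj, map_pow]
  · simp only [PrimaryGaussian.conj, Equiv.coe_fn_mk, gaussNorm_star]
  · obtain ⟨⟨k, n⟩, rfl⟩ := primaryEquivSigned.surjective α
    simp only [Function.comp_apply, Equiv.symm_apply_apply]
    have hN : ((gaussNorm (primaryEquivSigned (k, n)).1 : ℤ) : ℂ) =
      (((primaryEquivSigned (k, n)).1.re ^ 2 + (primaryEquivSigned (k, n)).1.im ^ 2 : ℤ) : ℂ) := by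
      rw [coe_gaussNorm]
    have hre : ((((primaryEquivSigned (k, n)).1 : ℂ) ^ 1).re : ℂ) =
        ((primaryEquivSigned (k, n)).1.re : ℂ) := by
      rw [GaussianInt.toComplex_def₂, pow_one]
      push_cast
      ring
    rw [hre, ← exp_nat_mul, mul_mul_mul_comm, ← exp_add]
    rw [Int.cast_natCast] at hN
    rw [hN]
    simp only [primaryEquivSigned, Equiv.coe_fn_mk]
    split_ifs with h2n
    · rw [Even.neg_one_pow (Nat.even_iff.mpr (by lia))]
      push_cast
      congr 1
      · ring
      · congr 1; ring
    · rw [Odd.neg_one_pow (Nat.odd_iff.mpr (by lia))]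
      push_cast
      congr 1
      · ring
      · congr 1; ring

end EtaGaussian

/-! ### The multiplier system of `η⁶` -/

section EtaMultiplier

open ModularForm MatrixGroups

/-- The sixth power of the Dedekind eta function. -/
noncomputable def etaPowSix (τ : ℍ) : ℂ := ModularForm.eta τ ^ 6

lemma etaPowSix_slash_T : etaPowSix ∣[(3 : ℤ)] ModularGroup.T = Complex.I • etaPowSix := by
  ext z
  rw [SL_slash_apply, modular_T_smul]
  have h : ModularForm.eta ((1 : ℂ) + z) =
      Complex.exp (2 * Real.pi * Complex.I / 24) * ModularForm.eta z := by
    rw [eta_eq_qPochInf, eta_eq_qPochInf, ← mul_assoc, ← Complex.exp_add, mul_add, Complex.exp_add,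
      mul_one, Complex.exp_two_pi_mul_I, one_mul]
    congr 2
    ring
  have hI : Complex.exp (2 * Real.pi * Complex.I / 24) ^ 6 = Complex.I := by
    rw [← Complex.exp_nat_mul, show ((6 : ℕ) : ℂ) * (2 * Real.pi * Complex.I / 24) =
      Real.pi / 2 * Complex.I by push_cast; ring, Complex.exp_pi_div_two_mul_I]
  simp [etaPowSix, denom, ModularGroup.coe_T, h, mul_pow, hI]

lemma etaPowSix_slash_S : etaPowSix ∣[(3 : ℤ)] ModularGroup.S = Complex.I • etaPowSix := by
  ext z
  rw [SL_slash_apply, modular_S_smul]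
  have h := eta_comp_eq_csqrt_I_inv z.2
  have hz := z.ne_zero
  have hp (w : ℂ) (hw : w ≠ 0) : (Complex.sqrt w) ^ 6 = w ^ 3 := by
    rw [sqrt_eq_exp hw, ← Complex.exp_nat_mul,
      show ((6 : ℕ) : ℂ) * (Complex.log w / 2) = (3 : ℕ) * Complex.log w by push_cast; ring,
      Complex.exp_nat_mul, Complex.exp_log hw]
  simp only [Function.comp_apply, Pi.smul_apply, Pi.mul_apply, smul_eq_mul] at h
  have h2 : ModularForm.eta (-1 / z) ^ 6 = Complex.I * (z : ℂ) ^ 3 * ModularForm.eta z ^ 6 := by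
    rw [h, mul_pow, mul_pow, inv_pow, hp _ Complex.I_ne_zero, hp _ hz, Complex.I_pow_three, inv_neg,
      Complex.inv_I]
    ring
  have h3 : ((-(z : ℂ))⁻¹) = -1 / z := by rw [inv_neg, neg_div, one_div]
  simp only [etaPowSix, h3, h2, ModularGroup.denom_S, Pi.smul_apply, smul_eq_mul]
  field_simp

/-- The exponent of `i` in the multiplier system of `η^6`, as a function of the entries modulo `4`. -/
def etaMultiplier (a b c d : ZMod 4) : ZMod 4 :=
  if c = 1 ∨ c = 3 then (a + d - 3) * c else d * (b - c + 3) - 3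

/-- A finite check of the closed formula: right multiplication by `T` adds `1` to the exponent, by
`T⁻¹` it adds `3`. The next lemma does the same for `S`. -/
lemma etaMultiplier_T : ∀ a b c d : ZMod 4, a * d - b * c = 1 →
    etaMultiplier a (a + b) c (c + d) = etaMultiplier a b c d + 1 ∧
    etaMultiplier a (-a + b) c (-c + d) = etaMultiplier a b c d + 3 := by decide

lemma etaMultiplier_S : ∀ a b c d : ZMod 4, a * d - b * c = 1 →
    etaMultiplier b (-a) d (-c) = etaMultiplier a b c d + 1 ∧
    etaMultiplier (-b) a (-d) c = etaMultiplier a b c d + 3 := by decide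

lemma I_pow_val_add (x : ZMod 4) (n : ℕ) :
    Complex.I ^ (x + n).val = Complex.I ^ x.val * Complex.I ^ n := by
  rw [← pow_add, ZMod.val_add, ZMod.val_natCast, Nat.add_mod_mod,
    Complex.I_pow_eq_pow_mod (x.val + n)]

/-- Both generators act on `η⁶` by `i`. Induction on words in `S`, `T` and their inverses keeps the
exponent in step with the formula, whose values on the entries modulo `4` are then all that matters.
-/
lemma etaPowSix_slash (γ : SL(2, ℤ)) :
    etaPowSix ∣[(3 : ℤ)] γ =
      Complex.I ^ (etaMultiplier (γ 0 0) (γ 0 1) (γ 1 0) (γ 1 1)).val • etaPowSix := by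
  have hmem : γ ∈ Subgroup.closure {ModularGroup.S, ModularGroup.T} := by
    simp [_root_.SpecialLinearGroup.SL2Z_generators]
  have hdet (γ : SL(2, ℤ)) :
      ((γ 0 0 : ℤ) : ZMod 4) * (γ 1 1 : ℤ) - (γ 0 1 : ℤ) * (γ 1 0 : ℤ) = 1 := by
    have := γ.det_coe
    rw [Matrix.det_fin_two] at this
    exact_mod_cast congrArg (Int.cast : ℤ → ZMod 4) this
  have hinv {g : SL(2, ℤ)} (hg : etaPowSix ∣[(3 : ℤ)] g = Complex.I • etaPowSix) :
      etaPowSix ∣[(3 : ℤ)] g⁻¹ = Complex.I ^ 3 • etaPowSix := by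
    have h := congrArg (fun f ↦ Complex.I ^ 3 • (f ∣[(3 : ℤ)] g⁻¹)) hg
    simp only [← SlashAction.slash_mul, mul_inv_cancel, SlashAction.slash_one, SL_smul_slash,
      smul_smul, ← pow_succ] at h
    rw [Complex.I_pow_four, one_smul] at h
    exact h.symm
  induction hmem using Subgroup.closure_induction_right with
  | one => simp [etaMultiplier]
  | mul_right x hx y hy ih =>
    rw [SlashAction.slash_mul, ih, SL_smul_slash]
    rcases hy with rfl | rfl
    · rw [etaPowSix_slash_S, smul_smul]
      have := (etaMultiplier_S _ _ _ _ (hdet x)).1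
      have h2 := I_pow_val_add (etaMultiplier (x 0 0) (x 0 1) (x 1 0) (x 1 1)) 1
      rw [pow_one, Nat.cast_one, ← this] at h2
      rw [← h2]
      simp [Matrix.SpecialLinearGroup.coe_mul, ModularGroup.coe_S, Matrix.mul_apply, Fin.sum_univ_two]
    · rw [etaPowSix_slash_T, smul_smul]
      have := (etaMultiplier_T _ _ _ _ (hdet x)).1
      have h2 := I_pow_val_add (etaMultiplier (x 0 0) (x 0 1) (x 1 0) (x 1 1)) 1
      rw [pow_one, Nat.cast_one, ← this] at h2
      rw [← h2]
      simp [Matrix.SpecialLinearGroup.coe_mul, ModularGroup.coe_T, Matrix.mul_apply, Fin.sum_univ_two]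
  | mul_inv_cancel x hx y hy ih =>
    rw [SlashAction.slash_mul, ih, SL_smul_slash]
    rcases hy with rfl | rfl
    · rw [hinv etaPowSix_slash_S, smul_smul]
      have := (etaMultiplier_S _ _ _ _ (hdet x)).2
      have h2 := I_pow_val_add (etaMultiplier (x 0 0) (x 0 1) (x 1 0) (x 1 1)) 3
      rw [show ((3 : ℕ) : ZMod 4) = 3 from rfl, ← this] at h2
      rw [← h2]
      simp [Matrix.SpecialLinearGroup.coe_mul, Matrix.SpecialLinearGroup.coe_inv, ModularGroup.coe_S, Matrix.mul_apply, Fin.sum_univ_two, Matrix.adjugate_fin_two]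
    · rw [hinv etaPowSix_slash_T, smul_smul]
      have := (etaMultiplier_T _ _ _ _ (hdet x)).2
      have h2 := I_pow_val_add (etaMultiplier (x 0 0) (x 0 1) (x 1 0) (x 1 1)) 3
      rw [show ((3 : ℕ) : ZMod 4) = 3 from rfl, ← this] at h2
      rw [← h2]
      simp [Matrix.SpecialLinearGroup.coe_mul, Matrix.SpecialLinearGroup.coe_inv, ModularGroup.coe_T, Matrix.mul_apply, Fin.sum_univ_two, Matrix.adjugate_fin_two]

end EtaMultiplier

/-! ### `η(4τ)⁶` as a cusp form for `Γ₁(16)` -/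

section CuspForm

open ModularForm MatrixGroups Filter Topology

/-- The point `4τ` of the upper half-plane. -/
def fourMul (τ : ℍ) : ℍ := ⟨4 * (τ : ℂ), by simpa using τ.im_pos⟩

/-- Conjugation by `diag(4, 1)` sends a matrix of `Γ₁(16)` to one congruent to the identity modulo
`4`, where the multiplier of `η⁶` is trivial. -/
lemma slash_fourMul {A : SL(2, ℤ)} (hA : A ∈ Gamma1 16) :
    (fun τ ↦ etaPowSix (fourMul τ)) ∣[(3 : ℤ)] A = fun τ ↦ etaPowSix (fourMul τ) := by
  obtain ⟨ha, hd, hc⟩ := (Gamma1_mem 16 A).mp hA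
  obtain ⟨c, hc'⟩ := (ZMod.intCast_zmod_eq_zero_iff_dvd _ 16).mp hc
  have hdet := A.det_coe
  rw [Matrix.det_fin_two] at hdet
  have h4 (x : ℤ) (hx : (x : ZMod 16) = 1) : (x : ZMod 4) = 1 := by
    have := congrArg (ZMod.castHom (show 4 ∣ 16 by norm_num) (ZMod 4)) hx
    simpa using this
  let B : SL(2, ℤ) := ⟨!![A 0 0, 4 * A 0 1; 4 * c, A 1 1], by
    rw [Matrix.det_fin_two_of]
    push_cast at hc'
    rw [hc'] at hdet
    linarith⟩
  have hB := etaPowSix_slash B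
  have hm : etaMultiplier (B 0 0) (B 0 1) (B 1 0) (B 1 1) = 0 := by
    have e1 : ((B 0 0 : ℤ) : ZMod 4) = 1 := h4 _ ha
    have e2 : ((B 1 1 : ℤ) : ZMod 4) = 1 := h4 _ hd
    have e3 : ((B 0 1 : ℤ) : ZMod 4) = 0 := by
      change ((4 * A 0 1 : ℤ) : ZMod 4) = 0
      push_cast
      rw [show (4 : ZMod 4) = 0 from rfl, zero_mul]
    have e4 : ((B 1 0 : ℤ) : ZMod 4) = 0 := by
      change ((4 * c : ℤ) : ZMod 4) = 0
      push_cast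
      rw [show (4 : ZMod 4) = 0 from rfl, zero_mul]
    rw [e1, e2, e3, e4]
    decide
  rw [hm, ZMod.val_zero, pow_zero, one_smul] at hB
  ext τ
  have h1 := (slash_action_eq'_iff 3 etaPowSix B (fourMul τ)).mp (congrFun hB _)
  rw [slash_action_eq'_iff]
  have h2 : fourMul (A • τ) = B • fourMul τ := by
    ext
    rw [UpperHalfPlane.coe_specialLinearGroup_apply]
    simp only [fourMul, UpperHalfPlane.coe_mk]
    rw [UpperHalfPlane.coe_specialLinearGroup_apply]
    simp [B, hc']
    ring
  rw [h2, h1]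
  congr 2
  simp [B, fourMul, hc']
  ring

/-- `η(4τ)^6` as a cusp form for `Γ₁(16)`. -/
noncomputable def etaCuspForm : CuspFormsWeightThreeLevelSixteen where
  toFun τ := etaPowSix (fourMul τ)
  slash_action_eq' A hA := by
    obtain ⟨A, hA, rfl⟩ := hA
    exact slash_fourMul hA
  holo' := by
    rw [UpperHalfPlane.mdifferentiable_iff]
    have h : DifferentiableOn ℂ (fun z : ℂ ↦ ModularForm.eta (4 * z) ^ 6) {z | 0 < z.im} :=
      fun z hz ↦ (((differentiableAt_eta_of_mem_upperHalfPlaneSet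
        (show 0 < (4 * z).im by simpa using hz)).comp z (by fun_prop : DifferentiableAt ℂ (fun z ↦ 4 * z) z)).pow
        6).differentiableWithinAt
    refine h.congr fun z hz ↦ ?_
    simp [etaPowSix, fourMul, ofComplex_apply_of_im_pos hz]
  zero_at_cusps' {c} hc := by
    rw [Subgroup.IsArithmetic.isCusp_iff_isCusp_SL2Z] at hc
    rw [OnePoint.isZeroAt_iff_forall_SL2Z hc]
    intro γ hγ
    -- Vanishing at the cusps is inherited from the discriminant, since `(η(4τ)⁶)⁴ = Δ(4τ)`. The
    -- rational matrix `g` maps cusps to cusps.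
    let g : GL (Fin 2) ℚ := Matrix.GeneralLinearGroup.mkOfDetNeZero !![4, 0; 0, 1] (by simp)
    let g' : GL (Fin 2) ℝ := g.map (algebraMap ℚ ℝ)
    have h1 : IsCusp (g' • c) 𝒮ℒ := by
      rw [isCusp_SL2Z_iff] at hc ⊢
      obtain ⟨x, rfl⟩ := hc
      exact ⟨g • x, by rw [← Rat.coe_castHom, OnePoint.map_smul]; rfl⟩
    have h2 := OnePoint.IsZeroAt.smul_iff.mp (CuspForm.discriminant.zero_at_cusps' h1)
    have h3 := (OnePoint.isZeroAt_iff_forall_SL2Z hc).mp h2 γ hγ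
    -- The constant is the normalization `det^{k-1} = 4^{11}` of the weight-`12` slash action.
    have hk (h : SL(2, ℤ)) (τ : ℍ) : ((ModularForm.discriminant ∣[(12 : ℤ)] g') ∣[(12 : ℤ)] h) τ =
        4 ^ 11 * (((fun τ ↦ etaPowSix (fourMul τ)) ∣[(3 : ℤ)] h) τ) ^ 4 := by
      have hdet : g'.det.val = 4 := by
        simp [g', g, Matrix.GeneralLinearGroup.mkOfDetNeZero, Matrix.det_fin_two]
      have hg (τ : ℍ) : g' • τ = fourMul τ := by
        ext
        rw [UpperHalfPlane.coe_smul_of_det_pos (by rw [hdet]; norm_num)]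
        simp [num, denom, g', g, fourMul, Matrix.GeneralLinearGroup.mkOfDetNeZero]
      rw [SL_slash_apply, SL_slash_apply, slash_apply, hg, hdet]
      have hσ (w : ℂ) : σ g' w = w := by simp [σ, hdet]
      have hd (τ : ℍ) : denom g' τ = 1 := by
        simp [denom, g', g, Matrix.GeneralLinearGroup.mkOfDetNeZero]
      rw [hσ, hd, mul_pow, ← zpow_natCast (denom _ _ ^ (-3 : ℤ)), ← zpow_mul]
      simp [ModularForm.discriminant, etaPowSix, fourMul, ← pow_mul]
      ring
    have h4 : Tendsto (fun τ ↦ ‖((ModularForm.discriminant ∣[(12 : ℤ)] g') ∣[(12 : ℤ)] γ) τ‖)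
        atImInfty (𝓝 0) := tendsto_zero_iff_norm_tendsto_zero.mp h3
    simp only [hk, norm_mul, norm_pow, Complex.norm_ofNat] at h4
    have h5 := (((h4.const_mul (4 ^ 11 : ℝ)⁻¹).congr fun τ ↦
      inv_mul_cancel_left₀ (by norm_num) _).sqrt).sqrt
    rw [mul_zero, Real.sqrt_zero, Real.sqrt_zero] at h5
    refine tendsto_zero_iff_norm_tendsto_zero.mpr (h5.congr fun τ ↦ ?_)
    rw [show ∀ x : ℝ, x ^ 4 = (x ^ 2) ^ 2 by intro x; ring, Real.sqrt_sq (by positivity),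
      Real.sqrt_sq (norm_nonneg _)]

@[simp] lemma etaCuspForm_apply (τ : ℍ) : etaCuspForm τ = ModularForm.eta (4 * (τ : ℂ)) ^ 6 := rfl

end CuspForm

/-! ### Dirichlet series indexed through a norm map -/

section DirichletSeries

/-- The coefficient at `n` of the Dirichlet series `∑ᵢ cᵢ (N i)^{-s}`. -/
noncomputable def fiberCoeff {ι : Type*} (N : ι → ℕ) (c : ι → ℂ) (n : ℕ) : ℂ :=
  ∑' i : {i // N i = n}, c i

lemma HasSum.fiberCoeff {ι : Type*} {N : ι → ℕ} {c : ι → ℂ} {f : ℕ → ℂ} {a : ℂ}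
    (h : HasSum (fun i ↦ c i * f (N i)) a) : HasSum (fun n ↦ _root_.fiberCoeff N c n * f n) a := by
  have h1 := (Equiv.sigmaFiberEquiv N).hasSum_iff.mpr h
  refine h1.sigma fun n ↦ ?_
  have h2 : (fun i : {i // N i = n} ↦ ((fun i ↦ c i * f (N i)) ∘ (Equiv.sigmaFiberEquiv N)) ⟨n, i⟩) =
      fun i : {i // N i = n} ↦ c i * f n := by
    ext ⟨i, hi⟩
    simp [Equiv.sigmaFiberEquiv, hi]
  rw [_root_.fiberCoeff, ← tsum_mul_right, h2]
  have h3 : Summable fun i : {i // N i = n} ↦ c i * f n := by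
    have := h.summable.comp_injective (Subtype.val_injective (p := fun i ↦ N i = n))
    refine this.congr fun i ↦ ?_
    simp only [Function.comp_apply, i.2]
  exact h3.hasSum

lemma lseries_term_eq {c : ℕ → ℂ} {s : ℂ} (hs : s ≠ 0) (n : ℕ) :
    LSeries.term c s n = c n * (n : ℂ) ^ (-s) := by
  rcases eq_or_ne n 0 with rfl | hn
  · simp [LSeries.term, Complex.zero_cpow (neg_ne_zero.mpr hs)]
  · rw [LSeries.term_of_ne_zero hn, Complex.cpow_neg, div_eq_mul_inv]

lemma HasSum.lseriesHasSum {ι : Type*} {N : ι → ℕ} {c : ι → ℂ} {a s : ℂ} (hs : s ≠ 0)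
    (h : HasSum (fun i ↦ c i * (N i : ℂ) ^ (-s)) a) :
    LSeriesHasSum (_root_.fiberCoeff N c) s a := by
  have h1 := HasSum.fiberCoeff (f := fun n ↦ (n : ℂ) ^ (-s)) h
  exact h1.congr_fun fun n ↦ lseries_term_eq hs n

/-- Dirichlet series that agree far to the right have the same coefficients. -/
lemma fiberCoeff_eq_of_hasSum {ι κ : Type*} {N : ι → ℕ} {c : ι → ℂ} {N' : κ → ℕ} {c' : κ → ℂ} {σ : ℝ}
    (h : ∀ s : ℝ, σ < s → ∃ a, HasSum (fun i ↦ c i * (N i : ℂ) ^ (-(s : ℂ))) a ∧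
      HasSum (fun j ↦ c' j * (N' j : ℂ) ^ (-(s : ℂ))) a) {n : ℕ} (hn : n ≠ 0) :
    fiberCoeff N c n = fiberCoeff N' c' n := by
  have key : ∀ s : ℝ, max σ 0 < s → ∃ a, LSeriesHasSum (fiberCoeff N c) s a ∧
      LSeriesHasSum (fiberCoeff N' c') s a := fun s hs ↦ by
    obtain ⟨a, h1, h2⟩ := h s ((le_max_left _ _).trans_lt hs)
    have h0 : (s : ℂ) ≠ 0 := by
      exact_mod_cast ((le_max_right _ _).trans_lt hs).ne'
    exact ⟨a, h1.lseriesHasSum h0, h2.lseriesHasSum h0⟩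
  obtain ⟨a, h1, h2⟩ := key (max σ 0 + 1) (lt_add_one _)
  refine LSeries.eq_of_LSeries_eventually_eq
    (h1.LSeriesSummable.abscissaOfAbsConv_le.trans_lt (EReal.coe_lt_top _))
    (h2.LSeriesSummable.abscissaOfAbsConv_le.trans_lt (EReal.coe_lt_top _)) ?_ hn
  filter_upwards [eventually_gt_atTop (max σ 0)] with s hs
  obtain ⟨a, h1, h2⟩ := key s hs
  rw [h1.LSeries_eq, h2.LSeries_eq]

end DirichletSeries

/-! ### `L`-series of the eta quotients as sums over primary integers -/

section ThetaLSeries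

open Complex

instance : Countable PrimaryGaussian := primaryEquivSumDiff.symm.injective.countable

lemma gaussNorm_pos {α : GaussianInt} (h : α ≠ 0) : 0 < gaussNorm α :=
  Int.natAbs_pos.mpr fun h0 ↦ h ((Zsqrtd.norm_eq_zero_iff (by norm_num) α).mp h0)

lemma IsPrimary.ne_zero {α : GaussianInt} (h : IsPrimary α) : α ≠ 0 := by
  rintro rfl
  have := h.2
  norm_num at this

lemma norm_toComplex_eq_rpow (α : GaussianInt) : ‖(α : ℂ)‖ = (gaussNorm α : ℝ) ^ (1 / 2 : ℝ) := by
  rw [← norm_toComplex_sq, ← Real.sqrt_eq_rpow, Real.sqrt_sq (norm_nonneg _)]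

lemma summable_primary_rpow (k : ℕ) {σ : ℝ} (hσ : k / 2 + 1 < σ) :
    Summable fun α : PrimaryGaussian ↦ ‖(α.1 : ℂ) ^ k‖ * (gaussNorm α.1 : ℝ) ^ (-σ) := by
  have h := (summable_gaussNorm_rpow (σ := σ - k / 2) (by linarith)).comp_injective
    (Subtype.val_injective (p := IsPrimary))
  refine h.congr fun α ↦ ?_
  have h0 : (0 : ℝ) < gaussNorm α.1 := Nat.cast_pos.mpr (gaussNorm_pos α.2.ne_zero)
  rw [Function.comp_apply, norm_pow, norm_toComplex_eq_rpow, ← Real.rpow_natCast, ← Real.rpow_mul h0.le,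
    ← Real.rpow_add h0]
  congr 1
  ring

/-- The `L`-series of `η(4τ)^6` as a sum over the primary Gaussian integers. -/
lemma hasSum_cuspL_etaCuspForm {s : ℂ} (hs : 2 < s.re) :
    HasSum (fun α : PrimaryGaussian ↦ (α.1 : ℂ) ^ 2 * (gaussNorm α.1 : ℂ) ^ (-s))
      (cuspL etaCuspForm s) := by
  have hs0 : 0 < s.re := by linarith
  -- On `τ = it` the theta terms are `α² e^{-π(2N)t}`, hence the parameter `2N`. The factor
  -- `2/Γ_ℂ(s) = (2π)^s/Γ(s)` below undoes the Mellin normalization.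
  have h := hasSum_mellin_pi_mul (ι := PrimaryGaussian) (a := fun α ↦ (α.1 : ℂ) ^ 2)
    (q := fun α ↦ 2 * (gaussNorm α.1 : ℝ)) (s := s)
    (F := fun t ↦ etaCuspForm (ofComplex (Complex.I * t)))
    (fun α ↦ Or.inr (mul_pos two_pos (Nat.cast_pos.mpr (gaussNorm_pos α.2.ne_zero)))) hs0 ?_ ?_
  · have h2 := h.mul_right (2 / Gammaℂ s)
    rw [← CuspForm.Λ_eq_mellin (by norm_num : (0 : ℤ) < 3)] at h2
    refine h2.congr_fun fun α ↦ ?_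
    have hN : (0 : ℝ) < gaussNorm α.1 := Nat.cast_pos.mpr (gaussNorm_pos α.2.ne_zero)
    have h2s : ((2 : ℝ) : ℂ) ^ s ≠ 0 := by simp [cpow_eq_zero_iff]
    have hpi : (Real.pi : ℂ) ^ s ≠ 0 := by simp [cpow_eq_zero_iff, Real.pi_ne_zero]
    have hNs : (gaussNorm α.1 : ℂ) ^ s ≠ 0 := by
      have : (gaussNorm α.1 : ℂ) ≠ 0 := by exact_mod_cast hN.ne'
      simp [cpow_eq_zero_iff, this]
    have hG := Gamma_ne_zero_of_re_pos hs0
    rw [ofReal_mul, mul_cpow_ofReal_nonneg zero_le_two hN.le, Gammaℂ, ← ofReal_ofNat,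
      cpow_neg, cpow_neg, cpow_neg, mul_cpow_ofReal_nonneg zero_le_two Real.pi_pos.le, ofReal_natCast]
    field_simp
  · intro t ht
    have ht' : 0 < (Complex.I * t).im := by simpa using ht
    have h := hasSum_eta_pow_six (z := Complex.I * t) ht'
    rw [etaCuspForm_apply, ofComplex_apply_of_im_pos ht']
    refine h.congr_fun fun α ↦ ?_
    rw [← exp_nat_mul, ofReal_exp]
    congr 2
    push_cast
    linear_combination (-2 * (Real.pi : ℂ) * t * gaussNorm α.1) * I_sq
  · have := (summable_primary_rpow 2 (σ := s.re) (by norm_num; linarith)).mul_left ((2 : ℝ) ^ s.re)⁻¹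
    refine this.congr fun α ↦ ?_
    rw [Real.mul_rpow zero_le_two (Nat.cast_nonneg _), Real.rpow_neg (Nat.cast_nonneg _)]
    field_simp

/-- The exponents of the theta series are integers. Together with holomorphy and boundedness at
`i∞`, this identifies the `q`-expansion of the bare function without using its modularity. -/
lemma periodic_etaQuotient32 : Function.Periodic (etaQuotient32 ∘ ofComplex) (1 : ℝ) := fun z ↦ by
  rw [Complex.ofReal_one]
  rcases lt_or_ge 0 z.im with hz | hz
  · have hz1 : 0 < (z + 1).im := by simpa using hz
    have h1 := hasSum_eta_sq_mul_eta_sq hz1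
    rw [show 2 * Real.pi * Complex.I * (z + 1) = 2 * Real.pi * Complex.I * z + 2 * Real.pi * Complex.I by
      ring, exp_add, exp_two_pi_mul_I, mul_one] at h1
    rw [Function.comp_apply, Function.comp_apply, ofComplex_apply_of_im_pos hz,
      ofComplex_apply_of_im_pos hz1]
    exact h1.unique (hasSum_eta_sq_mul_eta_sq hz)
  · simp [ofComplex_apply_of_im_nonpos hz,
      ofComplex_apply_of_im_nonpos (show (z + 1).im ≤ 0 by simpa using hz)]

lemma differentiableOn_eta_mul_sq {c : ℂ} (hc : 0 < c.re) (hc' : c.im = 0) :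
    DifferentiableOn ℂ (fun z : ℂ ↦ ModularForm.eta (c * z) ^ 2) {z | 0 < z.im} := by
  intro z hz
  have h : 0 < (c * z).im := by simpa [hc'] using mul_pos hc hz
  exact (((ModularForm.differentiableAt_eta_of_mem_upperHalfPlaneSet h).comp z
    ((differentiableAt_id).const_mul c)).pow 2).differentiableWithinAt

lemma mdifferentiable_etaQuotient32 :
    MDifferentiable (modelWithCornersSelf ℂ ℂ) (modelWithCornersSelf ℂ ℂ) etaQuotient32 := by
  rw [UpperHalfPlane.mdifferentiable_iff]
  refine ((differentiableOn_eta_mul_sq (c := 4) (by norm_num) (by norm_num)).mul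
    (differentiableOn_eta_mul_sq (c := 8) (by norm_num) (by norm_num))).congr fun z hz ↦ ?_
  rw [Function.comp_apply, ofComplex_apply_of_im_pos hz]
  rfl

lemma hasSum_etaQuotient32 (τ : ℍ) : HasSum (fun m ↦ fiberCoeff (fun α : PrimaryGaussian ↦ gaussNorm α.1)
    (fun α ↦ (α.1 : ℂ)) m • Function.Periodic.qParam 1 τ ^ m) (etaQuotient32 τ) := by
  have h := hasSum_eta_sq_mul_eta_sq τ.im_pos
  simp only [pow_one] at h
  have h2 := HasSum.fiberCoeff (N := fun α : PrimaryGaussian ↦ gaussNorm α.1)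
    (c := fun α ↦ (α.1 : ℂ)) (f := fun n ↦ cexp (2 * Real.pi * Complex.I * τ) ^ n) h
  simpa [Function.Periodic.qParam, etaQuotient32] using h2

lemma qExpansion_etaQuotient32_coeff (n : ℕ) :
    (qExpansion 1 etaQuotient32).coeff n =
      fiberCoeff (fun α : PrimaryGaussian ↦ gaussNorm α.1) (fun α ↦ (α.1 : ℂ)) n := by
  have hq := hasSum_etaQuotient32
  have hb : IsBoundedAtImInfty etaQuotient32 :=
    isBoundedAtImInfty_of_hasSum_qExpansion (h := 1) one_pos hq
  have ha : AnalyticAt ℂ (cuspFunction 1 etaQuotient32) 0 :=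
    analyticAt_cuspFunction_zero one_pos periodic_etaQuotient32 mdifferentiable_etaQuotient32 hb
  -- The uniqueness lemma for `q`-expansions expects a function-like type; plain functions are made
  -- into one locally.
  let : FunLike (ℍ → ℂ) ℍ ℂ := ⟨fun f ↦ f, fun _ _ h ↦ h⟩
  exact (qExpansion_coeff_unique (F := ℍ → ℂ) etaQuotient32 one_pos ha hq n).symm

lemma hasSum_LSeries_etaQuotient32 {s : ℂ} (hs : 3 / 2 < s.re) :
    HasSum (fun α : PrimaryGaussian ↦ (α.1 : ℂ) * (gaussNorm α.1 : ℂ) ^ (-s))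
      (LSeries (fun n ↦ (qExpansion 1 etaQuotient32).coeff n) s) := by
  have hs0 : s ≠ 0 := fun h ↦ by norm_num [h] at hs
  have h1 : Summable fun α : PrimaryGaussian ↦ (α.1 : ℂ) * (gaussNorm α.1 : ℂ) ^ (-s) := by
    refine Summable.of_norm ((summable_primary_rpow 1 (σ := s.re) (by norm_num; linarith)).congr
      fun α ↦ ?_)
    rw [norm_mul, pow_one, norm_natCast_cpow_of_pos (gaussNorm_pos α.2.ne_zero), neg_re]
  have h2 := h1.hasSum.lseriesHasSum hs0
  simp only [qExpansion_etaQuotient32_coeff]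
  rw [h2.LSeries_eq]
  exact h1.hasSum

end ThetaLSeries

/-! ### A cusp form is determined by its `L`-function -/

section Uniqueness

lemma one_mem_strictPeriods : (1 : ℝ) ∈ ((Gamma1 16).map (mapGL ℝ)).strictPeriods := by
  simp

lemma lseriesHasSum_cuspL (g : CuspFormsWeightThreeLevelSixteen) {s : ℂ} (hs : 5 / 2 < s.re) :
    LSeriesHasSum (fun n ↦ (qExpansion 1 g).coeff n) s (cuspL g s) := by
  have hs0 : s ≠ 0 := fun h ↦ by norm_num [h] at hs
  have h := CuspForm.hasSum_L (Γ := (Gamma1 16).map (mapGL ℝ)) (k := 3) (by norm_num) g (s := s)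
    (by norm_num; linarith)
  simp only [strictWidthInfty_Gamma1, Complex.ofReal_one, Complex.one_cpow, one_mul] at h
  refine h.congr_fun fun n ↦ ?_
  rw [lseries_term_eq hs0, Complex.cpow_neg, div_eq_mul_inv]

/-- A cusp form is determined by its `L`-function. -/
lemma cuspForm_ext_of_cuspL {f g : CuspFormsWeightThreeLevelSixteen}
    (h : ∀ s : ℂ, 5 / 2 < s.re → cuspL f s = cuspL g s) (τ : ℍ) : f τ = g τ := by
  have hc : ∀ n, (qExpansion 1 f).coeff n = (qExpansion 1 g).coeff n := by
    intro n
    rcases eq_or_ne n 0 with rfl | hn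
    · rw [CuspFormClass.qExpansion_coeff_zero f one_pos one_mem_strictPeriods,
        CuspFormClass.qExpansion_coeff_zero g one_pos one_mem_strictPeriods]
    · have h3 (f : CuspFormsWeightThreeLevelSixteen) :=
        (lseriesHasSum_cuspL f (s := 3) (by norm_num)).LSeriesSummable.abscissaOfAbsConv_le.trans_lt
          (EReal.coe_lt_top _)
      refine LSeries.eq_of_LSeries_eventually_eq (f := fun n ↦ (qExpansion 1 f).coeff n)
        (g := fun n ↦ (qExpansion 1 g).coeff n) (h3 f) (h3 g) ?_ hn
      filter_upwards [eventually_gt_atTop (5 / 2 : ℝ)] with s hs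
      rw [(lseriesHasSum_cuspL f (s := s) (by simpa using hs)).LSeries_eq,
        (lseriesHasSum_cuspL g (s := s) (by simpa using hs)).LSeries_eq, h s (by simpa using hs)]
  have : Fact (IsCusp OnePoint.infty ((Gamma1 16).map (mapGL ℝ))) :=
    ⟨Subgroup.isCusp_of_mem_strictPeriods one_pos one_mem_strictPeriods⟩
  have h1 := ModularForm.hasSum_qExpansion f one_pos one_mem_strictPeriods τ
  simp only [hc] at h1
  exact h1.unique (ModularForm.hasSum_qExpansion g one_pos one_mem_strictPeriods τ)

end Uniqueness

/-! ### The lemniscatic differential equation and the beta integral -/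

section LemniscaticODE

open Set

/-- A real solution on `(0, 4)` of the differential equation of a lemniscatic Weierstrass function,
with a pole at `0` and a zero at `2`. -/
structure IsLemniscatic (f : ℝ → ℝ) (g : ℝ) : Prop where
  analytic : AnalyticOnNhd ℝ f (Ioo 0 4)
  deriv_sq : ∀ t ∈ Ioo (0 : ℝ) 4, deriv f t ^ 2 = 4 * f t ^ 3 - g * f t
  tendsto_zero : Tendsto f (𝓝[>] 0) atTop
  map_two : f 2 = 0

namespace IsLemniscatic

variable {f : ℝ → ℝ} {g : ℝ}

lemma hasDerivAt (h : IsLemniscatic f g) {t : ℝ} (ht : t ∈ Ioo (0 : ℝ) 4) :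
    HasDerivAt f (deriv f t) t :=
  (h.analytic t ht).differentiableAt.hasDerivAt

lemma deriv_ne_zero_somewhere (h : IsLemniscatic f g) {b : ℝ} (hb : 0 < b) (hb4 : b ≤ 4) :
    ∃ t ∈ Ioo 0 b, deriv f t ≠ 0 := by
  by_contra! hc
  have hconst : ∀ t ∈ Ioo 0 b, f t = f (b / 2) := fun t ht ↦
    (convex_Ioo 0 b).is_const_of_fderivWithin_eq_zero (𝕜 := ℝ)
      (fun x hx ↦ (h.hasDerivAt ⟨hx.1, hx.2.trans_le hb4⟩).differentiableAt.differentiableWithinAt)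
      (fun x hx ↦ by
        rw [fderivWithin_of_isOpen isOpen_Ioo hx]
        ext
        simpa using hc x hx) ht ⟨by linarith, by linarith⟩
  obtain ⟨t, ht, ht'⟩ := ((h.tendsto_zero.eventually (eventually_gt_atTop (f (b / 2)))).and
    (Ioo_mem_nhdsGT hb)).exists
  exact ht.ne' (hconst t ht')

/-- Differentiating the first-order equation gives `f' · (f'' - 6f² + g/2) = 0`. One analytic factor
must vanish identically, and it is not `f'`, because `f` is unbounded near `0`. The second-order
equation has unique solutions, unlike the first-order one. -/
lemma deriv_deriv (h : IsLemniscatic f g) {t : ℝ} (ht : t ∈ Ioo (0 : ℝ) 4) :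
    deriv (deriv f) t = 6 * f t ^ 2 - g / 2 := by
  have hf' : AnalyticOnNhd ℝ (deriv f) (Ioo 0 4) := h.analytic.deriv
  have hq : AnalyticOnNhd ℝ (fun t ↦ deriv (deriv f) t - (6 * f t ^ 2 - g / 2)) (Ioo 0 4) :=
    hf'.deriv.sub ((analyticOnNhd_const.mul (h.analytic.pow 2)).sub analyticOnNhd_const)
  have hmul : ∀ t ∈ Ioo (0 : ℝ) 4,
      deriv f t * (deriv (deriv f) t - (6 * f t ^ 2 - g / 2)) = 0 := fun t ht ↦ by
    have h1 : HasDerivAt (fun t ↦ deriv f t ^ 2) (2 * deriv f t * deriv (deriv f) t) t := by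
      simpa using! (hf' t ht).differentiableAt.hasDerivAt.pow 2
    have h2 : HasDerivAt (fun t ↦ 4 * f t ^ 3 - g * f t) (4 * (3 * f t ^ 2 * deriv f t) - g * deriv f t) t := by
      simpa using! (((h.hasDerivAt ht).pow 3).const_mul 4).sub ((h.hasDerivAt ht).const_mul g)
    have h3 := h1.unique (h2.congr_of_eventuallyEq
      (by filter_upwards [isOpen_Ioo.mem_nhds ht] with t ht using h.deriv_sq t ht))
    linear_combination h3 / 2
  rcases hf'.eq_zero_or_eq_zero_of_mul_eq_zero hq hmul isPreconnected_Ioo with h0 | h0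
  · obtain ⟨t, ht, ht'⟩ := h.deriv_ne_zero_somewhere (b := 4) (by norm_num) le_rfl
    exact absurd (h0 t ht) ht'
  · exact sub_eq_zero.mp (h0 t ht)

/-- Local uniqueness for the second order equation `y'' = 6 y² - g / 2`. -/
lemma eventuallyEq_of_ode {y₁ y₂ : ℝ → ℝ} {t₀ : ℝ}
    (h1 : ∀ᶠ t in 𝓝 t₀, HasDerivAt y₁ (deriv y₁ t) t ∧ HasDerivAt (deriv y₁) (6 * y₁ t ^ 2 - g / 2) t)
    (h2 : ∀ᶠ t in 𝓝 t₀, HasDerivAt y₂ (deriv y₂ t) t ∧ HasDerivAt (deriv y₂) (6 * y₂ t ^ 2 - g / 2) t)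
    (h0 : y₁ t₀ = y₂ t₀) (h0' : deriv y₁ t₀ = deriv y₂ t₀) : y₁ =ᶠ[𝓝 t₀] y₂ := by
  let v : ℝ × ℝ → ℝ × ℝ := fun p ↦ (p.2, 6 * p.1 ^ 2 - g / 2)
  have hv : ContDiff ℝ 1 v := by fun_prop
  obtain ⟨K, s, hs, hK⟩ := (hv.contDiffAt (x := (y₁ t₀, deriv y₁ t₀))).exists_lipschitzOnWith
  have key {y : ℝ → ℝ} (hy : ∀ᶠ t in 𝓝 t₀, HasDerivAt y (deriv y t) t ∧
      HasDerivAt (deriv y) (6 * y t ^ 2 - g / 2) t) (he : (y t₀, deriv y t₀) = (y₁ t₀, deriv y₁ t₀)) :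
      ∀ᶠ t in 𝓝 t₀, HasDerivAt (fun t ↦ (y t, deriv y t)) (v (y t, deriv y t)) t ∧
        (y t, deriv y t) ∈ s := by
    have hc : ContinuousAt (fun t ↦ (y t, deriv y t)) t₀ :=
      (hy.self_of_nhds.1.continuousAt).prodMk hy.self_of_nhds.2.continuousAt
    filter_upwards [hy, hc.eventually_mem (by rwa [he])] with t ht hts
    exact ⟨ht.1.prodMk ht.2, hts⟩
  have := ODE_solution_unique_of_eventually (v := fun _ ↦ v) (s := fun _ ↦ s) (K := K)
    (Eventually.of_forall fun _ ↦ hK) (key h1 rfl) (key h2 (by rw [h0, h0'])) (by rw [h0, h0'])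
  filter_upwards [this] with t ht using congrArg Prod.fst ht

lemma eventually_ode (h : IsLemniscatic f g) {t₀ : ℝ} (ht : t₀ ∈ Ioo (0 : ℝ) 4) :
    ∀ᶠ t in 𝓝 t₀, HasDerivAt f (deriv f t) t ∧ HasDerivAt (deriv f) (6 * f t ^ 2 - g / 2) t := by
  filter_upwards [isOpen_Ioo.mem_nhds ht] with t ht
  refine ⟨h.hasDerivAt ht, ?_⟩
  rw [← h.deriv_deriv ht]
  exact (h.analytic.deriv t ht).differentiableAt.hasDerivAt

/-- At a critical point `t₀` the reflection `t ↦ f(2t₀ - t)` solves the same second-order equation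
with the same initial data, so `f` is symmetric about `t₀`. The blow-up at `0` would then reappear
at `2t₀ < 4`, where `f` is analytic. -/
lemma deriv_ne_zero (h : IsLemniscatic f g) {t₀ : ℝ} (ht : t₀ ∈ Ioo (0 : ℝ) 2) : deriv f t₀ ≠ 0 := by
  intro h0
  have hmem {t : ℝ} (ht' : t ∈ Ioo 0 (2 * t₀)) : t ∈ Ioo (0 : ℝ) 4 := ⟨ht'.1, by linarith [ht'.2, ht.2]⟩
  have hrefl {t : ℝ} (ht' : t ∈ Ioo 0 (2 * t₀)) : 2 * t₀ - t ∈ Ioo 0 (2 * t₀) :=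
    ⟨by linarith [ht'.2], by linarith [ht'.1]⟩
  have ht₀ : t₀ ∈ Ioo 0 (2 * t₀) := ⟨ht.1, by linarith [ht.1]⟩
  have hd : ∀ t ∈ Ioo 0 (2 * t₀), HasDerivAt (fun t ↦ f (2 * t₀ - t)) (-deriv f (2 * t₀ - t)) t :=
    fun t ht' ↦ by simpa using! (h.hasDerivAt (hmem (hrefl ht'))).comp_const_sub (2 * t₀) t
  have heq : f =ᶠ[𝓝 t₀] fun t ↦ f (2 * t₀ - t) := by
    refine eventuallyEq_of_ode (g := g) (h.eventually_ode (hmem ht₀)) ?_ (by ring_nf) ?_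
    · filter_upwards [isOpen_Ioo.mem_nhds ht₀] with t ht'
      refine ⟨(hd t ht').differentiableAt.hasDerivAt, ?_⟩
      have h2 : deriv (fun t ↦ f (2 * t₀ - t)) =ᶠ[𝓝 t] fun t ↦ -deriv f (2 * t₀ - t) := by
        filter_upwards [isOpen_Ioo.mem_nhds ht'] with u hu using (hd u hu).deriv
      refine HasDerivAt.congr_of_eventuallyEq ?_ h2
      have h3 := (h.eventually_ode (hmem (hrefl ht'))).self_of_nhds.2
      simpa using! (h3.comp_const_sub (2 * t₀) t).neg
    · rw [(hd t₀ ht₀).deriv, show 2 * t₀ - t₀ = t₀ by ring, h0, neg_zero]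
  have hEq : EqOn f (fun t ↦ f (2 * t₀ - t)) (Ioo 0 (2 * t₀)) := by
    refine AnalyticOnNhd.eqOn_of_preconnected_of_eventuallyEq (𝕜 := ℝ)
      (fun t ht' ↦ h.analytic t (hmem ht')) (fun t ht' ↦ ?_) isPreconnected_Ioo ht₀ heq
    exact (h.analytic _ (hmem (hrefl ht'))).comp (f := fun t ↦ 2 * t₀ - t) (by fun_prop)
  have hc : Tendsto (fun t ↦ f (2 * t₀ - t)) (𝓝[>] 0) (𝓝 (f (2 * t₀))) := by
    have h1 : ContinuousAt f (2 * t₀) :=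
      (h.analytic _ ⟨by linarith [ht.1], by linarith [ht.2]⟩).continuousAt
    have h2 : Tendsto (fun t ↦ 2 * t₀ - t) (𝓝[>] 0) (𝓝 (2 * t₀)) := by
      have : ContinuousAt (fun t : ℝ ↦ 2 * t₀ - t) 0 := by fun_prop
      simpa using this.tendsto.mono_left nhdsWithin_le_nhds
    exact h1.tendsto.comp h2
  refine not_tendsto_nhds_of_tendsto_atTop h.tendsto_zero _ (hc.congr' ?_)
  filter_upwards [Ioo_mem_nhdsGT (show 0 < 2 * t₀ by linarith [ht.1])] with t ht' using (hEq ht').symm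

/-- A nowhere vanishing continuous derivative keeps its sign, and a positive sign contradicts `f →
∞` at `0⁺`. -/
lemma deriv_neg (h : IsLemniscatic f g) {t : ℝ} (ht : t ∈ Ioo (0 : ℝ) 2) : deriv f t < 0 := by
  have hmem {t : ℝ} (ht' : t ∈ Ioo (0 : ℝ) 2) : t ∈ Ioo (0 : ℝ) 4 := ⟨ht'.1, by linarith [ht'.2]⟩
  rcases (convex_Ioo (0 : ℝ) 2).ordConnected.isPreconnected.image (deriv f)
    (fun t ht ↦ (h.analytic.deriv t (hmem ht)).continuousAt.continuousWithinAt) |>.ordConnected with hoc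
  by_contra! hpos
  have hpos' : ∀ u ∈ Ioo (0 : ℝ) 2, 0 < deriv f u := fun u hu ↦ by
    by_contra! hneg
    have := hoc.out ⟨u, hu, rfl⟩ ⟨t, ht, rfl⟩ ⟨hneg, hpos⟩
    obtain ⟨v, hv, hv0⟩ := this
    exact h.deriv_ne_zero hv hv0
  have hmono : StrictMonoOn f (Ioo 0 2) := by
    refine strictMonoOn_of_deriv_pos (convex_Ioo 0 2)
      (fun t ht ↦ (h.analytic t (hmem ht)).continuousAt.continuousWithinAt) fun t ht ↦ ?_
    rw [interior_Ioo] at ht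
    exact hpos' t ht
  obtain ⟨u, hu, hu'⟩ := ((h.tendsto_zero.eventually (eventually_gt_atTop (f t))).and
    (Ioo_mem_nhdsGT ht.1)).exists
  exact absurd (hmono ⟨hu'.1, hu'.2.trans ht.2⟩ ht hu'.2) hu.not_gt

lemma strictAntiOn (h : IsLemniscatic f g) : StrictAntiOn f (Ioc 0 2) := by
  refine strictAntiOn_of_deriv_neg (convex_Ioc 0 2)
    (fun t ht ↦ (h.analytic t ⟨ht.1, by linarith [ht.2]⟩).continuousAt.continuousWithinAt) fun t ht ↦ ?_
  rw [interior_Ioc] at ht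
  exact h.deriv_neg ht

lemma pos (h : IsLemniscatic f g) {t : ℝ} (ht : t ∈ Ioo (0 : ℝ) 2) : 0 < f t := by
  rw [← h.map_two]
  exact h.strictAntiOn ⟨ht.1, ht.2.le⟩ ⟨two_pos, le_rfl⟩ ht.2

lemma tendsto_two (h : IsLemniscatic f g) : Tendsto f (𝓝[<] 2) (𝓝 0) := by
  have := (h.analytic 2 ⟨by norm_num, by norm_num⟩).continuousAt.tendsto
  rw [h.map_two] at this
  exact this.mono_left nhdsWithin_le_nhds

/-- On `(0, 2)` one has `f > 0` and `f'² = f(4f² - g) ≥ 0`, so `g ≤ 4f²`, which tends to `0` at `2`.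
If `g = 0` then `f` and `f'` both vanish at `2`, and uniqueness makes `f` zero near `2`, against
positivity. -/
lemma neg_param (h : IsLemniscatic f g) : g < 0 := by
  have hle : g ≤ 0 := by
    have h1 : ∀ᶠ t in 𝓝[<] 2, g ≤ 4 * f t ^ 2 := by
      filter_upwards [Ioo_mem_nhdsLT (show (0 : ℝ) < 2 by norm_num)] with t ht
      have h2 := h.deriv_sq t ⟨ht.1, by linarith [ht.2]⟩
      have h3 := h.pos ht
      by_contra! h4
      nlinarith [sq_nonneg (deriv f t)]
    have h2 : Tendsto (fun t ↦ 4 * f t ^ 2) (𝓝[<] 2) (𝓝 0) := by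
      simpa using (h.tendsto_two.pow 2).const_mul 4
    exact ge_of_tendsto h2 h1
  refine lt_of_le_of_ne hle fun h0 ↦ ?_
  have h2 : (2 : ℝ) ∈ Ioo (0 : ℝ) 4 := ⟨by norm_num, by norm_num⟩
  have heq : f =ᶠ[𝓝 2] fun _ ↦ 0 := by
    refine eventuallyEq_of_ode (g := g) (h.eventually_ode h2) (Eventually.of_forall fun t ↦ ?_)
      h.map_two ?_
    · simp only [deriv_const', h0]
      norm_num
      exact hasDerivAt_const t (0 : ℝ)
    · have := h.deriv_sq 2 h2
      rw [h.map_two] at this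
      simpa using this
  obtain ⟨t, ht, ht'⟩ := ((heq.filter_mono nhdsWithin_le_nhds (l' := 𝓝[<] 2)).and
    (Ioo_mem_nhdsLT (show (0 : ℝ) < 2 by norm_num))).exists
  exact (h.pos ht').ne' ht

end IsLemniscatic

/-- The integrand of `B(1/4, 1/4)`. -/
noncomputable def betaWeight (x : ℝ) : ℝ := x ^ (-3 / 4 : ℝ) * (1 - x) ^ (-3 / 4 : ℝ)

lemma betaIntegrand_eq {x : ℝ} (hx : x ∈ Icc (0 : ℝ) 1) :
    (x : ℂ) ^ ((1 / 4 : ℂ) - 1) * (1 - (x : ℂ)) ^ ((1 / 4 : ℂ) - 1) = (betaWeight x : ℝ) := by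
  rw [betaWeight, Complex.ofReal_mul, Complex.ofReal_cpow hx.1, Complex.ofReal_cpow (sub_nonneg.mpr hx.2)]
  norm_num

lemma intervalIntegrable_betaWeight : IntervalIntegrable betaWeight MeasureTheory.volume 0 1 := by
  have h := (Complex.betaIntegral_convergent (u := 1 / 4) (v := 1 / 4) (by norm_num) (by norm_num)).norm
  refine (h.congr fun x hx ↦ ?_)
  rw [uIoc_of_le zero_le_one] at hx
  have hx' : x ∈ Icc (0 : ℝ) 1 := ⟨hx.1.le, hx.2⟩
  rw [betaIntegrand_eq hx', Complex.norm_real, Real.norm_of_nonneg]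
  exact mul_nonneg (Real.rpow_nonneg hx'.1 _) (Real.rpow_nonneg (sub_nonneg.mpr hx'.2) _)

lemma betaIntegral_eq : Complex.betaIntegral (1 / 4) (1 / 4) = ((∫ x in (0 : ℝ)..1, betaWeight x : ℝ) : ℂ) := by
  rw [Complex.betaIntegral, ← intervalIntegral.integral_ofReal]
  refine intervalIntegral.integral_congr fun x hx ↦ ?_
  rw [uIcc_of_le zero_le_one] at hx
  exact betaIntegrand_eq hx

lemma betaWeight_one_sub (x : ℝ) : betaWeight (1 - x) = betaWeight x := by
  simp [betaWeight, mul_comm]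

lemma betaWeight_pos {x : ℝ} (hx : x ∈ Ioo (0 : ℝ) 1) : 0 < betaWeight x :=
  mul_pos (Real.rpow_pos_of_pos hx.1 _) (Real.rpow_pos_of_pos (sub_pos.mpr hx.2) _)

/-- The primitive of the integrand of `B(1/4, 1/4)`. -/
noncomputable def betaPrimitive (y : ℝ) : ℝ := ∫ x in (0 : ℝ)..y, betaWeight x

lemma hasDerivAt_betaPrimitive {y : ℝ} (hy : y ∈ Ioo (0 : ℝ) 1) :
    HasDerivAt betaPrimitive (betaWeight y) y := by
  have hc (z : ℝ) (hz : z ∈ Ioo (0 : ℝ) 1) : ContinuousAt betaWeight z :=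
    (Real.continuousAt_rpow_const _ _ (Or.inl hz.1.ne')).mul
      (ContinuousAt.rpow_const (by fun_prop) (Or.inl (sub_pos.mpr hz.2).ne'))
  refine intervalIntegral.integral_hasDerivAt_right
    (intervalIntegrable_betaWeight.mono_set ?_) ?_ (hc y hy)
  · rw [uIcc_of_le hy.1.le, uIcc_of_le zero_le_one]
    exact Icc_subset_Icc_right hy.2.le
  · exact ContinuousOn.stronglyMeasurableAtFilter isOpen_Ioo
      (fun z hz ↦ (hc z hz).continuousWithinAt) y hy

lemma continuousOn_betaPrimitive : ContinuousOn betaPrimitive (Icc 0 1) := by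
  have := intervalIntegral.continuousOn_primitive_interval' intervalIntegrable_betaWeight
    (left_mem_uIcc)
  rwa [uIcc_of_le zero_le_one] at this

lemma strictMonoOn_betaPrimitive : StrictMonoOn betaPrimitive (Icc 0 1) := by
  refine strictMonoOn_of_deriv_pos (convex_Icc 0 1) continuousOn_betaPrimitive fun y hy ↦ ?_
  rw [interior_Icc] at hy
  rw [(hasDerivAt_betaPrimitive hy).deriv]
  exact betaWeight_pos hy

/-- Symmetry of the integrand under `x ↦ 1 - x`. -/
lemma betaPrimitive_half : 2 * betaPrimitive (1 / 2) = betaPrimitive 1 := by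
  have h1 : ∫ x in (1 / 2 : ℝ)..1, betaWeight x = ∫ x in (0 : ℝ)..(1 / 2), betaWeight x := by
    have := intervalIntegral.integral_comp_sub_left (a := 0) (b := 1 / 2) betaWeight 1
    simp only [betaWeight_one_sub] at this
    rw [this]
    norm_num
  have hi (a b : ℝ) (ha : 0 ≤ a) (hab : a ≤ b) (hb : b ≤ 1) :
      IntervalIntegrable betaWeight MeasureTheory.volume a b :=
    intervalIntegrable_betaWeight.mono_set (by
      rw [uIcc_of_le hab, uIcc_of_le zero_le_one]; exact Icc_subset_Icc ha hb)
  have h2 := intervalIntegral.integral_add_adjacent_intervals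
    (hi 0 (1 / 2) (by norm_num) (by norm_num) (by norm_num))
    (hi (1 / 2) 1 (by norm_num) (by norm_num) (by norm_num))
  rw [h1] at h2
  rw [betaPrimitive, betaPrimitive, ← h2, two_mul]

namespace IsLemniscatic

variable {f : ℝ → ℝ} {g m : ℝ}

/-- For `g = -4m²` the equation reads `f' = -2√f √(m² + f²)`. The substitution `X = m²/(m² + f²)`
carries `dt` to a constant multiple of the beta differential, so the beta primitive becomes linear
in `t`. -/
lemma hasDerivAt_betaPrimitive_comp (h : IsLemniscatic f g) (hm : 0 < m) (hg : g = -(4 * m ^ 2))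
    {t : ℝ} (ht : t ∈ Ioo (0 : ℝ) 2) :
    HasDerivAt (fun t ↦ betaPrimitive (m ^ 2 / (m ^ 2 + f t ^ 2))) (4 * √m) t := by
  have ht4 : t ∈ Ioo (0 : ℝ) 4 := ⟨ht.1, by linarith [ht.2]⟩
  have hf := h.pos ht
  set A := m ^ 2 + f t ^ 2 with hA
  have hA0 : 0 < A := by positivity
  have hd : deriv f t = -(2 * √(f t) * √A) := by
    have h1 := h.deriv_sq t ht4
    have h2 : deriv f t ^ 2 = (2 * √(f t) * √A) ^ 2 := by
      rw [h1, mul_pow, mul_pow, Real.sq_sqrt hf.le, Real.sq_sqrt hA0.le, hg, hA]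
      ring
    rcases sq_eq_sq_iff_eq_or_eq_neg.mp h2 with h3 | h3
    · have := h.deriv_neg ht
      have : 0 ≤ 2 * √(f t) * √A := by positivity
      linarith
    · exact h3
  have hX : HasDerivAt (fun t ↦ m ^ 2 / (m ^ 2 + f t ^ 2)) (-(m ^ 2 * (2 * f t * deriv f t)) / A ^ 2) t := by
    have h1 : HasDerivAt (fun t ↦ m ^ 2 + f t ^ 2) (2 * f t * deriv f t) t := by
      simpa using! ((h.hasDerivAt ht4).pow 2).const_add (m ^ 2)
    simpa using! (hasDerivAt_const t (m ^ 2)).div h1 hA0.ne'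
  have hmem : m ^ 2 / A ∈ Ioo (0 : ℝ) 1 := by
    refine ⟨by positivity, (div_lt_one hA0).mpr ?_⟩
    rw [hA]
    nlinarith
  have h2 := (hasDerivAt_betaPrimitive hmem).comp t hX
  have hw : betaWeight (m ^ 2 / A) = A * √A / (m * f t * (√m * √(f t))) := by
    have e1 : 1 - m ^ 2 / A = f t ^ 2 / A := by
      rw [eq_div_iff hA0.ne', sub_mul, div_mul_cancel₀ _ hA0.ne', hA]
      ring
    rw [betaWeight, e1, ← Real.mul_rpow (by positivity) (by positivity),
      show m ^ 2 / A * (f t ^ 2 / A) = (m * f t / A) ^ (2 : ℝ) by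
        rw [Real.rpow_two]; field_simp,
      ← Real.rpow_mul (by positivity), show (2 : ℝ) * (-3 / 4) = -(1 + 1 / 2) by norm_num,
      Real.rpow_neg (by positivity), Real.rpow_add (by positivity), Real.rpow_one,
      ← Real.sqrt_eq_rpow, Real.sqrt_div (by positivity), Real.sqrt_mul hm.le]
    field_simp
  have hs : 4 * √m = betaWeight (m ^ 2 / A) * (-(m ^ 2 * (2 * f t * deriv f t)) / A ^ 2) := by
    have := Real.sqrt_pos.mpr hm
    have := Real.sqrt_pos.mpr hf
    have := Real.sqrt_pos.mpr hA0
    rw [hw, hd]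
    field_simp
    rw [Real.sq_sqrt hm.le, Real.sq_sqrt hA0.le]
    ring
  rw [hs]
  exact h2

/-- Along `(0, 2)` the variable `X` runs from `0` (pole) to `1` (zero) and the beta primitive equals
`4√m · t`. Thus `B = 8√m`. At `t = 1` half of the integral is reached, so `X = 1/2`, that is, `f(1)
= m`. -/
lemma apply_one (h : IsLemniscatic f g) : f 1 = betaPrimitive 1 ^ 2 / 64 := by
  obtain ⟨m, hm, hg⟩ : ∃ m : ℝ, 0 < m ∧ g = -(4 * m ^ 2) := by
    refine ⟨√(-g) / 2, by have := Real.sqrt_pos.mpr (neg_pos.mpr h.neg_param); positivity, ?_⟩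
    rw [div_pow, Real.sq_sqrt (neg_pos.mpr h.neg_param).le]
    ring
  set X : ℝ → ℝ := fun t ↦ m ^ 2 / (m ^ 2 + f t ^ 2) with hXdef
  have hXmem (t : ℝ) : X t ∈ Icc (0 : ℝ) 1 :=
    ⟨by positivity, (div_le_one (by positivity)).mpr (by nlinarith [sq_nonneg (f t)])⟩
  obtain ⟨c, hc⟩ : ∃ c, ∀ t ∈ Ioo (0 : ℝ) 2, betaPrimitive (X t) = 4 * √m * t + c := by
    refine ⟨betaPrimitive (X 1) - 4 * √m * 1, fun t ht ↦ ?_⟩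
    have hd : ∀ t ∈ Ioo (0 : ℝ) 2, HasDerivAt (fun t ↦ betaPrimitive (X t) - 4 * √m * t) 0 t :=
      fun t ht ↦ by
        simpa using! (h.hasDerivAt_betaPrimitive_comp hm hg ht).sub ((hasDerivAt_id t).const_mul (4 * √m))
    have := (convex_Ioo (0 : ℝ) 2).is_const_of_fderivWithin_eq_zero (𝕜 := ℝ)
      (fun x hx ↦ (hd x hx).differentiableAt.differentiableWithinAt)
      (fun x hx ↦ by
        rw [fderivWithin_of_isOpen isOpen_Ioo hx]
        ext
        simpa using! (hd x hx).deriv) ht ⟨zero_lt_one, one_lt_two⟩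
    linarith
  have hlim {l : Filter ℝ} {y : ℝ} (hl : Tendsto X l (𝓝 y)) :
      Tendsto (fun t ↦ betaPrimitive (X t)) l (𝓝 (betaPrimitive y)) ∨ l = ⊥ := by
    rcases eq_or_neBot l with rfl | hne
    · exact Or.inr rfl
    have hy : y ∈ Icc (0 : ℝ) 1 := isClosed_Icc.mem_of_tendsto hl (Eventually.of_forall hXmem)
    exact Or.inl ((continuousOn_betaPrimitive y hy).tendsto.comp
      (tendsto_nhdsWithin_iff.mpr ⟨hl, Eventually.of_forall hXmem⟩))
  have h0 : c = 0 := by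
    have h1 : Tendsto X (𝓝[>] 0) (𝓝 0) := by
      refine Tendsto.div_atTop tendsto_const_nhds (tendsto_atTop_add_const_left _ _ ?_)
      exact (tendsto_pow_atTop two_ne_zero).comp h.tendsto_zero
    have h2 := (hlim h1).resolve_right (NeBot.ne inferInstance)
    have h3 : Tendsto (fun t ↦ 4 * √m * t + c) (𝓝[>] 0) (𝓝 (4 * √m * 0 + c)) :=
      (Continuous.tendsto (by fun_prop) 0).mono_left nhdsWithin_le_nhds
    have h4 := tendsto_nhds_unique (h2.congr' (by
      filter_upwards [Ioo_mem_nhdsGT (show (0 : ℝ) < 2 by norm_num)] with t ht using hc t ht)) h3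
    simpa [betaPrimitive] using h4.symm
  have h8 : betaPrimitive 1 = 8 * √m := by
    have h1 : Tendsto X (𝓝[<] 2) (𝓝 1) := by
      have := Tendsto.div (tendsto_const_nhds (x := m ^ 2) (f := 𝓝[<] (2 : ℝ)))
        ((h.tendsto_two.pow 2).const_add (m ^ 2)) (by positivity)
      rwa [zero_pow two_ne_zero, add_zero, div_self (by positivity)] at this
    have h2 := (hlim h1).resolve_right (NeBot.ne inferInstance)
    have h3 : Tendsto (fun t ↦ 4 * √m * t + c) (𝓝[<] 2) (𝓝 (4 * √m * 2 + c)) :=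
      (Continuous.tendsto (by fun_prop) 2).mono_left nhdsWithin_le_nhds
    have h4 := tendsto_nhds_unique (h2.congr' (by
      filter_upwards [Ioo_mem_nhdsLT (show (0 : ℝ) < 2 by norm_num)] with t ht using hc t ht)) h3
    rw [h4, h0]
    ring
  have hX1 : X 1 = 1 / 2 := by
    refine strictMonoOn_betaPrimitive.injOn (hXmem 1) ⟨by norm_num, by norm_num⟩ ?_
    have := betaPrimitive_half
    rw [hc 1 ⟨zero_lt_one, one_lt_two⟩, h0]
    linarith
  have hf1 := h.pos (t := 1) ⟨zero_lt_one, one_lt_two⟩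
  have hfm : f 1 = m := by
    simp only [hXdef] at hX1
    rw [div_eq_div_iff (by positivity) two_ne_zero] at hX1
    nlinarith
  rw [hfm, h8, mul_pow, Real.sq_sqrt hm.le]
  ring

end IsLemniscatic

end LemniscaticODE

/-! ### The Weierstrass function of `(2 + 2i)ℤ[i]` -/

section GaussianLattice

open Complex

/-- The periods `2 ± 2i` of the lattice `(2 + 2i) ℤ[i]`. -/
noncomputable def gaussPeriods : PeriodPair where
  ω₁ := 2 + 2 * Complex.I
  ω₂ := 2 - 2 * Complex.I
  indep := by
    refine LinearIndependent.pair_iff.mpr fun s t h ↦ ?_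
    have h1 := congrArg Complex.re h
    have h2 := congrArg Complex.im h
    simp at h1 h2
    constructor <;> linarith

lemma I_mul_mem_gaussPeriods {w : ℂ} (hw : w ∈ gaussPeriods.lattice) :
    Complex.I * w ∈ gaussPeriods.lattice := by
  obtain ⟨m, n, rfl⟩ := PeriodPair.mem_lattice.mp hw
  refine PeriodPair.mem_lattice.mpr ⟨n, -m, ?_⟩
  simp only [gaussPeriods]
  push_cast
  linear_combination (2 * n - 2 * m : ℂ) * I_mul_I

lemma conj_mem_gaussPeriods {w : ℂ} (hw : w ∈ gaussPeriods.lattice) :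
    starRingEnd ℂ w ∈ gaussPeriods.lattice := by
  obtain ⟨m, n, rfl⟩ := PeriodPair.mem_lattice.mp hw
  refine PeriodPair.mem_lattice.mpr ⟨n, m, ?_⟩
  simp only [gaussPeriods, map_add, map_mul, map_sub, conj_I, map_ofNat, map_intCast]
  ring

/-- Multiplication by `i` on the lattice `(2 + 2i) ℤ[i]`. -/
noncomputable def gaussLatticeMulI : gaussPeriods.lattice ≃ gaussPeriods.lattice where
  toFun w := ⟨Complex.I * w.1, I_mul_mem_gaussPeriods w.2⟩
  invFun w := ⟨Complex.I * (Complex.I * (Complex.I * w.1)),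
    I_mul_mem_gaussPeriods (I_mul_mem_gaussPeriods (I_mul_mem_gaussPeriods w.2))⟩
  left_inv w := by ext; simp [← mul_assoc]
  right_inv w := by ext; simp [← mul_assoc]

/-- Complex conjugation on the lattice `(2 + 2i) ℤ[i]`. -/
noncomputable def gaussLatticeConj : gaussPeriods.lattice ≃ gaussPeriods.lattice where
  toFun w := ⟨starRingEnd ℂ w.1, conj_mem_gaussPeriods w.2⟩
  invFun w := ⟨starRingEnd ℂ w.1, conj_mem_gaussPeriods w.2⟩
  left_inv w := by ext; simp
  right_inv w := by ext; simp

lemma weierstrassP_I_mul (z : ℂ) :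
    gaussPeriods.weierstrassP (Complex.I * z) = -gaussPeriods.weierstrassP z := by
  rw [PeriodPair.weierstrassP, PeriodPair.weierstrassP, ← gaussLatticeMulI.tsum_eq, ← tsum_neg]
  refine tsum_congr fun w ↦ ?_
  simp only [gaussLatticeMulI, Equiv.coe_fn_mk]
  rw [← mul_sub, mul_pow, mul_pow, I_sq]
  simp only [neg_mul, one_mul, div_neg]
  ring

lemma weierstrassP_conj (z : ℂ) :
    gaussPeriods.weierstrassP (starRingEnd ℂ z) = starRingEnd ℂ (gaussPeriods.weierstrassP z) := by
  rw [PeriodPair.weierstrassP, PeriodPair.weierstrassP, ← gaussLatticeConj.tsum_eq, conj_tsum]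
  refine tsum_congr fun w ↦ ?_
  simp [gaussLatticeConj]

lemma gaussPeriods_g₃ : gaussPeriods.g₃ = 0 := by
  have h : gaussPeriods.G 6 = -gaussPeriods.G 6 := by
    conv_lhs => rw [PeriodPair.G, ← gaussLatticeMulI.tsum_eq]
    rw [PeriodPair.G, ← tsum_neg]
    refine tsum_congr fun w ↦ ?_
    simp only [gaussLatticeMulI, Equiv.coe_fn_mk]
    rw [mul_pow, show Complex.I ^ 6 = -1 by rw [show 6 = 2 * 3 by rfl, pow_mul, I_sq]; norm_num]
    simp [inv_neg]
  rw [PeriodPair.g₃, self_eq_neg.mp h, mul_zero]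

lemma ofReal_notMem_gaussPeriods {t : ℝ} (h0 : 0 < t) (h4 : t < 4) :
    (t : ℂ) ∉ gaussPeriods.lattice := fun h ↦ by
  obtain ⟨m, n, h⟩ := PeriodPair.mem_lattice.mp h
  have h1 := congrArg Complex.re h
  have h2 := congrArg Complex.im h
  simp [gaussPeriods] at h1 h2
  have h3 : (m : ℝ) = n := by linarith
  rw [h3] at h1
  have h5 : (0 : ℝ) < n := by linarith
  have h6 : (n : ℝ) < 1 := by linarith
  have h7 : 0 < n := by exact_mod_cast h5
  have h8 : n < 1 := by exact_mod_cast h6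
  lia

/-- Since `2 - ω₂ = 2i`, periodicity gives `℘(2) = ℘(2i)`, which is `-℘(2)` by the symmetry under
`i`. -/
lemma weierstrassP_two : gaussPeriods.weierstrassP 2 = 0 := by
  have h1 := weierstrassP_I_mul 2
  have h2 := gaussPeriods.weierstrassP_sub_coe 2 ⟨_, gaussPeriods.ω₂_mem_lattice⟩
  have h3 : (2 : ℂ) - gaussPeriods.ω₂ = Complex.I * 2 := by simp [gaussPeriods]; ring
  simp only [h3] at h2
  rw [h1] at h2
  exact self_eq_neg.mp h2.symm

lemma weierstrassP_ofReal (t : ℝ) :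
    ((gaussPeriods.weierstrassP t).re : ℂ) = gaussPeriods.weierstrassP t := by
  refine conj_eq_iff_re.mp ?_
  rw [← weierstrassP_conj, conj_ofReal]

lemma hasDerivAt_weierstrassP {z : ℂ} (hz : z ∉ gaussPeriods.lattice) :
    HasDerivAt gaussPeriods.weierstrassP (gaussPeriods.derivWeierstrassP z) z := by
  rw [← PeriodPair.deriv_weierstrassP]
  exact (gaussPeriods.analyticOnNhd_weierstrassP z hz).differentiableAt.hasDerivAt

lemma isLemniscatic_weierstrassP :
    IsLemniscatic (fun t : ℝ ↦ (gaussPeriods.weierstrassP t).re) gaussPeriods.g₂.re where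
  analytic t ht := by
    have h1 := (gaussPeriods.analyticOnNhd_weierstrassP t
      (ofReal_notMem_gaussPeriods ht.1 ht.2)).restrictScalars (𝕜 := ℝ)
    exact (reCLM.analyticAt _).comp (h1.comp (f := fun t : ℝ ↦ (t : ℂ)) (ofRealCLM.analyticAt t))
  deriv_sq t ht := by
    have hmem := ofReal_notMem_gaussPeriods ht.1 ht.2
    have h1 := hasDerivAt_weierstrassP hmem
    have h2 := h1.real_of_complex
    have h3 := h2.ofReal_comp
    simp only [weierstrassP_ofReal] at h3
    have h4 := h3.unique h1.comp_ofReal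
    have h5 := gaussPeriods.derivWeierstrassP_sq t hmem
    rw [h2.deriv]
    rw [← h4, ← weierstrassP_ofReal, gaussPeriods_g₃, sub_zero] at h5
    have h6 := congrArg Complex.re h5
    rw [sub_re, re_mul_ofReal] at h6
    norm_cast at h6
  -- Split `℘(t) = 1/t² + (a function continuous at 0)`.
  tendsto_zero := by
    have h1 : ContinuousAt (gaussPeriods.weierstrassPExcept 0) 0 :=
      (gaussPeriods.analyticAt_weierstrassPExcept 0).continuousAt
    have h2 : Tendsto (fun t : ℝ ↦ (gaussPeriods.weierstrassPExcept 0 t).re) (𝓝[>] 0)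
        (𝓝 (gaussPeriods.weierstrassPExcept 0 0).re) := by
      refine (Complex.continuous_re.tendsto _).comp (h1.tendsto.comp ?_)
      exact (continuous_ofReal.tendsto' 0 0 ofReal_zero).mono_left nhdsWithin_le_nhds
    have h3 : Tendsto (fun t : ℝ ↦ 1 / t ^ 2) (𝓝[>] 0) atTop := by
      simpa [Function.comp_def] using tendsto_pow_atTop (α := ℝ) two_ne_zero |>.comp tendsto_inv_nhdsGT_zero
    refine (h2.add_atTop h3).congr fun t ↦ ?_
    have := gaussPeriods.weierstrassPExcept_add 0 t
    simp only [ZeroMemClass.coe_zero, sub_zero] at this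
    rw [← this, add_re]
    congr 1
    simp only [ne_eq, OfNat.ofNat_ne_zero, not_false_eq_true, zero_pow, div_zero, sub_zero]
    norm_cast
  map_two := by simp [weierstrassP_two]

lemma weierstrassP_one :
    gaussPeriods.weierstrassP 1 = Complex.betaIntegral (1 / 4) (1 / 4) ^ 2 / 64 := by
  have := isLemniscatic_weierstrassP.apply_one
  have h2 := weierstrassP_ofReal 1
  rw [this] at h2
  rw [betaIntegral_eq, ← ofReal_one, ← h2]
  push_cast [betaPrimitive]
  rfl

/-- The primary Gaussian integers are `1 + w` for `w` in the lattice `(2 + 2i) ℤ[i]`. -/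
noncomputable def latticeEquivPrimary : gaussPeriods.lattice ≃ PrimaryGaussian :=
  gaussPeriods.latticeEquivProd.toEquiv.trans primaryEquivSumDiff

lemma coe_latticeEquivPrimary (w : gaussPeriods.lattice) :
    ((latticeEquivPrimary w).1 : ℂ) = 1 + w.1 := by
  obtain ⟨x, rfl⟩ := gaussPeriods.latticeEquivProd.symm.surjective w
  have : latticeEquivPrimary (gaussPeriods.latticeEquivProd.symm x) = primaryEquivSumDiff x := by
    simp [latticeEquivPrimary]
  rw [this, PeriodPair.latticeEquiv_symm_apply, GaussianInt.toComplex_def₂]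
  simp only [primaryEquivSumDiff, Equiv.coe_fn_mk, gaussPeriods]
  apply Complex.ext
  · simp; ring
  · simp; ring

end GaussianLattice

/-! ### The value at `2` by Hecke's limit trick -/

section LimitAtTwo

open Complex

/-- The function `z̄² |z|^{-2σ}`. -/
noncomputable def conjSqTwist (σ : ℝ) (z : ℂ) : ℂ := starRingEnd ℂ z ^ 2 * ((‖z‖ ^ (-(2 * σ)) : ℝ) : ℂ)

lemma norm_conjSqTwist_le {σ : ℝ} (z : ℂ) : ‖conjSqTwist σ z‖ = ‖z‖ ^ 2 * ‖z‖ ^ (-(2 * σ)) := by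
  rw [conjSqTwist, norm_mul, norm_pow, norm_conj, norm_real,
    Real.norm_of_nonneg (Real.rpow_nonneg (norm_nonneg _) _)]

lemma summable_lattice_rpow {r : ℝ} (hr : r < -2) :
    Summable fun w : gaussPeriods.lattice ↦ ‖w.1‖ ^ r := by
  refine ZLattice.summable_norm_rpow _ r ?_
  simpa using hr

lemma summable_conjSqTwist {σ : ℝ} (hσ : 2 < σ) :
    Summable fun w : gaussPeriods.lattice ↦ conjSqTwist σ w.1 := by
  refine Summable.of_norm_bounded (summable_lattice_rpow (r := 2 - 2 * σ) (by linarith)) fun w ↦ ?_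
  rw [norm_conjSqTwist_le]
  rcases eq_or_ne w.1 0 with h | h
  · simp only [h, norm_zero]
    rw [zero_pow two_ne_zero, zero_mul]
    positivity
  · have : 0 < ‖w.1‖ := norm_pos_iff.mpr h
    rw [← Real.rpow_two, ← Real.rpow_add this]
    exact le_of_eq (by ring_nf)

/-- Replacing `w` by `iw` permutes the lattice and changes the sign of `w̄²`. -/
lemma tsum_conjSqTwist (σ : ℝ) : ∑' w : gaussPeriods.lattice, conjSqTwist σ w.1 = 0 := by
  refine self_eq_neg.mp ?_
  conv_lhs => rw [← gaussLatticeMulI.tsum_eq]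
  rw [← tsum_neg]
  refine tsum_congr fun w ↦ ?_
  simp [gaussLatticeMulI, conjSqTwist, mul_pow]

/-- Conjugating the primary integers turns `α²` into `ᾱ²`, with `α = 1 + w`. The subtracted series
has sum zero; it is there so that the terms decay fast enough at `σ = 2`. -/
lemma hasSum_cuspL_lattice {σ : ℝ} (hσ : 2 < σ) :
    HasSum (fun w : gaussPeriods.lattice ↦ conjSqTwist σ (1 + w.1) - conjSqTwist σ w.1)
      (cuspL etaCuspForm σ) := by
  have h1 := hasSum_cuspL_etaCuspForm (s := σ) (by simpa using hσ)
  have h2 := latticeEquivPrimary.hasSum_iff.mpr (PrimaryGaussian.conj.hasSum_iff.mpr h1)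
  have h3 := h2.sub (summable_conjSqTwist hσ).hasSum
  rw [tsum_conjSqTwist, sub_zero] at h3
  refine h3.congr_fun fun w ↦ ?_
  congr 1
  simp only [Function.comp_apply, toComplex_conj, coe_latticeEquivPrimary, conjSqTwist]
  congr 1
  rw [show gaussNorm (PrimaryGaussian.conj (latticeEquivPrimary w)).1 = gaussNorm (latticeEquivPrimary w).1
    from gaussNorm_star _]
  have : ((gaussNorm (latticeEquivPrimary w).1 : ℝ)) = ‖1 + w.1‖ ^ 2 := by
    rw [← norm_toComplex_sq, coe_latticeEquivPrimary]
  rw [← ofReal_natCast, this, ← ofReal_neg, ← ofReal_cpow (by positivity), neg_mul_eq_mul_neg,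
    Real.rpow_mul (norm_nonneg _), Real.rpow_two]

/-- The difference gains one power of `|w|` by the mean value theorem, uniformly in `σ`. The bound
`2 ≤ ‖w‖` gives `|1 + w| ≥ |w|/2 ≥ 1`, so powers are monotone in the exponent. -/
lemma norm_conjSqTwist_sub_le {σ : ℝ} (h2 : 2 ≤ σ) (h3 : σ ≤ 3) {w : ℂ} (hw : 2 ≤ ‖w‖) :
    ‖conjSqTwist σ (1 + w) - conjSqTwist σ w‖ ≤ 1000 * ‖w‖ ^ (-3 : ℝ) := by
  have hlow : ‖w‖ / 2 ≤ ‖1 + w‖ := by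
    have := norm_sub_norm_le w (-1)
    rw [norm_neg, norm_one, sub_neg_eq_add, add_comm w] at this
    linarith
  have hw0 : 0 < ‖w‖ / 2 := by linarith
  have hdiff : |‖1 + w‖ - ‖w‖| ≤ 1 := by
    have := abs_norm_sub_norm_le (1 + w) w
    simpa using this
  have hpow {x p : ℝ} (hx : ‖w‖ / 2 ≤ x) (hp : p ≤ -4) : x ^ p ≤ (‖w‖ / 2) ^ p :=
    Real.rpow_le_rpow_of_nonpos hw0 hx (by linarith)
  have hexp {p q : ℝ} (hpq : p ≤ q) : (‖w‖ / 2) ^ p ≤ (‖w‖ / 2) ^ q :=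
    Real.rpow_le_rpow_of_exponent_le (by linarith) hpq
  have h1 : ‖(starRingEnd ℂ (1 + w) ^ 2 - starRingEnd ℂ w ^ 2) * ((‖1 + w‖ ^ (-(2 * σ)) : ℝ) : ℂ)‖ ≤
      (3 * ‖w‖) * (‖w‖ / 2) ^ (-4 : ℝ) := by
    rw [norm_mul, norm_real, Real.norm_of_nonneg (by positivity)]
    refine mul_le_mul ?_ ((hpow hlow (by linarith)).trans (hexp (by linarith))) (by positivity)
      (by positivity)
    rw [← map_pow, ← map_pow, ← map_sub, norm_conj, show (1 + w) ^ 2 - w ^ 2 = 1 + 2 * w by ring]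
    refine (norm_add_le _ _).trans ?_
    rw [norm_one, norm_mul, norm_ofNat]
    linarith
  have hmvt : |‖1 + w‖ ^ (-(2 * σ)) - ‖w‖ ^ (-(2 * σ))| ≤ 6 * (‖w‖ / 2) ^ (-5 : ℝ) * |‖1 + w‖ - ‖w‖| := by
    refine Convex.norm_image_sub_le_of_norm_hasDerivWithin_le (𝕜 := ℝ) (s := Set.Ici (‖w‖ / 2))
      (f := fun x ↦ x ^ (-(2 * σ))) (f' := fun x ↦ -(2 * σ) * x ^ (-(2 * σ) - 1))
      (fun x hx ↦ ((Real.hasDerivAt_rpow_const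
        (Or.inl (hw0.trans_le hx).ne')).hasDerivWithinAt)) (fun x hx ↦ ?_) (convex_Ici _)
      (by simp only [Set.mem_Ici]; linarith) hlow
    have hx0 : 0 < x := hw0.trans_le hx
    rw [norm_mul, Real.norm_of_nonneg (Real.rpow_nonneg hx0.le _), norm_neg,
      Real.norm_of_nonneg (by positivity)]
    exact mul_le_mul (by linarith) ((hpow hx (by linarith)).trans (hexp (by linarith)))
      (by positivity) (by norm_num)
  have h2' : ‖starRingEnd ℂ w ^ 2 * ((‖1 + w‖ ^ (-(2 * σ)) : ℝ) - (‖w‖ ^ (-(2 * σ)) : ℝ) : ℂ)‖ ≤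
      ‖w‖ ^ 2 * (6 * (‖w‖ / 2) ^ (-5 : ℝ)) := by
    rw [norm_mul, norm_pow, norm_conj, ← ofReal_sub, norm_real, Real.norm_eq_abs]
    refine mul_le_mul_of_nonneg_left (hmvt.trans ?_) (by positivity)
    exact mul_le_of_le_one_right (by positivity) hdiff
  have e : conjSqTwist σ (1 + w) - conjSqTwist σ w =
      (starRingEnd ℂ (1 + w) ^ 2 - starRingEnd ℂ w ^ 2) * ((‖1 + w‖ ^ (-(2 * σ)) : ℝ) : ℂ) +
      starRingEnd ℂ w ^ 2 * ((‖1 + w‖ ^ (-(2 * σ)) : ℝ) - (‖w‖ ^ (-(2 * σ)) : ℝ) : ℂ) := by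
    simp only [conjSqTwist]
    ring
  rw [e]
  refine (norm_add_le_of_le h1 h2').trans (le_of_sub_nonneg ?_)
  have hz (x : ℝ) (n : ℕ) : x ^ (-(n : ℝ)) = (x ^ n)⁻¹ := by
    rw [← Int.cast_natCast, ← Int.cast_neg, Real.rpow_intCast, zpow_neg, zpow_natCast]
  have e3 : ‖w‖ ^ (-3 : ℝ) = (‖w‖ ^ 3)⁻¹ := hz ‖w‖ 3
  have e4 : (‖w‖ / 2) ^ (-4 : ℝ) = ((‖w‖ / 2) ^ 4)⁻¹ := hz (‖w‖ / 2) 4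
  have e5 : (‖w‖ / 2) ^ (-5 : ℝ) = ((‖w‖ / 2) ^ 5)⁻¹ := hz (‖w‖ / 2) 5
  rw [e3, e4, e5]
  have hw1 : 0 < ‖w‖ := by linarith
  -- The two estimates contribute `3·16 + 6·32 = 240`; the constant `1000` is generous.
  have : 1000 * (‖w‖ ^ 3)⁻¹ - (3 * ‖w‖ * ((‖w‖ / 2) ^ 4)⁻¹ + ‖w‖ ^ 2 * (6 * ((‖w‖ / 2) ^ 5)⁻¹)) =
      760 * (‖w‖ ^ 3)⁻¹ := by
    field_simp
    norm_num
  rw [this]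
  positivity

lemma conjSqTwist_two (z : ℂ) : conjSqTwist 2 z = 1 / z ^ 2 := by
  rcases eq_or_ne z 0 with rfl | hz
  · simp [conjSqTwist]
  · have h0 : (‖z‖ : ℂ) ≠ 0 := by simpa using hz
    rw [conjSqTwist, show (-(2 * 2) : ℝ) = ((-4 : ℤ) : ℝ) by norm_num, Real.rpow_intCast, ofReal_zpow,
      zpow_neg, eq_div_iff (pow_ne_zero 2 hz)]
    have h1 : starRingEnd ℂ z * z = (‖z‖ : ℂ) ^ 2 := conj_mul' z
    rw [mul_right_comm, ← mul_pow, h1]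
    field_simp

/-- The value of the `L`-function of `η(4τ)^6` at `2`. -/
theorem cuspL_etaCuspForm_two :
    cuspL etaCuspForm 2 = Complex.betaIntegral (1 / 4) (1 / 4) ^ 2 / 64 := by
  rw [← weierstrassP_one]
  have h1 : Tendsto (fun σ : ℝ ↦ cuspL etaCuspForm σ) (𝓝[>] 2) (𝓝 (cuspL etaCuspForm 2)) := by
    have hc : Continuous (cuspL etaCuspForm) := (CuspForm.differentiable_L _ _).continuous
    exact ((hc.comp continuous_ofReal).tendsto' 2 _ (by simp)).mono_left nhdsWithin_le_nhds
  have h2 : Tendsto (fun σ : ℝ ↦ ∑' w : gaussPeriods.lattice, (conjSqTwist σ (1 + w.1) - conjSqTwist σ w.1))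
      (𝓝[>] 2) (𝓝 (∑' w : gaussPeriods.lattice, (conjSqTwist 2 (1 + w.1) - conjSqTwist 2 w.1))) := by
    -- Nonzero lattice vectors have `|w|² ≥ 8`, so the estimate covers every `w ≠ 0`. The term at `w
    -- = 0` is `1`, whence the indicator in the dominating function.
    have hfin : {w : gaussPeriods.lattice | ‖w.1‖ < 2} = {0} := by
      ext w
      simp only [Set.mem_ofPred_eq, Set.mem_singleton_iff]
      refine ⟨fun h ↦ ?_, fun h ↦ by simp [h]⟩
      obtain ⟨m, n, hmn⟩ := PeriodPair.mem_lattice.mp w.2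
      have h3 : ‖w.1‖ ^ 2 = 8 * ((m ^ 2 + n ^ 2 : ℤ) : ℝ) := by
        rw [← hmn, ← normSq_eq_norm_sq, normSq_apply]
        simp [gaussPeriods]
        ring
      have h4 : ‖w.1‖ ^ 2 < 4 := by nlinarith [norm_nonneg w.1]
      have h5 : m ^ 2 + n ^ 2 < 1 := by
        have : ((m ^ 2 + n ^ 2 : ℤ) : ℝ) < 1 := by linarith
        exact_mod_cast this
      have h6 : m = 0 := by nlinarith [sq_nonneg m, sq_nonneg n]
      have h7 : n = 0 := by nlinarith [sq_nonneg m, sq_nonneg n]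
      ext
      rw [← hmn, h6, h7]
      simp
    refine tendsto_tsum_of_dominated_convergence
      (bound := fun w : gaussPeriods.lattice ↦ 1000 * ‖w.1‖ ^ (-3 : ℝ) + if w = 0 then 1 else 0)
      (((summable_lattice_rpow (by norm_num)).mul_left 1000).add
        (summable_of_ne_finset_zero (s := {0}) (by simp +contextual))) (fun w ↦ ?_) ?_
    · have hc (z : ℂ) : Tendsto (fun σ ↦ conjSqTwist σ z) (𝓝[>] 2) (𝓝 (conjSqTwist 2 z)) := by
        rcases eq_or_ne z 0 with rfl | hz
        · simp [conjSqTwist]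
        · have hz' : ‖z‖ ≠ 0 := norm_ne_zero_iff.mpr hz
          have : Continuous fun σ ↦ conjSqTwist σ z := by
            unfold conjSqTwist
            exact continuous_const.mul (continuous_ofReal.comp
              (Real.continuous_const_rpow hz' |>.comp (by fun_prop)))
          exact (this.tendsto 2).mono_left nhdsWithin_le_nhds
      exact (hc _).sub (hc _)
    · filter_upwards [Ioc_mem_nhdsGT (show (2 : ℝ) < 3 by norm_num)] with σ hσ w
      rcases lt_or_ge ‖w.1‖ 2 with hw | hw
      · have : w = 0 := by
          have : w ∈ {w : gaussPeriods.lattice | ‖w.1‖ < 2} := hw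
          rwa [hfin] at this
        rw [this]
        simp [conjSqTwist]
      · refine (norm_conjSqTwist_sub_le hσ.1.le hσ.2 hw).trans (le_add_of_nonneg_right ?_)
        split_ifs <;> norm_num
  have h3 := tendsto_nhds_unique (h1.congr' ?_) h2
  -- The limit is the defining series of `℘(-1)`; at `w = 0` the convention `1/0 = 0` agrees on both
  -- sides.
  · rw [h3, ← PeriodPair.weierstrassP_neg, PeriodPair.weierstrassP]
    refine tsum_congr fun w ↦ ?_
    rw [conjSqTwist_two, conjSqTwist_two, show (-1 - w.1) ^ 2 = (1 + w.1) ^ 2 by ring]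
  · filter_upwards [self_mem_nhdsWithin] with σ hσ using (hasSum_cuspL_lattice hσ).tsum_eq.symm

end LimitAtTwo

/-! ### Expanding Euler products over finitely supported exponents -/

section EulerProduct

variable {V : Type*} {a : V → ℂ}

/-- Finitely supported functions with support in `insert v S`. -/
noncomputable def finsuppInsertEquiv [DecidableEq V] (S : Finset V) {v : V} (hv : v ∉ S) :
    {e : V →₀ ℕ // e.support ⊆ insert v S} ≃ ℕ × {e : V →₀ ℕ // e.support ⊆ S} where
  toFun e := (e.1 v, ⟨e.1.erase v, by
    rw [Finsupp.support_erase, ← Finset.subset_insert_iff]; exact e.2⟩)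
  invFun x := ⟨x.2.1 + Finsupp.single v x.1, by
    refine Finsupp.support_add.trans (Finset.union_subset (x.2.2.trans (Finset.subset_insert _ _)) ?_)
    exact Finsupp.support_single_subset.trans (Finset.singleton_subset_iff.mpr (Finset.mem_insert_self _ _))⟩
  left_inv e := by
    ext w
    by_cases h : w = v
    · subst h; simp
    · simp [h]
  right_inv x := by
    have h0 : x.2.1 v = 0 := Finsupp.notMem_support_iff.mp fun h ↦ hv (x.2.2 h)
    refine Prod.ext ?_ (Subtype.ext (Finsupp.ext fun w ↦ ?_))
    · simp [h0]
    · by_cases h : w = v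
      · subst h; simp [h0]
      · simp [h]

lemma hasSum_finsupp_prod_pow (ha : ∀ v, ‖a v‖ < 1) (S : Finset V) :
    HasSum (fun e : {e : V →₀ ℕ // e.support ⊆ S} ↦ e.1.prod fun v n ↦ a v ^ n)
      (∏ v ∈ S, (1 - a v)⁻¹) := by
  classical
  induction S using Finset.induction_on with
  | empty =>
    have : Unique {e : V →₀ ℕ // e.support ⊆ ∅} :=
      ⟨⟨⟨0, by simp⟩⟩, fun e ↦ Subtype.ext (Finsupp.support_eq_empty.mp (Finset.subset_empty.mp e.2))⟩
    have h1 := hasSum_unique fun e : {e : V →₀ ℕ // e.support ⊆ ∅} ↦ e.1.prod fun v n ↦ a v ^ n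
    have h0 : (default : {e : V →₀ ℕ // e.support ⊆ ∅}).1 = 0 :=
      Finsupp.support_eq_empty.mp (Finset.subset_empty.mp (default : {e : V →₀ ℕ // e.support ⊆ ∅}).2)
    simpa [h0] using h1
  | insert v S hv ih =>
    rw [Finset.prod_insert hv]
    have h := (hasSum_geometric_of_norm_lt_one (ha v)).mul_complex ih
    rw [← (finsuppInsertEquiv S hv).hasSum_iff] at h
    refine h.congr_fun fun e ↦ ?_
    obtain ⟨⟨n, e⟩, rfl⟩ := (finsuppInsertEquiv S hv).symm.surjective e
    simp only [Function.comp_apply, Equiv.apply_symm_apply]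
    change (e.1 + Finsupp.single v n).prod (fun v n ↦ a v ^ n) = _
    rw [Finsupp.prod_add_index' (by simp) (fun _ _ _ ↦ pow_add _ _ _), Finsupp.prod_single_index (by simp),
      mul_comm]

/-- A finite partial product is the sum over exponents supported in that finite set; dominated
convergence then lets the set grow. -/
lemma hasProd_one_sub_inv (ha : ∀ v, ‖a v‖ < 1)
    (hs : Summable fun e : V →₀ ℕ ↦ ‖e.prod fun v n ↦ a v ^ n‖) :
    HasProd (fun v ↦ (1 - a v)⁻¹) (∑' e : V →₀ ℕ, e.prod fun v n ↦ a v ^ n) := by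
  classical
  set F : (V →₀ ℕ) → ℂ := fun e ↦ e.prod fun v n ↦ a v ^ n with hF
  have h1 (S : Finset V) : ∏ v ∈ S, (1 - a v)⁻¹ =
      ∑' e : V →₀ ℕ, Set.indicator {e | e.support ⊆ S} F e := by
    rw [← tsum_subtype]
    exact (hasSum_finsupp_prod_pow ha S).tsum_eq.symm
  have h2 : Tendsto (fun S : Finset V ↦ ∑' e : V →₀ ℕ, Set.indicator {e | e.support ⊆ S} F e) atTop
      (𝓝 (∑' e, F e)) := by
    refine tendsto_tsum_of_dominated_convergence hs (fun e ↦ ?_)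
      (Eventually.of_forall fun S e ↦ norm_indicator_le_norm_self _ _)
    refine tendsto_const_nhds.congr' ?_
    filter_upwards [eventually_ge_atTop e.support] with S hS
    exact (Set.indicator_of_mem (s := {e : V →₀ ℕ | e.support ⊆ S}) hS F).symm
  exact h2.congr fun S ↦ (h1 S).symm

end EulerProduct

/-! ### Arithmetic of primary Gaussian integers -/

section PrimaryArithmetic

lemma isPrimary_iff_dvd (α : GaussianInt) : IsPrimary α ↔ (⟨2, 2⟩ : GaussianInt) ∣ α - 1 := by
  constructor
  · rintro ⟨⟨b, hb⟩, ⟨c, hc⟩⟩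
    refine ⟨⟨c, b - c⟩, ?_⟩
    ext
    · simp only [Zsqrtd.re_sub, Zsqrtd.re_one, Zsqrtd.re_mul]; lia
    · simp only [Zsqrtd.im_sub, Zsqrtd.im_one, Zsqrtd.im_mul]; lia
  · rintro ⟨β, h⟩
    have h1 := congrArg Zsqrtd.re h
    have h2 := congrArg Zsqrtd.im h
    simp only [Zsqrtd.re_sub, Zsqrtd.re_one, Zsqrtd.re_mul, Zsqrtd.im_sub, Zsqrtd.im_one,
      Zsqrtd.im_mul] at h1 h2
    constructor <;> lia

lemma isPrimary_one : IsPrimary 1 := (isPrimary_iff_dvd 1).mpr (by simp)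

lemma IsPrimary.mul {α β : GaussianInt} (ha : IsPrimary α) (hb : IsPrimary β) : IsPrimary (α * β) := by
  rw [isPrimary_iff_dvd] at *
  have : α * β - 1 = (α - 1) * β + (β - 1) := by ring
  rw [this]
  exact dvd_add (ha.mul_right _) hb

lemma IsPrimary.of_mul {α β : GaussianInt} (ha : IsPrimary α) (hb : IsPrimary (α * β)) : IsPrimary β := by
  rw [isPrimary_iff_dvd] at *
  have : β - 1 = (α * β - 1) - (α - 1) * β := by ring
  rw [this]
  exact dvd_sub hb (ha.mul_right _)

lemma IsPrimary.pow {α : GaussianInt} (ha : IsPrimary α) (n : ℕ) : IsPrimary (α ^ n) := by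
  induction n with
  | zero => simpa using isPrimary_one
  | succ n ih => rw [pow_succ]; exact ih.mul ha

/-- The prime `1 + i`. -/
def oneAddI : GaussianInt := ⟨1, 1⟩

lemma gaussNorm_mul (α β : GaussianInt) : gaussNorm (α * β) = gaussNorm α * gaussNorm β := by
  simp [gaussNorm, Zsqrtd.norm_mul, Int.natAbs_mul]

lemma isUnit_iff_gaussNorm {α : GaussianInt} : IsUnit α ↔ gaussNorm α = 1 :=
  Zsqrtd.norm_eq_one_iff.symm

lemma re_im_of_isUnit {α : GaussianInt} (h : IsUnit α) :
    (α = ⟨1, 0⟩ ∨ α = ⟨-1, 0⟩) ∨ (α = ⟨0, 1⟩ ∨ α = ⟨0, -1⟩) := by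
  have h1 := coe_gaussNorm α
  rw [isUnit_iff_gaussNorm.mp h] at h1
  obtain ⟨a, b⟩ := α
  simp only [Nat.cast_one] at h1
  have ha : a ≤ 1 := by nlinarith
  have ha' : -1 ≤ a := by nlinarith
  have hb : b ≤ 1 := by nlinarith
  have hb' : -1 ≤ b := by nlinarith
  simp only [Zsqrtd.mk.injEq]
  interval_cases a <;> interval_cases b <;> first | (simp; done) | norm_num at h1

/-- The units `±1, ±i` are distinct modulo `2 + 2i`. This makes primary generators unique. -/
lemma IsPrimary.eq_one_of_isUnit {α : GaussianInt} (ha : IsPrimary α) (h : IsUnit α) : α = 1 := by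
  obtain ⟨h1, h2⟩ := ha
  rcases re_im_of_isUnit h with (rfl | rfl) | (rfl | rfl)
  · rfl
  · norm_num at h2
  · norm_num at h1
  · norm_num at h1

lemma oneAddI_dvd_iff (α : GaussianInt) : oneAddI ∣ α ↔ 2 ∣ α.re + α.im := by
  constructor
  · rintro ⟨β, rfl⟩
    simp only [oneAddI, Zsqrtd.re_mul, Zsqrtd.im_mul]
    lia
  · rintro ⟨c, hc⟩
    refine ⟨⟨c, α.im - c⟩, ?_⟩
    ext
    · simp only [oneAddI, Zsqrtd.re_mul]; lia
    · simp only [oneAddI, Zsqrtd.im_mul]; lia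

lemma IsPrimary.not_oneAddI_dvd {α : GaussianInt} (h : IsPrimary α) : ¬ oneAddI ∣ α := by
  rw [oneAddI_dvd_iff]
  obtain ⟨h1, h2⟩ := h
  lia

lemma isUnit_I : IsUnit (⟨0, 1⟩ : GaussianInt) := isUnit_iff_gaussNorm.mpr rfl

/-- Every Gaussian integer prime to `1 + i` has a primary associate. -/
lemma exists_isPrimary_mul {α : GaussianInt} (h : ¬ oneAddI ∣ α) :
    ∃ n : ℕ, IsPrimary ((⟨0, 1⟩ : GaussianInt) ^ n * α) := by
  rw [oneAddI_dvd_iff] at h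
  obtain ⟨a, b⟩ := α
  simp only at h
  have h4 : (2 ∣ b ∧ 4 ∣ a + b - 1) ∨ (2 ∣ b ∧ 4 ∣ a + b - 3) ∨ (¬ 2 ∣ b ∧ 4 ∣ a - b - 1) ∨
    (¬ 2 ∣ b ∧ 4 ∣ a - b - 3) := by lia
  rcases h4 with h4 | h4 | h4 | h4
  · exact ⟨0, by simpa using! h4⟩
  · refine ⟨2, ?_, ?_⟩ <;> simp [pow_succ] <;> lia
  · refine ⟨1, ?_, ?_⟩ <;> simp <;> lia
  · refine ⟨3, ?_, ?_⟩ <;> simp [pow_succ] <;> lia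

lemma prime_oneAddI : Prime oneAddI := by
  refine irreducible_iff_prime.mp ⟨fun h ↦ ?_, fun {a b} h ↦ ?_⟩
  · exact absurd (isUnit_iff_gaussNorm.mp h) (by decide)
  · have h2 : gaussNorm a * gaussNorm b = 2 := by
      rw [← gaussNorm_mul, ← h]
      rfl
    rw [isUnit_iff_gaussNorm, isUnit_iff_gaussNorm]
    have h3 := (Nat.prime_mul_iff (a := gaussNorm a) (b := gaussNorm b)).mp (h2 ▸ Nat.prime_two)
    tauto

end PrimaryArithmetic

/-! ### Unique factorization into primary primes and Euler products -/

section PrimeSystem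

variable {V : Type*} {p : V → GaussianInt} {lam : V}

/-- The Gaussian integers `p v` represent the primes of `ℤ[i]` up to units; they are primary,
except for `p lam = 1 + i`. -/
structure IsPrimeSystem (p : V → GaussianInt) (lam : V) : Prop where
  prime : ∀ v, Prime (p v)
  exists_associated : ∀ q, Prime q → ∃ v, Associated (p v) q
  eq_of_associated : ∀ u v, Associated (p u) (p v) → u = v
  isPrimary : ∀ v, v ≠ lam → IsPrimary (p v)
  map_lam : p lam = oneAddI

/-- The Gaussian integer with given exponents. -/
noncomputable def gaussProd (p : V → GaussianInt) (e : V →₀ ℕ) : GaussianInt := e.prod fun v n ↦ p v ^ n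

lemma gaussProd_add (e f : V →₀ ℕ) : gaussProd p (e + f) = gaussProd p e * gaussProd p f :=
  Finsupp.prod_add_index' (by simp) (fun _ _ _ ↦ pow_add _ _ _)

@[simp] lemma gaussProd_single (v : V) : gaussProd p (Finsupp.single v 1) = p v := by
  simp [gaussProd]

namespace IsPrimeSystem

lemma isPrimary_gaussProd (h : IsPrimeSystem p lam) {e : V →₀ ℕ} (he : e lam = 0) :
    IsPrimary (gaussProd p e) := by
  refine Finset.prod_induction _ IsPrimary (fun _ _ ↦ IsPrimary.mul) isPrimary_one fun v hv ↦ ?_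
  refine (h.isPrimary v ?_).pow _
  rintro rfl
  exact Finsupp.mem_support_iff.mp hv he

lemma gaussProd_ne_zero (h : IsPrimeSystem p lam) (e : V →₀ ℕ) : gaussProd p e ≠ 0 :=
  Finset.prod_ne_zero_iff.mpr fun v _ ↦ pow_ne_zero _ (h.prime v).ne_zero

lemma emultiplicity_gaussProd (h : IsPrimeSystem p lam) (e : V →₀ ℕ) (v : V) :
    emultiplicity (p v) (gaussProd p e) = e v := by
  classical
  rw [gaussProd, Finsupp.prod, Finset.emultiplicity_prod (h.prime v)]
  have h1 (u : V) : emultiplicity (p v) (p u ^ e u) = if u = v then (e v : ℕ∞) else 0 := by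
    rw [emultiplicity_pow (h.prime v)]
    split_ifs with huv
    · subst huv
      rw [(FiniteMultiplicity.of_prime_left (h.prime u) (h.prime u).ne_zero).emultiplicity_self, mul_one]
    · rw [emultiplicity_eq_zero.mpr, mul_zero]
      exact fun hd ↦ huv (h.eq_of_associated _ _ ((h.prime v).associated_of_dvd (h.prime u) hd).symm)
  simp only [h1, Finset.sum_ite_eq', Finsupp.mem_support_iff]
  split_ifs with h0
  · rfl
  · simp only [ne_eq, not_not] at h0
    rw [h0]
    rfl

lemma gaussProd_injective (h : IsPrimeSystem p lam) : Function.Injective (gaussProd p) := fun e f hef ↦ by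
  ext v
  have := h.emultiplicity_gaussProd e v
  rw [hef, h.emultiplicity_gaussProd] at this
  exact_mod_cast this.symm

lemma exists_gaussProd (h : IsPrimeSystem p lam) {α : GaussianInt} (hα : α ≠ 0) :
    ∃ u : GaussianInt, IsUnit u ∧ ∃ e, α = gaussProd p e * u := by
  induction α using UniqueFactorizationMonoid.induction_on_prime with
  | h₁ => exact absurd rfl hα
  | h₂ u hu => exact ⟨u, hu, 0, by simp [gaussProd]⟩
  | h₃ a q ha hq ih =>
    obtain ⟨u, hu, e, he⟩ := ih ha
    obtain ⟨v, w, hv⟩ := h.exists_associated q hq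
    refine ⟨u * w, hu.mul w.isUnit, e + Finsupp.single v 1, ?_⟩
    rw [gaussProd_add, gaussProd_single, he, ← hv]
    ring

/-- Unique factorization of primary Gaussian integers. -/
noncomputable def primaryEquiv (h : IsPrimeSystem p lam) : {e : V →₀ ℕ // e lam = 0} ≃ PrimaryGaussian :=
  Equiv.ofBijective (fun e ↦ ⟨gaussProd p e.1, h.isPrimary_gaussProd e.2⟩) (by
    refine ⟨fun e f hef ↦ Subtype.ext (h.gaussProd_injective (congrArg Subtype.val hef)), fun α ↦ ?_⟩
    obtain ⟨u, hu, e, he⟩ := h.exists_gaussProd α.2.ne_zero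
    -- A primary integer is prime to `1 + i`; the remaining unit factor is itself primary, hence
    -- `1`.
    have he0 : e lam = 0 := by
      by_contra h0
      refine α.2.not_oneAddI_dvd ?_
      rw [he, ← h.map_lam]
      refine Dvd.dvd.mul_right ?_ _
      exact (dvd_pow_self _ h0).trans (Finset.dvd_prod_of_mem _ (Finsupp.mem_support_iff.mpr h0))
    have hu1 := ((h.isPrimary_gaussProd he0).of_mul (he ▸ α.2)).eq_one_of_isUnit hu
    exact ⟨⟨e, he0⟩, Subtype.ext (by simp [he, hu1])⟩)

@[simp] lemma coe_primaryEquiv (h : IsPrimeSystem p lam) (e : {e : V →₀ ℕ // e lam = 0}) :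
    (h.primaryEquiv e).1 = gaussProd p e.1 := rfl

end IsPrimeSystem

/-- The completely multiplicative function `α ↦ N(α)^{-s}`. -/
noncomputable def gaussNormCpow (s : ℂ) : GaussianInt →* ℂ where
  toFun α := (gaussNorm α : ℂ) ^ (-s)
  map_one' := by simp [gaussNorm]
  map_mul' α β := by rw [gaussNorm_mul, Nat.cast_mul, Complex.natCast_mul_natCast_cpow]

/-- The completely multiplicative function `α ↦ α / |α|`. -/
noncomputable def gaussSign : GaussianInt →* ℂ where
  toFun α := (α : ℂ) / (‖(α : ℂ)‖ : ℂ)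
  map_one' := by simp
  map_mul' α β := by
    rw [map_mul, norm_mul, Complex.ofReal_mul, mul_div_mul_comm]

lemma norm_gaussNormCpow {s : ℂ} {α : GaussianInt} (hα : α ≠ 0) :
    ‖gaussNormCpow s α‖ = (gaussNorm α : ℝ) ^ (-s.re) :=
  (Complex.norm_natCast_cpow_of_pos (gaussNorm_pos hα) _).trans (by rw [Complex.neg_re])

lemma norm_gaussSign {α : GaussianInt} (hα : α ≠ 0) : ‖gaussSign α‖ = 1 := by
  have h : (α : ℂ) ≠ 0 := fun h ↦ hα (GaussianInt.toComplex_eq_zero.mp h)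
  change ‖(α : ℂ) / (‖(α : ℂ)‖ : ℂ)‖ = 1
  rw [norm_div, Complex.norm_real, norm_norm, div_self (norm_ne_zero_iff.mpr h)]

namespace IsPrimeSystem

lemma prod_mul_gaussNormCpow {x : V → ℂ} (s : ℂ) (e : V →₀ ℕ) :
    (e.prod fun v n ↦ (x v * gaussNormCpow s (p v)) ^ n) =
      (e.prod fun v n ↦ x v ^ n) * gaussNormCpow s (gaussProd p e) := by
  rw [gaussProd, map_finsuppProd, ← Finsupp.prod_mul]
  simp only [map_pow, mul_pow]

lemma norm_prod_le_one {x : V → ℂ} (hx : ∀ v, ‖x v‖ ≤ 1) (e : V →₀ ℕ) :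
    ‖e.prod fun v n ↦ x v ^ n‖ ≤ 1 := by
  rw [Finsupp.prod, norm_prod]
  refine Finset.prod_le_one (fun _ _ ↦ norm_nonneg _) fun v _ ↦ ?_
  rw [norm_pow]
  exact pow_le_one₀ (norm_nonneg _) (hx v)

lemma summable_euler (h : IsPrimeSystem p lam) {x : V → ℂ} (hx : ∀ v, ‖x v‖ ≤ 1) {s : ℂ} (hs : 1 < s.re) :
    Summable fun e : V →₀ ℕ ↦ ‖(e.prod fun v n ↦ x v ^ n) * gaussNormCpow s (gaussProd p e)‖ := by
  refine Summable.of_nonneg_of_le (fun _ ↦ norm_nonneg _) (fun e ↦ ?_)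
    ((summable_gaussNorm_rpow hs).comp_injective h.gaussProd_injective)
  rw [norm_mul, norm_gaussNormCpow (h.gaussProd_ne_zero e)]
  exact mul_le_of_le_one_left (by positivity) (norm_prod_le_one hx e)

lemma hasProd_euler (h : IsPrimeSystem p lam) {x : V → ℂ} (hx : ∀ v, ‖x v‖ ≤ 1) {s : ℂ} (hs : 1 < s.re) :
    HasProd (fun v ↦ (1 - x v * gaussNormCpow s (p v))⁻¹)
      (∑' e : V →₀ ℕ, (e.prod fun v n ↦ x v ^ n) * gaussNormCpow s (gaussProd p e)) := by
  have h1 := h.summable_euler hx hs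
  simp only [← prod_mul_gaussNormCpow] at h1 ⊢
  refine hasProd_one_sub_inv (fun v ↦ ?_) h1
  have hN : 1 < gaussNorm (p v) := by
    have h0 := gaussNorm_pos (h.prime v).ne_zero
    have h1 : gaussNorm (p v) ≠ 1 := fun h1 ↦ (h.prime v).not_isUnit (isUnit_iff_gaussNorm.mpr h1)
    lia
  rw [norm_mul, norm_gaussNormCpow (h.prime v).ne_zero]
  refine (mul_le_of_le_one_left (by positivity) (hx v)).trans_lt ?_
  exact Real.rpow_lt_one_of_one_lt_of_neg (by exact_mod_cast hN) (by linarith)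

open Classical in
/-- The values at the primes of the character `α ↦ α / |α|` on primary `α`. -/
noncomputable def signValue (p : V → GaussianInt) (lam v : V) : ℂ := if v = lam then 0 else gaussSign (p v)

lemma signValue_lam : signValue p lam lam = 0 := if_pos rfl

lemma signValue_of_ne {v : V} (hv : v ≠ lam) : signValue p lam v = gaussSign (p v) := if_neg hv

lemma norm_signValue_le (h : IsPrimeSystem p lam) (v : V) : ‖signValue p lam v‖ ≤ 1 := by
  by_cases hv : v = lam
  · rw [hv, signValue_lam, norm_zero]
    exact zero_le_one
  · rw [signValue_of_ne hv, norm_gaussSign (h.prime v).ne_zero]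

/-- Unique factorization reindexes the primary sum by exponents. Exponents involving `1 + i`
contribute nothing because the local value there is `0`; this uses `k ≠ 0`. -/
lemma hasSum_signValue (h : IsPrimeSystem p lam) {k : ℕ} (hk : k ≠ 0) {f : GaussianInt → ℂ} {a : ℂ}
    (ha : HasSum (fun α : PrimaryGaussian ↦ gaussSign α.1 ^ k * f α.1) a) :
    HasSum (fun e : V →₀ ℕ ↦ (e.prod fun v n ↦ (signValue p lam v ^ k) ^ n) * f (gaussProd p e)) a := by
  have h1 := h.primaryEquiv.hasSum_iff.mpr ha
  have h2 : Function.support (fun e : V →₀ ℕ ↦ (e.prod fun v n ↦ (signValue p lam v ^ k) ^ n) *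
      f (gaussProd p e)) ⊆ {e | e lam = 0} := by
    intro e he
    by_contra h0
    refine he ?_
    have : (e.prod fun v n ↦ (signValue p lam v ^ k) ^ n) = 0 := by
      refine Finset.prod_eq_zero (Finsupp.mem_support_iff.mpr h0) ?_
      simp only [signValue_lam, zero_pow hk]
      exact zero_pow h0
    simp only [this, zero_mul]
  refine (hasSum_subtype_iff_of_support_subset h2).mp (h1.congr_fun fun e ↦ ?_)
  simp only [Function.comp_apply, coe_primaryEquiv]
  congr 1
  rw [gaussProd, map_finsuppProd, Finsupp.prod, Finsupp.prod, ← Finset.prod_pow]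
  refine Finset.prod_congr rfl fun v hv ↦ ?_
  have hv' : v ≠ lam := by
    rintro rfl
    exact Finsupp.mem_support_iff.mp hv e.2
  rw [signValue_of_ne hv', map_pow, pow_right_comm]

/-- The Euler product of `∑ (α / |α|)^k N(α)^{-s}` over primary `α`. -/
lemma hasProd_signValue (h : IsPrimeSystem p lam) {k : ℕ} (hk : k ≠ 0) {s a : ℂ} (hs : 1 < s.re)
    (ha : HasSum (fun α : PrimaryGaussian ↦ gaussSign α.1 ^ k * gaussNormCpow s α.1) a) :
    HasProd (fun v ↦ (1 - signValue p lam v ^ k * gaussNormCpow s (p v))⁻¹) a := by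
  have h1 := h.hasProd_euler (x := fun v ↦ signValue p lam v ^ k) (fun v ↦ by
    rw [norm_pow]
    exact pow_le_one₀ (norm_nonneg _) (h.norm_signValue_le v)) hs
  rwa [(h.hasSum_signValue hk ha).tsum_eq] at h1

end IsPrimeSystem

end PrimeSystem

/-! ### Recovering local values from the `L`-function, up to conjugation -/

section Comparison

variable {V : Type*} {p : V → GaussianInt} {lam : V}

lemma prime_star {α : GaussianInt} (h : Prime α) : Prime (star α) :=
  (MulEquiv.prime_iff (starMulAut (R := GaussianInt))).mpr h

lemma associated_star {α β : GaussianInt} (h : Associated α β) : Associated (star α) (star β) :=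
  h.map (starMulAut (R := GaussianInt)).toMonoidHom

lemma gaussNorm_eq_of_associated {α β : GaussianInt} (h : Associated α β) : gaussNorm α = gaussNorm β := by
  obtain ⟨u, rfl⟩ := h
  rw [gaussNorm_mul, isUnit_iff_gaussNorm.mp u.isUnit, mul_one]

lemma associated_of_dvd_of_gaussNorm {α β : GaussianInt} (hα : α ≠ 0) (h : α ∣ β)
    (hN : gaussNorm β = gaussNorm α) : Associated α β := by
  obtain ⟨c, rfl⟩ := h
  rw [gaussNorm_mul] at hN
  have hc : IsUnit c := isUnit_iff_gaussNorm.mpr (Nat.eq_of_mul_eq_mul_left (gaussNorm_pos hα) (by lia))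
  exact ⟨hc.unit, rfl⟩

lemma IsPrimary.eq_of_associated {α β : GaussianInt} (ha : IsPrimary α) (hb : IsPrimary β)
    (h : Associated α β) : α = β := by
  obtain ⟨u, rfl⟩ := h
  rw [(ha.of_mul hb).eq_one_of_isUnit u.isUnit, mul_one]

lemma gaussSign_star (α : GaussianInt) : gaussSign (star α) = starRingEnd ℂ (gaussSign α) := by
  change ((star α : GaussianInt) : ℂ) / (‖((star α : GaussianInt) : ℂ)‖ : ℂ) = starRingEnd ℂ ((α : ℂ) / (‖(α : ℂ)‖ : ℂ))
  rw [GaussianInt.toComplex_star, Complex.norm_conj, map_div₀, Complex.conj_ofReal]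

/-- If `x` or `y` is `0`, the sum has modulus `0` or `1`, which is excluded. Otherwise conjugating
the nonzero real sum gives `xy = 1`, so `x, y` and `z, z̄` are the roots of the same quadratic. -/
lemma eq_or_eq_of_add_eq {x y z : ℂ} (hx : x = 0 ∨ ‖x‖ = 1) (hy : y = 0 ∨ ‖y‖ = 1) (hz : ‖z‖ = 1)
    (h : x + y = z + starRingEnd ℂ z) (h0 : z + starRingEnd ℂ z ≠ 0) (h1 : ‖z + starRingEnd ℂ z‖ ≠ 1) :
    (x = z ∧ y = starRingEnd ℂ z) ∨ (x = starRingEnd ℂ z ∧ y = z) := by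
  have hu {w : ℂ} (hw : ‖w‖ = 1) : w * starRingEnd ℂ w = 1 := by
    rw [Complex.mul_conj', hw]
    simp
  rcases hx with rfl | hx
  · rw [zero_add] at h
    rcases hy with rfl | hy
    · exact absurd h.symm h0
    · exact absurd (h ▸ hy) h1
  · rcases hy with rfl | hy
    · rw [add_zero] at h
      exact absurd (h ▸ hx) h1
    · have hxy : x * y = 1 := by
        have h2 : starRingEnd ℂ x + starRingEnd ℂ y = z + starRingEnd ℂ z := by
          rw [← map_add, h, map_add, Complex.conj_conj, add_comm]
        refine mul_right_cancel₀ h0 ?_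
        linear_combination (-(x * y)) * h2 + y * hu hx + x * hu hy + h
      have hq : (x - z) * (x - starRingEnd ℂ z) = 0 := by
        linear_combination hu hz + x * h - hxy
      rcases mul_eq_zero.mp hq with h2 | h2
      · have h3 := sub_eq_zero.mp h2
        exact Or.inl ⟨h3, by rw [h3] at h; exact add_left_cancel h⟩
      · have h3 := sub_eq_zero.mp h2
        exact Or.inr ⟨h3, by rw [h3, add_comm] at h; exact add_right_cancel h⟩

/-- With `α = a + bi` the sum is `2a/|α|`. It is nonzero because `a` is odd, and modulus one would
mean `3a² = b²`, impossible with `a` odd and `b` even. -/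
lemma IsPrimary.gaussSign_add_conj {α : GaussianInt} (h : IsPrimary α) :
    gaussSign α + starRingEnd ℂ (gaussSign α) ≠ 0 ∧ ‖gaussSign α + starRingEnd ℂ (gaussSign α)‖ ≠ 1 := by
  have hN := coe_gaussNorm α
  have hN0 := norm_toComplex_sq α
  have hpos : 0 < ‖(α : ℂ)‖ := norm_pos_iff.mpr fun h0 ↦ h.ne_zero (GaussianInt.toComplex_eq_zero.mp h0)
  have e : gaussSign α + starRingEnd ℂ (gaussSign α) = ((2 * α.re / ‖(α : ℂ)‖ : ℝ) : ℂ) := by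
    change (α : ℂ) / (‖(α : ℂ)‖ : ℂ) + starRingEnd ℂ ((α : ℂ) / (‖(α : ℂ)‖ : ℂ)) = _
    rw [map_div₀, Complex.conj_ofReal, ← add_div, Complex.add_conj, ← GaussianInt.intCast_re]
    push_cast
    rfl
  obtain ⟨⟨b, hb⟩, ⟨c, hc⟩⟩ := h
  have hre : α.re = 2 * (2 * c - b) + 1 := by lia
  rw [e]
  refine ⟨fun h0 ↦ ?_, fun h1 ↦ ?_⟩
  · rw [Complex.ofReal_eq_zero, div_eq_zero_iff] at h0
    rcases h0 with h0 | h0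
    · have : (2 * α.re : ℤ) = 0 := by exact_mod_cast h0
      lia
    · exact hpos.ne' h0
  · rw [Complex.norm_real, Real.norm_eq_abs, abs_div, abs_of_pos hpos, div_eq_one_iff_eq hpos.ne'] at h1
    have h2 : (2 * (α.re : ℝ)) ^ 2 = gaussNorm α := by rw [← hN0, ← h1, sq_abs]
    have h3 : (2 * α.re) ^ 2 = (gaussNorm α : ℤ) := by exact_mod_cast h2
    rw [hN, hre, hb] at h3
    have h4 : 2 * (6 * (2 * c - b) ^ 2 + 6 * (2 * c - b) + 1 - 2 * b ^ 2) = -1 := by linear_combination h3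
    lia

namespace IsPrimeSystem

/-- The index of the complex conjugate prime. -/
noncomputable def conjIndex (h : IsPrimeSystem p lam) (v : V) : V :=
  (h.exists_associated _ (prime_star (h.prime v))).choose

lemma associated_conjIndex (h : IsPrimeSystem p lam) (v : V) : Associated (p (h.conjIndex v)) (star (p v)) :=
  (h.exists_associated _ (prime_star (h.prime v))).choose_spec

lemma conjIndex_conjIndex (h : IsPrimeSystem p lam) (v : V) : h.conjIndex (h.conjIndex v) = v := by
  refine h.eq_of_associated _ _ ((h.associated_conjIndex _).trans ?_)
  simpa using associated_star (h.associated_conjIndex v)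

lemma conjIndex_lam (h : IsPrimeSystem p lam) : h.conjIndex lam = lam := by
  refine h.eq_of_associated _ _ ((h.associated_conjIndex _).trans ?_)
  rw [h.map_lam]
  exact ⟨isUnit_I.unit, rfl⟩

lemma conjIndex_ne (h : IsPrimeSystem p lam) {v : V} (hv : v ≠ lam) : h.conjIndex v ≠ lam := fun h0 ↦ by
  have := h.conjIndex_conjIndex v
  rw [h0, h.conjIndex_lam] at this
  exact hv this.symm

lemma gaussNorm_conjIndex (h : IsPrimeSystem p lam) (v : V) :
    gaussNorm (p (h.conjIndex v)) = gaussNorm (p v) := by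
  rw [gaussNorm_eq_of_associated (h.associated_conjIndex v), gaussNorm_star]

lemma signValue_conjIndex (h : IsPrimeSystem p lam) {v : V} (hv : v ≠ lam) :
    signValue p lam (h.conjIndex v) = starRingEnd ℂ (signValue p lam v) := by
  rw [signValue_of_ne hv, signValue_of_ne (h.conjIndex_ne hv), ← gaussSign_star,
    (h.isPrimary _ (h.conjIndex_ne hv)).eq_of_associated (h.isPrimary _ hv).star (h.associated_conjIndex v)]

lemma eq_single_of_associated (h : IsPrimeSystem p lam) {e : V →₀ ℕ} {v : V}
    (he : Associated (p v) (gaussProd p e)) : e = Finsupp.single v 1 := by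
  ext u
  have h1 := h.emultiplicity_gaussProd e u
  rw [← emultiplicity_eq_of_associated_right he, ← gaussProd_single (p := p) v, h.emultiplicity_gaussProd] at h1
  exact_mod_cast h1.symm

/-- If `N(α) = N(p)`, then `p` divides `αᾱ`, hence `α` or `ᾱ`, and equality of norms turns
divisibility into association. -/
lemma gaussNorm_gaussProd_eq_iff (h : IsPrimeSystem p lam) (e : V →₀ ℕ) (v : V) :
    gaussNorm (gaussProd p e) = gaussNorm (p v) ↔
      e = Finsupp.single v 1 ∨ e = Finsupp.single (h.conjIndex v) 1 := by
  constructor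
  · intro hN
    have h1 : p v ∣ gaussProd p e * star (gaussProd p e) := by
      rw [← Zsqrtd.norm_eq_mul_conj]
      have h2 : (gaussProd p e).norm = (p v).norm := by
        have h3 (α : GaussianInt) : α.norm = gaussNorm α := by
          rw [gaussNorm, Int.natAbs_of_nonneg (GaussianInt.norm_nonneg α)]
        rw [h3, h3, hN]
      rw [h2, Zsqrtd.norm_eq_mul_conj]
      exact dvd_mul_right _ _
    rcases (h.prime v).dvd_or_dvd h1 with h2 | h2
    · exact Or.inl (h.eq_single_of_associated (associated_of_dvd_of_gaussNorm (h.prime v).ne_zero h2 hN))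
    · refine Or.inr (h.eq_single_of_associated ((h.associated_conjIndex v).trans ?_))
      have := associated_star (associated_of_dvd_of_gaussNorm (h.prime v).ne_zero h2
        (by rw [gaussNorm_star, hN]))
      rwa [star_star] at this
  · rintro (rfl | rfl)
    · rw [gaussProd_single]
    · rw [gaussProd_single, h.gaussNorm_conjIndex]

-- Only a prime and its conjugate have that norm, so this Dirichlet coefficient sees exactly their
-- local values. A self-conjugate index (an inert prime or `1 + i`) counts once.
open Classical in
lemma fiberCoeff_prime (h : IsPrimeSystem p lam) (x : V → ℂ) (v : V) :
    fiberCoeff (fun e : V →₀ ℕ ↦ gaussNorm (gaussProd p e)) (fun e ↦ e.prod fun v n ↦ x v ^ n)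
      (gaussNorm (p v)) = if h.conjIndex v = v then x v else x v + x (h.conjIndex v) := by
  have hset : {e : V →₀ ℕ | gaussNorm (gaussProd p e) = gaussNorm (p v)} =
      (({Finsupp.single v 1, Finsupp.single (h.conjIndex v) 1} : Finset (V →₀ ℕ)) : Set (V →₀ ℕ)) := by
    ext e
    simp [h.gaussNorm_gaussProd_eq_iff]
  have h1 : fiberCoeff (fun e : V →₀ ℕ ↦ gaussNorm (gaussProd p e)) (fun e ↦ e.prod fun v n ↦ x v ^ n)
      (gaussNorm (p v)) = ∑' e : ({e : V →₀ ℕ | gaussNorm (gaussProd p e) = gaussNorm (p v)} : Set (V →₀ ℕ)),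
        e.1.prod fun v n ↦ x v ^ n := rfl
  rw [h1, hset, Finset.tsum_subtype' _ fun e : V →₀ ℕ ↦ e.prod fun v n ↦ x v ^ n]
  split_ifs with hv
  · simp [hv]
  · rw [Finset.sum_pair]
    · simp
    · intro h0
      exact hv ((Finsupp.single_left_injective one_ne_zero h0).symm)

section Matching

variable {x : V → ℂ}

open Classical in
lemma fiberCoeff_eq_signValue (h : IsPrimeSystem p lam) (hx : ∀ v, ‖x v‖ ≤ 1)
    (hL : ∀ s : ℂ, 1 < s.re → ∃ a, HasProd (fun v ↦ (1 - x v * gaussNormCpow s (p v))⁻¹) a ∧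
      HasSum (fun α : PrimaryGaussian ↦ gaussSign α.1 * gaussNormCpow s α.1) a) (v : V) :
    (if h.conjIndex v = v then x v else x v + x (h.conjIndex v)) =
      if h.conjIndex v = v then signValue p lam v else signValue p lam v + signValue p lam (h.conjIndex v) := by
  rw [← h.fiberCoeff_prime x v, ← h.fiberCoeff_prime (signValue p lam) v]
  refine fiberCoeff_eq_of_hasSum (σ := 1) (fun s hs ↦ ?_) (gaussNorm_pos (h.prime v).ne_zero).ne'
  have hs' : 1 < (s : ℂ).re := by simpa using hs
  obtain ⟨a, h1, h2⟩ := hL s hs'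
  refine ⟨a, ?_, ?_⟩
  · have h3 := (h.summable_euler hx hs').of_norm.hasSum
    rw [← h1.unique (h.hasProd_euler hx hs')] at h3
    exact h3
  · have h3 := h.hasSum_signValue one_ne_zero (f := gaussNormCpow s) (a := a) (by simpa using h2)
    simp only [pow_one] at h3
    exact h3

lemma eq_signValue_or (h : IsPrimeSystem p lam) (hx : ∀ v, x v = 0 ∨ ‖x v‖ = 1)
    (hL : ∀ s : ℂ, 1 < s.re → ∃ a, HasProd (fun v ↦ (1 - x v * gaussNormCpow s (p v))⁻¹) a ∧
      HasSum (fun α : PrimaryGaussian ↦ gaussSign α.1 * gaussNormCpow s α.1) a) (v : V) :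
    x v = signValue p lam v ∨
      (x v = signValue p lam (h.conjIndex v) ∧ x (h.conjIndex v) = signValue p lam v) := by
  have h1 := h.fiberCoeff_eq_signValue (fun v ↦ by
    rcases hx v with h0 | h0 <;> simp [h0]) hL v
  split_ifs at h1 with hv
  · exact Or.inl h1
  · have hv' : v ≠ lam := fun h0 ↦ hv (h0 ▸ h.conjIndex_lam)
    rw [h.signValue_conjIndex hv', signValue_of_ne hv'] at *
    obtain ⟨h2, h3⟩ := (h.isPrimary v hv').gaussSign_add_conj
    rcases eq_or_eq_of_add_eq (hx _) (hx _) (norm_gaussSign (h.prime v).ne_zero) h1 h2 h3 with h4 | h4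
    · exact Or.inl h4.1
    · exact Or.inr h4

/-- A family of local values with the `L`-function of the standard character is obtained from the standard
one by permuting conjugate primes. -/
lemma exists_perm (h : IsPrimeSystem p lam) (hx : ∀ v, x v = 0 ∨ ‖x v‖ = 1)
    (hL : ∀ s : ℂ, 1 < s.re → ∃ a, HasProd (fun v ↦ (1 - x v * gaussNormCpow s (p v))⁻¹) a ∧
      HasSum (fun α : PrimaryGaussian ↦ gaussSign α.1 * gaussNormCpow s α.1) a) :
    ∃ σ : V ≃ V, ∀ v, x v = signValue p lam (σ v) ∧ gaussNorm (p (σ v)) = gaussNorm (p v) ∧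
      (v ≠ lam → σ v ≠ lam) := by
  classical
  have key := h.eq_signValue_or hx hL
  -- Exchange `v` with its conjugate exactly where the value is not already the standard one. The
  -- dichotomy makes both members of a pair move together, so `σ` is an involution.
  let σ : V → V := fun v ↦ if x v = signValue p lam v then v else h.conjIndex v
  have hσ : Function.Involutive σ := fun v ↦ by
    simp only [σ]
    by_cases h0 : x v = signValue p lam v
    · simp [h0]
    · obtain ⟨h1, h2⟩ := (key v).resolve_left h0
      have h3 : x (h.conjIndex v) ≠ signValue p lam (h.conjIndex v) := fun h3 ↦
        h0 (by rw [h1, ← h3, h2])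
      rw [if_neg h0, if_neg h3, h.conjIndex_conjIndex]
  refine ⟨hσ.toPerm, fun v ↦ ?_⟩
  simp only [Function.Involutive.coe_toPerm, σ]
  by_cases h0 : x v = signValue p lam v
  · simp [h0]
  · simp only [h0, if_false]
    exact ⟨((key v).resolve_left h0).1, h.gaussNorm_conjIndex v, h.conjIndex_ne⟩

end Matching

end IsPrimeSystem

end Comparison

/-! ### Identification of `K` with `ℚ(i)` and choice of prime generators -/

section GaussianField

/-- An identification of a number field with `ℚ(i)`, together with the choice of a generator for each prime
ideal, primary if the prime is odd. -/
structure GaussianField (K : Type*) [Field K] [NumberField K] where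
  /-- The infinite place. -/
  infPlace : InfinitePlace K
  eq_infPlace : ∀ w : InfinitePlace K, w = infPlace
  isComplex : infPlace.IsComplex
  /-- The Gaussian integers are the ring of integers. -/
  equiv : GaussianInt ≃+* 𝓞 K
  embedding_equiv : ∀ α : GaussianInt, infPlace.embedding (equiv α : K) = (α : ℂ)
  /-- The chosen generators. -/
  gen : HeightOneSpectrum (𝓞 K) → GaussianInt
  /-- The prime over `2`. -/
  lam : HeightOneSpectrum (𝓞 K)
  isPrimeSystem : IsPrimeSystem gen lam
  asIdeal_eq : ∀ v, v.asIdeal = Ideal.span {equiv (gen v)}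

variable {K : Type*} [Field K] [NumberField K]

lemma exists_eq_add_mul_of_finrank_eq_two (hK : Module.finrank ℚ K = 2) {j : K} (hj : j * j = -1) (x : K) :
    ∃ a b : ℚ, x = a + b * j := by
  have hind : LinearIndependent ℚ ![(1 : K), j] := by
    rw [LinearIndependent.pair_iff]
    intro s t h
    rw [Algebra.smul_def, Algebra.smul_def, mul_one] at h
    have h2 : s * s + t * t = 0 := by
      refine (algebraMap ℚ K).injective ?_
      rw [map_add, map_mul, map_mul, map_zero]
      linear_combination (algebraMap ℚ K s - algebraMap ℚ K t * j) * h + (algebraMap ℚ K t) ^ 2 * hj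
    exact ⟨by nlinarith [mul_self_nonneg s, mul_self_nonneg t],
      by nlinarith [mul_self_nonneg s, mul_self_nonneg t]⟩
  have hspan := hind.span_eq_top_of_card_eq_finrank (by simp [hK])
  have hx : x ∈ Submodule.span ℚ (Set.range ![(1 : K), j]) := hspan ▸ Submodule.mem_top
  rw [Matrix.range_cons_cons_empty, Submodule.mem_span_pair] at hx
  obtain ⟨a, b, rfl⟩ := hx
  exact ⟨a, b, by simp [Algebra.smul_def]⟩

lemma infinitePlace_isComplex {j : K} (hj : j * j = -1) (w : InfinitePlace K) : w.IsComplex := by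
  rw [← InfinitePlace.not_isReal_iff_isComplex]
  intro hw
  have h := congrArg (InfinitePlace.embedding_of_isReal hw) hj
  rw [map_mul, map_neg, map_one] at h
  nlinarith [mul_self_nonneg (InfinitePlace.embedding_of_isReal hw j)]

lemma subsingleton_infinitePlace (hK : Module.finrank ℚ K = 2) {j : K} (hj : j * j = -1) :
    Subsingleton (InfinitePlace K) := by
  have h1 := InfinitePlace.card_add_two_mul_card_eq_rank K
  have h2 := InfinitePlace.card_eq_nrRealPlaces_add_nrComplexPlaces K
  classical
  have h3 : InfinitePlace.nrRealPlaces K = 0 :=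
    Fintype.card_eq_zero_iff.mpr ⟨fun w ↦ InfinitePlace.not_isReal_iff_isComplex.mpr
      (infinitePlace_isComplex hj w.1) w.2⟩
  rw [← Fintype.card_le_one_iff_subsingleton]
  lia

lemma exists_embedding_eq_I {j : K} (hj : j * j = -1) (w : InfinitePlace K) :
    ∃ j' : K, j' * j' = -1 ∧ w.embedding j' = Complex.I := by
  have h := congrArg w.embedding hj
  rw [map_mul, map_neg, map_one, ← Complex.I_mul_I, mul_self_eq_mul_self_iff] at h
  rcases h with h | h
  · exact ⟨j, hj, h⟩
  · exact ⟨-j, by rw [neg_mul_neg, hj], by rw [map_neg, h, neg_neg]⟩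

/-- `ℤ[i]` is integrally closed and has fraction field `K`, so its image exhausts the integers of
`K`. The square root of `-1` is chosen so that the given embedding sends it to `i`. -/
lemma exists_equiv_ringOfIntegers (hK : Module.finrank ℚ K = 2) {j : K} (hj : j * j = -1)
    (w : InfinitePlace K) :
    ∃ γ : GaussianInt ≃+* 𝓞 K, ∀ α : GaussianInt, w.embedding (γ α : K) = (α : ℂ) := by
  obtain ⟨j, hj, hw⟩ := exists_embedding_eq_I hj w
  have hint : IsIntegral ℤ j := ⟨Polynomial.X ^ 2 + 1, by monicity!, by simp [sq, hj]⟩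
  let j' : 𝓞 K := ⟨j, hint⟩
  have hj' : j' * j' = ((-1 : ℤ) : 𝓞 K) := by
    ext
    change algebraMap (𝓞 K) K (j' * j') = algebraMap (𝓞 K) K ((-1 : ℤ) : 𝓞 K)
    rw [map_mul, map_intCast, Int.cast_neg, Int.cast_one]
    exact hj
  let f : GaussianInt →+* 𝓞 K := Zsqrtd.lift ⟨j', hj'⟩
  have hf (α : GaussianInt) : (f α : K) = α.re + α.im * j := by
    change algebraMap (𝓞 K) K ((α.re : 𝓞 K) + α.im * j') = _
    rw [map_add, map_mul, map_intCast, map_intCast]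
    rfl
  have hfw (α : GaussianInt) : w.embedding (f α : K) = (α : ℂ) := by
    rw [hf, map_add, map_mul, map_intCast, map_intCast, hw, GaussianInt.toComplex_def]
  have hinj : Function.Injective f := fun α β h ↦ by
    have h1 := congrArg (fun x : 𝓞 K ↦ w.embedding (x : K)) h
    simp only [hfw] at h1
    exact GaussianInt.toComplex_inj.mp h1
  let _ : Algebra GaussianInt K := ((algebraMap (𝓞 K) K).comp f).toAlgebra
  have hmap (α : GaussianInt) : algebraMap GaussianInt K α = (f α : K) := rfl
  have : FaithfulSMul GaussianInt K :=
    (faithfulSMul_iff_algebraMap_injective _ _).mpr (RingOfIntegers.coe_injective.comp hinj)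
  have : IsFractionRing GaussianInt K := IsFractionRing.of_field _ _ fun z ↦ by
    obtain ⟨a, b, rfl⟩ := exists_eq_add_mul_of_finrank_eq_two hK hj z
    refine ⟨⟨a.num * b.den, b.num * a.den⟩, ((a.den * b.den : ℤ) : GaussianInt), ?_⟩
    rw [hmap, hmap, hf, map_intCast]
    have h1 : (a.den : K) ≠ 0 := by exact_mod_cast a.den_nz
    have h2 : (b.den : K) ≠ 0 := by exact_mod_cast b.den_nz
    have h3 : (a : K) = a.num / a.den := by exact_mod_cast congrArg (Rat.cast (K := K)) (Rat.num_div_den a).symm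
    have h4 : (b : K) = b.num / b.den := by exact_mod_cast congrArg (Rat.cast (K := K)) (Rat.num_div_den b).symm
    push_cast
    rw [h3, h4]
    field_simp
  have hsurj : Function.Surjective f := fun x ↦ by
    obtain ⟨α, hα⟩ := IsIntegrallyClosed.isIntegral_iff.mp
      (IsIntegral.tower_top (A := GaussianInt) (RingOfIntegers.isIntegral_coe x))
    exact ⟨α, RingOfIntegers.coe_injective hα⟩
  exact ⟨RingEquiv.ofBijective f ⟨hinj, hsurj⟩, hfw⟩

lemma exists_span_gen (γ : GaussianInt ≃+* 𝓞 K) (v : HeightOneSpectrum (𝓞 K)) :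
    ∃ α : GaussianInt, v.asIdeal = Ideal.span {γ α} ∧ Prime α ∧ (α = oneAddI ∨ IsPrimary α) := by
  have : IsPrincipalIdealRing (𝓞 K) := IsPrincipalIdealRing.of_surjective γ γ.surjective
  obtain ⟨g, hg⟩ := (IsPrincipalIdealRing.principal v.asIdeal).principal
  obtain ⟨β, rfl⟩ := γ.surjective g
  have hv : v.asIdeal = Ideal.span {γ β} := hg
  have hβ : Prime β := by
    have hne : γ β ≠ 0 := fun h0 ↦ v.ne_bot (by rw [hv, h0, Ideal.span_singleton_eq_bot])
    exact (MulEquiv.prime_iff γ.toMulEquiv).mp ((Ideal.span_singleton_prime hne).mp (hv ▸ v.isPrime))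
  have key {α : GaussianInt} (h : Associated β α) : v.asIdeal = Ideal.span {γ α} ∧ Prime α :=
    ⟨by rw [hv, Ideal.span_singleton_eq_span_singleton]; exact h.map γ.toRingHom.toMonoidHom,
      h.prime hβ⟩
  by_cases hd : oneAddI ∣ β
  · have h := key (prime_oneAddI.associated_of_dvd hβ hd).symm
    exact ⟨oneAddI, h.1, h.2, Or.inl rfl⟩
  · obtain ⟨n, hn⟩ := exists_isPrimary_mul hd
    have h := key (α := (⟨0, 1⟩ : GaussianInt) ^ n * β)
      (associated_unit_mul_right β _ (isUnit_I.pow n))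
    exact ⟨_, h.1, h.2, Or.inr hn⟩

theorem nonempty_gaussianField (hK : Module.finrank ℚ K = 2) (hi : ∃ i : K, i ^ 2 = -1) :
    Nonempty (GaussianField K) := by
  obtain ⟨j, hj⟩ := hi
  rw [sq] at hj
  obtain ⟨w⟩ := (inferInstance : Nonempty (InfinitePlace K))
  obtain ⟨γ, hγ⟩ := exists_equiv_ringOfIntegers hK hj w
  have := subsingleton_infinitePlace hK hj
  choose p hp1 hp2 hp3 using exists_span_gen γ
  have exists_place {q : GaussianInt} (hq : Prime q) :
      ∃ v : HeightOneSpectrum (𝓞 K), v.asIdeal = Ideal.span {γ q} := by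
    have hq' : Prime (γ q) := (MulEquiv.prime_iff γ.toMulEquiv).mpr hq
    exact ⟨⟨Ideal.span {γ q}, (Ideal.span_singleton_prime hq'.ne_zero).mpr hq',
      by rw [Ne, Ideal.span_singleton_eq_bot]; exact hq'.ne_zero⟩, rfl⟩
  have hassoc {a b : GaussianInt} : Ideal.span {γ a} = Ideal.span {γ b} ↔ Associated a b := by
    rw [Ideal.span_singleton_eq_span_singleton]
    refine ⟨fun h ↦ ?_, fun h ↦ h.map γ.toRingHom.toMonoidHom⟩
    have := h.map γ.symm.toRingHom.toMonoidHom
    simpa using this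
  obtain ⟨lam, hlam⟩ := exists_place prime_oneAddI
  refine ⟨⟨w, fun _ ↦ Subsingleton.elim _ _, infinitePlace_isComplex hj w, γ, hγ, p, lam, ?_, hp1⟩⟩
  refine ⟨hp2, fun q hq ↦ ?_, fun u v h ↦ ?_, fun v hv ↦ (hp3 v).resolve_left fun h ↦ hv ?_, ?_⟩
  · obtain ⟨v, hv⟩ := exists_place hq
    exact ⟨v, hassoc.mp ((hp1 v).symm.trans hv)⟩
  · exact HeightOneSpectrum.ext (by rw [hp1, hp1, hassoc.mpr h])
  · exact HeightOneSpectrum.ext (by rw [hp1, hlam, h])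
  · refine (hp3 lam).resolve_right fun h ↦ h.not_oneAddI_dvd ?_
    exact (hassoc.mp (hlam.symm.trans (hp1 lam))).dvd

namespace GaussianField

variable (G : GaussianField K)

/-- The field norm is a product over infinite places; here there is a single one, complex, so it
gives `|α|²`. -/
lemma absNorm_eq (v : HeightOneSpectrum (𝓞 K)) : Ideal.absNorm v.asIdeal = gaussNorm (G.gen v) := by
  rw [G.asIdeal_eq, Ideal.absNorm_span_singleton]
  set α := G.gen v
  have h1 := InfinitePlace.prod_eq_abs_norm (G.equiv α : K)
  have h2 : (∏ w : InfinitePlace K, w (G.equiv α : K) ^ w.mult) = gaussNorm α := by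
    rw [Fintype.prod_eq_single G.infPlace fun w hw ↦ absurd (G.eq_infPlace w) hw,
      ← InfinitePlace.norm_embedding_eq, G.embedding_equiv, InfinitePlace.mult,
      if_neg (InfinitePlace.not_isReal_iff_isComplex.mpr G.isComplex), norm_toComplex_sq]
  rw [h2, ← Algebra.coe_norm_int] at h1
  have h3 : (gaussNorm α : ℚ) = |((Algebra.norm ℤ (G.equiv α) : ℤ) : ℚ)| := by exact_mod_cast h1
  have h4 : (gaussNorm α : ℤ) = |Algebra.norm ℤ (G.equiv α)| := by exact_mod_cast h3
  rw [Int.abs_eq_natAbs] at h4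
  exact_mod_cast h4.symm

end GaussianField

end GaussianField

/-! ### Local units whose powers approach `1` -/

section Adic

variable {K : Type*} [Field K] [NumberField K] {v : HeightOneSpectrum (𝓞 K)}

lemma adicCompletion_tendsto {ι : Type*} {l : Filter ι} {f : ι → v.adicCompletion K} {a : v.adicCompletion K}
    (h : ∀ n : ℕ, ∀ᶠ k in l, Valued.v (f k - a) ≤ WithZero.exp (-(n : ℤ))) : Tendsto f l (𝓝 a) := by
  intro s hs
  obtain ⟨γ, hγ⟩ := Valued.mem_nhds.mp hs
  have hγ0 : MonoidWithZeroHom.ValueGroup₀.embedding γ.1 ≠ 0 := by simp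
  obtain ⟨m, hm⟩ := WithZero.ne_zero_iff_exists.mp hγ0
  rw [Filter.mem_map]
  filter_upwards [h (m.toAdd.natAbs + 1)] with k hk
  refine hγ ?_
  rw [Set.mem_ofPred_eq, Valuation.restrict_lt_iff_lt_embedding, ← hm]
  refine hk.trans_lt ?_
  change WithZero.exp _ < WithZero.exp m.toAdd
  rw [WithZero.exp_lt_exp]
  lia

lemma isOpen_adicCompletion_closedBall (t : v.adicCompletion K) (ht : t ≠ 0) :
    IsOpen {x : v.adicCompletion K | Valued.v (x - 1) ≤ Valued.v t} := by
  have h1 := Valued.isOpen_closedBall (R := v.adicCompletion K) (r := Valued.v.restrict t)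
    (by rwa [Ne, Valuation.restrict_eq_zero_iff, Valuation.zero_iff])
  have h2 := h1.preimage (continuous_id.sub (continuous_const (y := (1 : v.adicCompletion K))))
  convert! h2 using 1
  ext x
  simp [Valuation.restrict_le_iff]

lemma valued_pow_sub_one_le {x : v.adicCompletion K} (hx : Valued.v x ≤ 1) {m n : ℕ} (h : m ∣ n) :
    Valued.v (x ^ n - 1) ≤ Valued.v (x ^ m - 1) := by
  obtain ⟨k, rfl⟩ := h
  let y : v.adicCompletionIntegers K := ⟨x, hx⟩
  obtain ⟨c, hc⟩ := sub_dvd_pow_sub_pow (y ^ m) 1 k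
  rw [one_pow, ← pow_mul] at hc
  have hc' : x ^ (m * k) - 1 = (x ^ m - 1) * (c : v.adicCompletion K) := congrArg Subtype.val hc
  rw [hc', map_mul]
  exact mul_le_of_le_one_right' c.2

/-- A local unit is pro-torsion if its powers come arbitrarily close to `1`. -/
def IsProTorsion (u : v.adicCompletion K) : Prop :=
  Valued.v u = 1 ∧ ∀ n : ℕ, ∃ m : ℕ, 0 < m ∧ Valued.v (u ^ m - 1) ≤ WithZero.exp (-(n : ℤ))

lemma isProTorsion_one : IsProTorsion (1 : v.adicCompletion K) :=
  ⟨map_one _, fun _ ↦ ⟨1, one_pos, by simp⟩⟩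

lemma IsProTorsion.inv {u : v.adicCompletion K} (h : IsProTorsion u) : IsProTorsion u⁻¹ := by
  have hu : u ≠ 0 := fun h0 ↦ by simpa [h0] using h.1
  refine ⟨by rw [map_inv₀, h.1, inv_one], fun n ↦ ?_⟩
  obtain ⟨m, hm, h1⟩ := h.2 n
  refine ⟨m, hm, ?_⟩
  have h2 : u⁻¹ ^ m - 1 = -(u⁻¹ ^ m * (u ^ m - 1)) := by
    rw [mul_sub, ← mul_pow, inv_mul_cancel₀ hu, one_pow]
    ring
  rwa [h2, Valuation.map_neg, map_mul, map_pow, map_inv₀, h.1, inv_one, one_pow, one_mul]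

lemma IsProTorsion.tendsto {u : v.adicCompletion K} (h : IsProTorsion u) :
    Tendsto (fun k : ℕ ↦ u ^ k.factorial) atTop (𝓝 1) := by
  refine adicCompletion_tendsto fun n ↦ ?_
  obtain ⟨m, hm, h1⟩ := h.2 n
  filter_upwards [eventually_ge_atTop m] with k hk
  exact (valued_pow_sub_one_le h.1.le (Nat.dvd_factorial hm hk)).trans h1

/-- Pigeonhole in the finite ring `𝓞/vⁿ`: two powers of `a` coincide, and `a` can be cancelled since
it is a unit at `v`. -/
lemma isProTorsion_coe {a : 𝓞 K} (ha : v.intValuation a = 1) :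
    IsProTorsion ((a : K) : v.adicCompletion K) := by
  have hv (b : 𝓞 K) : Valued.v ((b : K) : v.adicCompletion K) = v.intValuation b := by
    rw [HeightOneSpectrum.adicCompletion.valued_coe, HeightOneSpectrum.valuation_of_algebraMap]
  refine ⟨by rw [hv, ha], fun n ↦ ?_⟩
  have : Finite (𝓞 K ⧸ v.asIdeal ^ n) := Ideal.finiteQuotientOfFreeOfNeBot _ (pow_ne_zero n v.ne_bot)
  have key {i j : ℕ} (hij : i < j) (h : Ideal.Quotient.mk (v.asIdeal ^ n) (a ^ i) = Ideal.Quotient.mk _ (a ^ j)) :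
      ∃ m : ℕ, 0 < m ∧ Valued.v (((a : K) : v.adicCompletion K) ^ m - 1) ≤ WithZero.exp (-(n : ℤ)) := by
    refine ⟨j - i, by lia, ?_⟩
    have h1 : a ^ j - a ^ i ∈ v.asIdeal ^ n := Ideal.Quotient.eq.mp h.symm
    rw [← v.intValuation_le_pow_iff_mem, show a ^ j - a ^ i = a ^ i * (a ^ (j - i) - 1) by
      rw [mul_sub, ← pow_add, mul_one, Nat.add_sub_cancel' hij.le], map_mul, map_pow, ha, one_pow, one_mul] at h1
    have h2 : ((a : K) : v.adicCompletion K) ^ (j - i) - 1 = (((a ^ (j - i) - 1 : 𝓞 K) : K) : v.adicCompletion K) := by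
      change algebraMap K (v.adicCompletion K) (algebraMap (𝓞 K) K a) ^ (j - i) - 1 =
        algebraMap K (v.adicCompletion K) (algebraMap (𝓞 K) K (a ^ (j - i) - 1))
      simp only [map_sub, map_pow, map_one]
    rwa [h2, hv]
  obtain ⟨i, j, hij, h⟩ := Finite.exists_ne_map_eq_of_infinite
    fun m : ℕ ↦ Ideal.Quotient.mk (v.asIdeal ^ n) (a ^ m)
  rcases hij.lt_or_gt with hij | hij
  · exact key hij h
  · exact key hij h.symm

end Adic

/-! ### Components of idèles and unit idèles -/

section Ideles

variable {K : Type*} [Field K] [NumberField K]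

/-- The component of an idèle at a finite place. -/
noncomputable def finiteComp (v : HeightOneSpectrum (𝓞 K)) : IdeleGroup K →* (v.adicCompletion K)ˣ :=
  Units.map { toFun := fun a ↦ a.2 v, map_one' := rfl, map_mul' := fun _ _ ↦ rfl }

/-- The component of an idèle at an infinite place. -/
noncomputable def infiniteComp (w : InfinitePlace K) : IdeleGroup K →* (w.Completion)ˣ :=
  Units.map { toFun := fun a ↦ a.1 w, map_one' := rfl, map_mul' := fun _ _ ↦ rfl }

/-- The diagonal embedding. -/
noncomputable abbrev principalIdele : Kˣ →* IdeleGroup K := Units.map (algebraMap K (AdeleRing (𝓞 K) K)).toMonoidHom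

/-- The embedding of `Kˣ` in the completion at a finite place. -/
noncomputable abbrev finiteCoe (v : HeightOneSpectrum (𝓞 K)) : Kˣ →* (v.adicCompletion K)ˣ :=
  Units.map (algebraMap K (v.adicCompletion K)).toMonoidHom

/-- The embedding of `Kˣ` in the completion at an infinite place. -/
noncomputable abbrev infiniteCoe (w : InfinitePlace K) : Kˣ →* (w.Completion)ˣ :=
  Units.map (algebraMap K w.Completion).toMonoidHom

lemma idele_ext {x y : IdeleGroup K} (h1 : ∀ w, infiniteComp w x = infiniteComp w y)
    (h2 : ∀ v, finiteComp v x = finiteComp v y) : x = y := by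
  refine Units.ext (Prod.ext (funext fun w ↦ ?_) (FiniteAdeleRing.ext K fun v ↦ ?_))
  · exact congrArg Units.val (h1 w)
  · exact congrArg Units.val (h2 v)

@[simp] lemma finiteComp_principalIdele (v : HeightOneSpectrum (𝓞 K)) (a : Kˣ) :
    finiteComp v (principalIdele a) = finiteCoe v a := rfl

@[simp] lemma infiniteComp_principalIdele (w : InfinitePlace K) (a : Kˣ) :
    infiniteComp w (principalIdele a) = infiniteCoe w a := rfl

@[simp] lemma finiteComp_finiteLocalIdele_self (v : HeightOneSpectrum (𝓞 K)) (x : (v.adicCompletion K)ˣ) :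
    finiteComp v (finiteLocalIdele v x) = x := by
  classical
  exact Units.ext (RestrictedProduct.mulSingle_eq_same
    (fun w : HeightOneSpectrum (𝓞 K) ↦ w.adicCompletionIntegers K) v (x : v.adicCompletion K))

lemma finiteComp_finiteLocalIdele_of_ne {v w : HeightOneSpectrum (𝓞 K)} (h : w ≠ v) (x : (v.adicCompletion K)ˣ) :
    finiteComp w (finiteLocalIdele v x) = 1 := by
  classical
  exact Units.ext (RestrictedProduct.mulSingle_eq_of_ne
    (fun w : HeightOneSpectrum (𝓞 K) ↦ w.adicCompletionIntegers K) (x : v.adicCompletion K) h)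

@[simp] lemma infiniteComp_finiteLocalIdele (w : InfinitePlace K) (v : HeightOneSpectrum (𝓞 K))
    (x : (v.adicCompletion K)ˣ) : infiniteComp w (finiteLocalIdele v x) = 1 := Units.ext rfl

@[simp] lemma finiteComp_infiniteLocalIdele (w : InfinitePlace K) (v : HeightOneSpectrum (𝓞 K))
    (x : (w.Completion)ˣ) : finiteComp v (infiniteLocalIdele w x) = 1 := Units.ext rfl

@[simp] lemma infiniteComp_infiniteLocalIdele_self (w : InfinitePlace K) (x : (w.Completion)ˣ) :
    infiniteComp w (infiniteLocalIdele w x) = x := by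
  classical
  exact Units.ext (Pi.mulSingle_eq_same (M := fun u : InfinitePlace K ↦ u.Completion) w (x : w.Completion))

/-- The idèles which are units at the finite places and `1` at the infinite places. -/
noncomputable def unitIdele : (∀ v : HeightOneSpectrum (𝓞 K), (v.adicCompletionIntegers K)ˣ) →* IdeleGroup K :=
  (Units.map
    { toFun := fun f ↦ ((1 : InfiniteAdeleRing K),
        (RestrictedProduct.structureMap (fun v : HeightOneSpectrum (𝓞 K) ↦ v.adicCompletion K)
          (fun v ↦ (v.adicCompletionIntegers K : Set (v.adicCompletion K))) cofinite f : FiniteAdeleRing (𝓞 K) K))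
      map_one' := rfl
      map_mul' := fun _ _ ↦ Prod.ext (mul_one (1 : InfiniteAdeleRing K)).symm rfl :
      (∀ v : HeightOneSpectrum (𝓞 K), v.adicCompletionIntegers K) →* AdeleRing (𝓞 K) K }).comp
    (MulEquiv.piUnits (M := fun v : HeightOneSpectrum (𝓞 K) ↦ v.adicCompletionIntegers K)).symm.toMonoidHom

@[simp] lemma infiniteComp_unitIdele (w : InfinitePlace K)
    (u : ∀ v : HeightOneSpectrum (𝓞 K), (v.adicCompletionIntegers K)ˣ) :
    infiniteComp w (unitIdele u) = 1 := Units.ext rfl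

@[simp] lemma coe_finiteComp_unitIdele (v : HeightOneSpectrum (𝓞 K))
    (u : ∀ v : HeightOneSpectrum (𝓞 K), (v.adicCompletionIntegers K)ˣ) :
    (finiteComp v (unitIdele u) : v.adicCompletion K) = (u v : v.adicCompletionIntegers K) := rfl

/-- On unit idèles the restricted product carries the product topology, so convergence is placewise.
The units topology also demands convergence of inverses. -/
lemma tendsto_unitIdele {ι : Type*} {l : Filter ι}
    {f : ι → ∀ v : HeightOneSpectrum (𝓞 K), (v.adicCompletionIntegers K)ˣ}
    {u : ∀ v : HeightOneSpectrum (𝓞 K), (v.adicCompletionIntegers K)ˣ}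
    (h1 : ∀ v, Tendsto (fun i ↦ ((f i v : v.adicCompletionIntegers K) : v.adicCompletion K)) l
      (𝓝 ((u v : v.adicCompletionIntegers K) : v.adicCompletion K)))
    (h2 : ∀ v, Tendsto (fun i ↦ (((f i v)⁻¹ : (v.adicCompletionIntegers K)ˣ) : v.adicCompletion K)) l
      (𝓝 (((u v)⁻¹ : (v.adicCompletionIntegers K)ˣ) : v.adicCompletion K))) :
    Tendsto (fun i ↦ unitIdele (f i)) l (𝓝 (unitIdele u)) := by
  have key {g : ι → ∀ v : HeightOneSpectrum (𝓞 K), v.adicCompletionIntegers K}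
      {a : ∀ v : HeightOneSpectrum (𝓞 K), v.adicCompletionIntegers K}
      (h : ∀ v, Tendsto (fun i ↦ (g i v : v.adicCompletion K)) l (𝓝 (a v : v.adicCompletion K))) :
      Tendsto (fun i ↦ ((1, RestrictedProduct.structureMap _ _ cofinite (g i)) : InfiniteAdeleRing K ×
        FiniteAdeleRing (𝓞 K) K)) l (𝓝 (1, RestrictedProduct.structureMap _ _ cofinite a)) := by
    refine tendsto_const_nhds.prodMk_nhds ?_
    refine (RestrictedProduct.isEmbedding_structureMap.continuous.tendsto a).comp (tendsto_pi_nhds.mpr fun v ↦ ?_)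
    exact tendsto_subtype_rng.mpr (h v)
  rw [Units.isEmbedding_embedProduct.tendsto_nhds_iff]
  exact (key h1).prodMk_nhds ((MulOpposite.continuous_op.tendsto _).comp (key h2))

end Ideles

/-! ### Global elements that are units away from one place -/

section Valuations

variable {K : Type*} [Field K] [NumberField K]

/-- An element of `K_vˣ` of valuation one as a unit of the valuation ring. -/
noncomputable def integerUnit (v : HeightOneSpectrum (𝓞 K)) (a : (v.adicCompletion K)ˣ)
    (h : Valued.v (a : v.adicCompletion K) = 1) : (v.adicCompletionIntegers K)ˣ where
  val := ⟨a, h.le⟩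
  inv := ⟨(a⁻¹ : (v.adicCompletion K)ˣ), by
    change Valued.v ((a⁻¹ : (v.adicCompletion K)ˣ) : v.adicCompletion K) ≤ 1
    rw [Units.val_inv_eq_inv_val, map_inv₀, h, inv_one]⟩
  val_inv := Subtype.ext a.mul_inv
  inv_val := Subtype.ext a.inv_mul

lemma valued_finiteCoe (v : HeightOneSpectrum (𝓞 K)) (a : Kˣ) :
    Valued.v (finiteCoe v a : v.adicCompletion K) = v.valuation K (a : K) :=
  HeightOneSpectrum.adicCompletion.valued_coe _ _ _

open Classical in
/-- The unit idèle with component `a` away from `v₀` and at infinity, and `1` at `v₀` and at infinity. -/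
noncomputable def awayUnit (v₀ : HeightOneSpectrum (𝓞 K)) (a : Kˣ) (ha : ∀ w ≠ v₀, w.valuation K (a : K) = 1)
    (w : HeightOneSpectrum (𝓞 K)) : (w.adicCompletionIntegers K)ˣ :=
  if h : w = v₀ then 1 else integerUnit w (finiteCoe w a) ((valued_finiteCoe w a).trans (ha w h))

variable {v₀ : HeightOneSpectrum (𝓞 K)} {a : Kˣ} {ha : ∀ w ≠ v₀, w.valuation K (a : K) = 1}

lemma awayUnit_self : awayUnit v₀ a ha v₀ = 1 := dif_pos rfl

lemma coe_awayUnit_of_ne {w : HeightOneSpectrum (𝓞 K)} (h : w ≠ v₀) :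
    ((awayUnit v₀ a ha w : w.adicCompletionIntegers K) : w.adicCompletion K) = finiteCoe w a := by
  rw [awayUnit, dif_neg h]
  rfl

end Valuations

/-! ### Idèle characters on unit idèles, and their local values -/

section Characters

variable {K : Type*} [Field K] [NumberField K] (ψ : IdeleGroup K →ₜ* ℂˣ)

lemma tendsto_character {ι : Type*} {l : Filter ι} {f : ι → IdeleGroup K} {x : IdeleGroup K}
    (h : Tendsto f l (𝓝 x)) : Tendsto (fun i ↦ (ψ (f i) : ℂ)) l (𝓝 (ψ x : ℂ)) :=
  ((Units.continuous_val.comp ψ.continuous_toFun).tendsto x).comp h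

/-- The powers `u^{k!}` tend to `1` at all places at once, so `|ψ(u)|^{k!} → 1`, which forces
`|ψ(u)| = 1`. Unitarity is not part of `IsPsi`; this is how it enters. -/
lemma norm_character_unitIdele {u : ∀ v : HeightOneSpectrum (𝓞 K), (v.adicCompletionIntegers K)ˣ}
    (hu : ∀ v, IsProTorsion ((u v : v.adicCompletionIntegers K) : v.adicCompletion K)) :
    ‖(ψ (unitIdele u) : ℂ)‖ = 1 := by
  have h1 : Tendsto (fun k : ℕ ↦ unitIdele (u ^ k.factorial)) atTop 
      (𝓝 (unitIdele (1 : ∀ v : HeightOneSpectrum (𝓞 K), (v.adicCompletionIntegers K)ˣ))) := by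
    refine tendsto_unitIdele (fun v ↦ (hu v).tendsto) fun v ↦ ?_
    have h2 : (((u v)⁻¹ : (v.adicCompletionIntegers K)ˣ) : v.adicCompletion K) =
        ((u v : v.adicCompletionIntegers K) : v.adicCompletion K)⁻¹ :=
      eq_inv_of_mul_eq_one_left (congrArg Subtype.val (u v).inv_mul)
    have h3 := (hu v).inv.tendsto
    rw [← h2] at h3
    refine h3.congr' ?_ |>.trans ?_
    · filter_upwards with k
      change _ = ((((u v) ^ k.factorial)⁻¹ : (v.adicCompletionIntegers K)ˣ) : v.adicCompletion K)
      rw [← inv_pow]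
      rfl
    · exact le_of_eq rfl
  have h2 := (tendsto_character ψ h1).norm
  simp only [map_pow, map_one, Units.val_pow_eq_pow_val, norm_pow, Units.val_one, norm_one] at h2
  set r := ‖(ψ (unitIdele u) : ℂ)‖
  have hr : 0 ≤ r := norm_nonneg _
  rcases le_total r 1 with h | h
  · refine le_antisymm h (le_of_tendsto h2 (Eventually.of_forall fun k ↦ ?_))
    exact pow_le_of_le_one hr h (Nat.factorial_ne_zero k)
  · refine le_antisymm (ge_of_tendsto h2 (Eventually.of_forall fun k ↦ ?_)) h
    exact le_self_pow₀ h (Nat.factorial_ne_zero k)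

lemma finiteLocalIdele_eq_unitIdele (v : HeightOneSpectrum (𝓞 K)) [DecidableEq (HeightOneSpectrum (𝓞 K))]
    (x : (v.adicCompletionIntegers K)ˣ) :
    finiteLocalIdele v (Units.map (v.adicCompletionIntegers K).subtype.toMonoidHom x) =
      unitIdele (Pi.mulSingle v x) := by
  refine idele_ext (fun w ↦ by simp) fun w ↦ ?_
  by_cases h : w = v
  · subst h
    refine Units.ext ?_
    rw [finiteComp_finiteLocalIdele_self, coe_finiteComp_unitIdele, Pi.mulSingle_eq_same]
    rfl
  · refine Units.ext ?_
    rw [finiteComp_finiteLocalIdele_of_ne h, coe_finiteComp_unitIdele, Pi.mulSingle_eq_of_ne h]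
    rfl

/-- Truncations of `u` to finitely many places lie in the kernel and converge to `u`; continuity
does the rest. -/
lemma character_unitIdele_eq_one {u : ∀ v : HeightOneSpectrum (𝓞 K), (v.adicCompletionIntegers K)ˣ}
    (hu : ∀ v, u v = 1 ∨ IsUnramifiedAt ψ v) : ψ (unitIdele u) = 1 := by
  classical
  let f (S : Finset (HeightOneSpectrum (𝓞 K))) : ∀ v : HeightOneSpectrum (𝓞 K), (v.adicCompletionIntegers K)ˣ :=
    S.piecewise u 1
  have hf (S) : ψ (unitIdele (f S)) = 1 := by
    induction S using Finset.induction_on with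
    | empty => simp [f]
    | insert v S hv ih =>
      have h1 : f (insert v S) = Pi.mulSingle v (u v) * f S := by
        ext1 w
        by_cases h : w = v
        · subst h
          simp [f, hv]
        · simp [f, h, Finset.piecewise]
      rw [h1, map_mul, map_mul, ih, mul_one]
      rcases hu v with h | h
      · simp [h]
      · rw [← finiteLocalIdele_eq_unitIdele]
        exact h _ (HeightOneSpectrum.adicCompletionIntegers.isUnit_iff_valued_eq_one.mp (u v).isUnit)
  have hev (v) : ∀ᶠ S : Finset (HeightOneSpectrum (𝓞 K)) in atTop, f S v = u v := by
    filter_upwards [eventually_ge_atTop {v}] with S hS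
    exact Finset.piecewise_eq_of_mem _ _ _ (hS (Finset.mem_singleton_self v))
  have h1 : Tendsto (fun S ↦ unitIdele (f S)) atTop (𝓝 (unitIdele u)) := by
    refine tendsto_unitIdele (fun v ↦ ?_) fun v ↦ ?_
    · exact tendsto_const_nhds.congr' ((hev v).mono fun S hS ↦ by simp only [hS])
    · exact tendsto_const_nhds.congr' ((hev v).mono fun S hS ↦ by simp only [hS])
  have h2 := tendsto_character ψ h1
  simp only [hf] at h2
  exact Units.ext (tendsto_nhds_unique h2 tendsto_const_nhds)

lemma coe_globalUniformizer_valuation (v : HeightOneSpectrum (𝓞 K)) :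
    v.valuation K (globalUniformizer v : K) = WithZero.exp (-1) :=
  (v.valuation_exists_uniformizer K).choose_spec

lemma uniformizerValue_eq {v : HeightOneSpectrum (𝓞 K)} (h : IsUnramifiedAt ψ v) {a : Kˣ}
    (ha : v.valuation K (a : K) = WithZero.exp (-1)) :
    uniformizerValue ψ v = ψ (finiteLocalIdele v (finiteCoe v a)) := by
  have h1 := h (finiteCoe v (globalUniformizer v * a⁻¹)) (by
    rw [valued_finiteCoe, Units.val_mul, Units.val_inv_eq_inv_val, map_mul, map_inv₀, ha,
      coe_globalUniformizer_valuation, mul_inv_cancel₀ WithZero.exp_ne_zero])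
  rw [map_mul, map_mul, map_mul, map_inv, map_inv, map_inv, mul_inv_eq_one] at h1
  exact congrArg Units.val h1

end Characters

namespace GaussianField

variable {K : Type*} [Field K] [NumberField K] (G : GaussianField K)

lemma mem_asIdeal_iff (v : HeightOneSpectrum (𝓞 K)) (α : GaussianInt) :
    G.equiv α ∈ v.asIdeal ↔ G.gen v ∣ α := by
  rw [G.asIdeal_eq, Ideal.mem_span_singleton]
  refine ⟨fun h ↦ ?_, fun h ↦ map_dvd G.equiv h⟩
  simpa using map_dvd G.equiv.symm h

/-- A nonzero Gaussian integer as an element of `Kˣ`. -/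
noncomputable def toUnits (α : GaussianInt) (h : α ≠ 0) : Kˣ :=
  Units.mk0 (G.equiv α : K) (by simpa using h)

lemma valuation_toUnits_eq_one_iff {α : GaussianInt} (h : α ≠ 0) (v : HeightOneSpectrum (𝓞 K)) :
    v.valuation K (G.toUnits α h : K) = 1 ↔ ¬ G.gen v ∣ α := by
  rw [← G.mem_asIdeal_iff, ← HeightOneSpectrum.intValuation_eq_one_iff, ← HeightOneSpectrum.valuation_of_algebraMap (K := K)]
  rfl

/-- The chosen generator as an element of `Kˣ`. -/
noncomputable abbrev genUnit (v : HeightOneSpectrum (𝓞 K)) : Kˣ :=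
  G.toUnits (G.gen v) (G.isPrimeSystem.prime v).ne_zero

lemma valuation_genUnit_self (v : HeightOneSpectrum (𝓞 K)) :
    v.valuation K (G.genUnit v : K) = WithZero.exp (-1) := by
  rw [← v.intValuation_singleton (r := G.equiv (G.gen v)) (by simpa using (G.isPrimeSystem.prime v).ne_zero) (G.asIdeal_eq v),
    ← HeightOneSpectrum.valuation_of_algebraMap (K := K)]
  rfl

lemma valuation_genUnit_of_ne {v w : HeightOneSpectrum (𝓞 K)} (h : w ≠ v) :
    w.valuation K (G.genUnit v : K) = 1 := by
  rw [valuation_toUnits_eq_one_iff]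
  intro hd
  exact h (G.isPrimeSystem.eq_of_associated _ _
    ((G.isPrimeSystem.prime w).associated_of_dvd (G.isPrimeSystem.prime v) hd))

lemma isProTorsion_toUnits {α : GaussianInt} (h : α ≠ 0) {v : HeightOneSpectrum (𝓞 K)}
    (hv : v.valuation K (G.toUnits α h : K) = 1) :
    IsProTorsion (finiteCoe v (G.toUnits α h) : v.adicCompletion K) :=
  isProTorsion_coe (a := G.equiv α) (by
    rw [← HeightOneSpectrum.valuation_of_algebraMap (K := K)]
    exact hv)

lemma extensionEmbedding_toUnits {α : GaussianInt} (h : α ≠ 0) :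
    InfinitePlace.Completion.extensionEmbedding G.infPlace
      (infiniteCoe G.infPlace (G.toUnits α h) : G.infPlace.Completion) = α :=
  (InfinitePlace.Completion.extensionEmbedding_coe _ _).trans (G.embedding_equiv α)

lemma principalIdele_eq (v₀ : HeightOneSpectrum (𝓞 K)) (a : Kˣ) (ha : ∀ w ≠ v₀, w.valuation K (a : K) = 1) :
    principalIdele a = infiniteLocalIdele G.infPlace (infiniteCoe G.infPlace a) *
      finiteLocalIdele v₀ (finiteCoe v₀ a) * unitIdele (awayUnit v₀ a ha) := by
  refine idele_ext (fun w ↦ ?_) fun w ↦ ?_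
  · obtain rfl := G.eq_infPlace w
    simp
  · rw [map_mul, map_mul, finiteComp_infiniteLocalIdele, one_mul, finiteComp_principalIdele]
    refine Units.ext ?_
    by_cases h : w = v₀
    · subst h
      rw [finiteComp_finiteLocalIdele_self, Units.val_mul, coe_finiteComp_unitIdele, awayUnit_self]
      exact (mul_one _).symm
    · rw [finiteComp_finiteLocalIdele_of_ne h, one_mul, coe_finiteComp_unitIdele, coe_awayUnit_of_ne h]

variable {ψ : IdeleGroup K →ₜ* ℂˣ}

lemma exists_character_infinite (h : IsAlgebraicOfType ψ 2) :
    ∃ n : ℤ, |n| = 1 ∧ ∀ (α : GaussianInt) (hα : α ≠ 0),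
      (ψ (infiniteLocalIdele G.infPlace (infiniteCoe G.infPlace (G.toUnits α hα))) : ℂ) = gaussSign α ^ n := by
  obtain ⟨n, hn, h1⟩ := h
  refine ⟨n, by simpa using hn, fun α hα ↦ ?_⟩
  rw [h1, G.extensionEmbedding_toUnits]
  rfl

lemma character_mul_eq_one (h : IsIdeleClassCharacter ψ) (v₀ : HeightOneSpectrum (𝓞 K)) (a : Kˣ)
    (ha : ∀ w ≠ v₀, w.valuation K (a : K) = 1) :
    ψ (infiniteLocalIdele G.infPlace (infiniteCoe G.infPlace a)) *
      ψ (finiteLocalIdele v₀ (finiteCoe v₀ a)) * ψ (unitIdele (awayUnit v₀ a ha)) = 1 := by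
  rw [← map_mul, ← map_mul, ← G.principalIdele_eq]
  exact h a

/-- Apply triviality on `Kˣ` to the generator of `v`. The component at infinity has modulus one by
the algebraic type, and the components at the other finite places form a pro-torsion unit idèle. -/
lemma norm_uniformizerValue (G : GaussianField K) (h1 : IsIdeleClassCharacter ψ) (h2 : IsAlgebraicOfType ψ 2)
    {v : HeightOneSpectrum (𝓞 K)} (hv : IsUnramifiedAt ψ v) : ‖uniformizerValue ψ v‖ = 1 := by
  obtain ⟨n, -, hn⟩ := G.exists_character_infinite h2
  have h3 := congrArg (fun z : ℂˣ ↦ ‖(z : ℂ)‖)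
    (G.character_mul_eq_one h1 v (G.genUnit v) fun w hw ↦ G.valuation_genUnit_of_ne hw)
  simp only [Units.val_mul, norm_mul, hn, norm_zpow, norm_gaussSign (G.isPrimeSystem.prime v).ne_zero,
    one_zpow, one_mul, Units.val_one, norm_one] at h3
  rwa [norm_character_unitIdele, mul_one, ← uniformizerValue_eq ψ hv (G.valuation_genUnit_self v)] at h3
  intro w
  by_cases h : w = v
  · subst h
    rw [awayUnit_self]
    exact isProTorsion_one
  · rw [coe_awayUnit_of_ne h]
    exact G.isProTorsion_toUnits _ (G.valuation_genUnit_of_ne h)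

open Classical in
/-- The value of a character at the uniformizer, or `0` at a ramified place. -/
noncomputable def eulerValue (ψ : IdeleGroup K →ₜ* ℂˣ) (v : HeightOneSpectrum (𝓞 K)) : ℂ :=
  if IsUnramifiedAt ψ v then uniformizerValue ψ v else 0

lemma heckeEulerFactor_eq (ψ : IdeleGroup K →ₜ* ℂˣ) (s : ℂ) (v : HeightOneSpectrum (𝓞 K)) :
    heckeEulerFactor ψ s v = (1 - eulerValue ψ v * gaussNormCpow s (G.gen v))⁻¹ := by
  rw [heckeEulerFactor, eulerValue, G.absNorm_eq]
  split_ifs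
  · rfl
  · rw [zero_mul, sub_zero, inv_one]

end GaussianField

lemma gaussNorm_cpow_neg_half {α : GaussianInt} :
    (gaussNorm α : ℂ) ^ (-(1 / 2 : ℂ)) = (‖(α : ℂ)‖ : ℂ)⁻¹ := by
  rw [norm_toComplex_eq_rpow, Complex.ofReal_cpow (Nat.cast_nonneg _), ← Complex.cpow_neg]
  push_cast
  rfl

lemma toComplex_mul_gaussNorm_cpow {α : GaussianInt} (hα : α ≠ 0) (s : ℂ) :
    (α : ℂ) * (gaussNorm α : ℂ) ^ (-(s + 1 / 2)) = gaussSign α * gaussNormCpow s α := by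
  have h0 : (gaussNorm α : ℂ) ≠ 0 := by exact_mod_cast (gaussNorm_pos hα).ne'
  change _ = (α : ℂ) / (‖(α : ℂ)‖ : ℂ) * (gaussNorm α : ℂ) ^ (-s)
  rw [neg_add, Complex.cpow_add _ _ h0, gaussNorm_cpow_neg_half]
  ring

lemma toComplex_sq_mul_gaussNorm_cpow {α : GaussianInt} (hα : α ≠ 0) (s : ℂ) :
    (α : ℂ) ^ 2 * (gaussNorm α : ℂ) ^ (-(s + 1)) = gaussSign α ^ 2 * gaussNormCpow s α := by
  have h0 : (gaussNorm α : ℂ) ≠ 0 := by exact_mod_cast (gaussNorm_pos hα).ne'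
  change _ = ((α : ℂ) / (‖(α : ℂ)‖ : ℂ)) ^ 2 * (gaussNorm α : ℂ) ^ (-s)
  rw [show -(s + 1) = -s + -(1 / 2 : ℂ) + -(1 / 2 : ℂ) by ring, Complex.cpow_add _ _ h0, Complex.cpow_add _ _ h0,
    gaussNorm_cpow_neg_half]
  ring

/-! ### The `L`-function of `ψ²` -/

section PsiSquared

variable {K : Type*} [Field K] [NumberField K]

lemma hasSum_gaussSign {s : ℂ} (hs : 1 < s.re) :
    HasSum (fun α : PrimaryGaussian ↦ gaussSign α.1 * gaussNormCpow s α.1)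
      (LSeries (fun n ↦ (qExpansion 1 etaQuotient32).coeff n) (s + 1 / 2)) :=
  (hasSum_LSeries_etaQuotient32 (s := s + 1 / 2) (by norm_num; linarith)).congr_fun
    fun α ↦ (toComplex_mul_gaussNorm_cpow α.2.ne_zero s).symm

lemma hasSum_gaussSign_sq {s : ℂ} (hs : 1 < s.re) :
    HasSum (fun α : PrimaryGaussian ↦ gaussSign α.1 ^ 2 * gaussNormCpow s α.1) (cuspL etaCuspForm (s + 1)) :=
  (hasSum_cuspL_etaCuspForm (s := s + 1) (by norm_num; linarith)).congr_fun
    fun α ↦ (toComplex_sq_mul_gaussNorm_cpow α.2.ne_zero s).symm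

open IsPrimeSystem (signValue signValue_of_ne signValue_lam)

namespace GaussianField

/-- The unit `i` in `Kˣ`. -/
noncomputable abbrev unitI (G : GaussianField K) : Kˣ := G.toUnits ⟨0, 1⟩ isUnit_I.ne_zero

lemma valuation_unitI (G : GaussianField K) (v : HeightOneSpectrum (𝓞 K)) :
    v.valuation K (G.unitI : K) = 1 := by
  rw [valuation_toUnits_eq_one_iff]
  exact fun h ↦ (G.isPrimeSystem.prime v).not_isUnit (isUnit_of_dvd_unit h isUnit_I)

lemma gaussSign_I : gaussSign ⟨0, 1⟩ = Complex.I := by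
  change ((⟨0, 1⟩ : GaussianInt) : ℂ) / (‖((⟨0, 1⟩ : GaussianInt) : ℂ)‖ : ℂ) = Complex.I
  simp [GaussianInt.toComplex_def']

variable {ψ : IdeleGroup K →ₜ* ℂˣ}

lemma exists_perm_of_isPsi (G : GaussianField K) (h : IsPsi ψ) :
    ∃ σ : HeightOneSpectrum (𝓞 K) ≃ HeightOneSpectrum (𝓞 K), ∀ v,
      eulerValue ψ v = signValue G.gen G.lam (σ v) ∧ gaussNorm (G.gen (σ v)) = gaussNorm (G.gen v) ∧
        (v ≠ G.lam → σ v ≠ G.lam) := by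
  refine G.isPrimeSystem.exists_perm (fun v ↦ ?_) fun s hs ↦ ?_
  · rw [eulerValue]
    split_ifs with hv
    · exact Or.inr (G.norm_uniformizerValue h.isIdeleClassCharacter h.isAlgebraic hv)
    · exact Or.inl rfl
  · refine ⟨_, ?_, hasSum_gaussSign hs⟩
    have h1 := h.lFunction (s + 1 / 2) (by norm_num; linarith)
    rw [add_sub_cancel_right] at h1
    exact h1.congr_fun fun v ↦ (G.heckeEulerFactor_eq ψ s v).symm

/-- A ramified place has local value `0`, whereas the standard values away from `1 + i` have modulus
one. -/
lemma isUnramifiedAt_of_isPsi (G : GaussianField K) (h : IsPsi ψ) {v : HeightOneSpectrum (𝓞 K)}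
    (hv : v ≠ G.lam) : IsUnramifiedAt ψ v := by
  obtain ⟨σ, hσ⟩ := G.exists_perm_of_isPsi h
  obtain ⟨h1, -, h2⟩ := hσ v
  rw [signValue_of_ne (h2 hv), eulerValue] at h1
  by_contra h0
  rw [if_neg h0] at h1
  have h3 := norm_gaussSign (G.isPrimeSystem.prime (σ v)).ne_zero
  rw [← h1, norm_zero] at h3
  exact zero_ne_one h3

/-- The global unit `i` is seen by `ψ` only at infinity and at `1 + i`. At infinity it gives
`i^{±1}`, so the square of the local value at `1 + i` is `-1`, not `1`. Hence `ψ²` has no Euler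
factor there. -/
lemma not_isUnramifiedAt_sq_lam (G : GaussianField K) (h : IsPsi ψ) : ¬ IsUnramifiedAt (ψ ^ 2) G.lam := by
  intro h0
  have h1 : ψ (finiteLocalIdele G.lam (finiteCoe G.lam G.unitI)) ^ 2 = 1 :=
    (ContinuousMonoidHom.pow_apply ψ 2 _).symm.trans <| h0 (finiteCoe G.lam G.unitI) ((valued_finiteCoe _ _).trans (G.valuation_unitI _))
  have h2 := G.character_mul_eq_one h.isIdeleClassCharacter G.lam G.unitI fun w _ ↦ G.valuation_unitI w
  rw [character_unitIdele_eq_one ψ fun v ↦ ?_, mul_one] at h2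
  · obtain ⟨n, hn, h3⟩ := G.exists_character_infinite h.isAlgebraic
    have h4 := congrArg (fun z : ℂˣ ↦ (z : ℂ)) (congrArg (· ^ 2) h2)
    simp only [mul_pow, h1, mul_one, one_pow, Units.val_pow_eq_pow_val, h3, gaussSign_I, Units.val_one] at h4
    rcases (abs_eq zero_le_one).mp hn with rfl | rfl
    · norm_num at h4
    · norm_num at h4
  · by_cases hv : v = G.lam
    · subst hv
      exact Or.inl awayUnit_self
    · exact Or.inr (G.isUnramifiedAt_of_isPsi h hv)

theorem hasProd_heckeEulerFactor_sq (G : GaussianField K) (h : IsPsi ψ) {s : ℂ} (hs : 1 < s.re) :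
    HasProd (heckeEulerFactor (ψ ^ 2) s) (cuspL etaCuspForm (s + 1)) := by
  obtain ⟨σ, hσ⟩ := G.exists_perm_of_isPsi h
  have h1 := (Equiv.hasProd_iff σ).mpr
    (G.isPrimeSystem.hasProd_signValue two_ne_zero hs (hasSum_gaussSign_sq hs))
  refine h1.congr_fun fun v ↦ ?_
  obtain ⟨h2, h3, h4⟩ := hσ v
  rw [Function.comp_apply, ← h2, G.heckeEulerFactor_eq]
  congr 2
  have h5 : gaussNormCpow s (G.gen (σ v)) = gaussNormCpow s (G.gen v) := congrArg (fun n : ℕ ↦ (n : ℂ) ^ (-s)) h3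
  rw [h5]
  congr 1
  by_cases hv : v = G.lam
  · have h6 : σ v = G.lam := by
      by_contra h0
      obtain ⟨u, hu⟩ := σ.surjective G.lam
      by_cases huv : u = v
      · exact h0 (huv ▸ hu)
      · exact (hσ u).2.2 (hv ▸ huv) hu
    rw [h2, h6, signValue_lam, zero_pow two_ne_zero, eulerValue, if_neg]
    rw [hv]
    exact G.not_isUnramifiedAt_sq_lam h
  · have h7 := G.isUnramifiedAt_of_isPsi h hv
    have h8 : IsUnramifiedAt (ψ ^ 2) v := fun u hu ↦ by
      rw [ContinuousMonoidHom.pow_apply, h7 u hu, one_pow]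
    rw [eulerValue, eulerValue, if_pos h7, if_pos h8, uniformizerValue, uniformizerValue, ContinuousMonoidHom.pow_apply,
      Units.val_pow_eq_pow_val]

theorem isHeckeLFunction_sq (G : GaussianField K) (h : IsPsi ψ) :
    IsHeckeLFunction (ψ ^ 2) fun s ↦ cuspL etaCuspForm (s + 1) :=
  ⟨(CuspForm.differentiable_L _ _).comp (differentiable_id.add_const 1),
    fun _ hs ↦ G.hasProd_heckeEulerFactor_sq h hs⟩

theorem eq_etaCuspForm_of_isHeckeLFunction (G : GaussianField K) (h : IsPsi ψ)
    {g : CuspFormsWeightThreeLevelSixteen} (hg : IsHeckeLFunction (ψ ^ 2) fun s ↦ cuspL g (s + 1)) (τ : ℍ) :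
    g τ = etaCuspForm τ := by
  refine cuspForm_ext_of_cuspL (fun s hs ↦ ?_) τ
  have h1 : 1 < (s - 1).re := by
    rw [Complex.sub_re, Complex.one_re]
    linarith
  have h2 := (hg.2 (s - 1) h1).unique (G.hasProd_heckeEulerFactor_sq h h1)
  simpa only [sub_add_cancel] using h2

end GaussianField

end PsiSquared

/-! ### The decomposition of the idèles as `Kˣ` times the primary subgroup -/

section Existence

variable {K : Type*} [Field K] [NumberField K]

lemma continuous_adele_fst : Continuous fun a : AdeleRing (𝓞 K) K ↦ a.1 :=
  continuous_fst (X := InfiniteAdeleRing K) (Y := FiniteAdeleRing (𝓞 K) K)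

lemma continuous_adele_snd : Continuous fun a : AdeleRing (𝓞 K) K ↦ a.2 :=
  continuous_snd (X := InfiniteAdeleRing K) (Y := FiniteAdeleRing (𝓞 K) K)

lemma isOpen_finiteComp_valued_eq_one :
    IsOpen {x : IdeleGroup K | ∀ v, Valued.v (finiteComp v x : v.adicCompletion K) = 1} := by
  have h1 : IsOpen {f : FiniteAdeleRing (𝓞 K) K | ∀ v, f v ∈ v.adicCompletionIntegers K} :=
    RestrictedProduct.isOpen_forall_mem (R := fun v : HeightOneSpectrum (𝓞 K) ↦ v.adicCompletion K)
      (A := fun v ↦ (v.adicCompletionIntegers K : Set (v.adicCompletion K)))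
      fun _ ↦ Valued.isOpen_valuationSubring _
  have h2 : IsOpen {x : IdeleGroup K | ∀ v, (finiteComp v x : v.adicCompletion K) ∈ v.adicCompletionIntegers K} :=
    h1.preimage (continuous_adele_snd.comp Units.continuous_val)
  have h3 : IsOpen {x : IdeleGroup K | ∀ v, (finiteComp v x⁻¹ : v.adicCompletion K) ∈ v.adicCompletionIntegers K} :=
    h2.preimage continuous_inv
  convert! h2.inter h3 using 1
  ext x
  simp only [Set.mem_inter_iff, Set.mem_ofPred_eq, HeightOneSpectrum.mem_adicCompletionIntegers, map_inv,
    Units.val_inv_eq_inv_val, map_inv₀, ← forall_and]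
  refine forall_congr' fun v ↦ ⟨fun h ↦ by simp [h], fun h ↦ le_antisymm h.1 ?_⟩
  have h0 : Valued.v (finiteComp v x : v.adicCompletion K) ≠ 0 := by simp
  exact (inv_le_one₀ (zero_lt_iff.mpr h0)).mp h.2

lemma continuous_finiteComp (v : HeightOneSpectrum (𝓞 K)) :
    Continuous fun x : IdeleGroup K ↦ (finiteComp v x : v.adicCompletion K) :=
  (RestrictedProduct.continuous_eval (R := fun v : HeightOneSpectrum (𝓞 K) ↦ v.adicCompletion K) v).comp
    (continuous_adele_snd.comp Units.continuous_val)

lemma continuous_infiniteComp (w : InfinitePlace K) :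
    Continuous fun x : IdeleGroup K ↦ (infiniteComp w x : w.Completion) :=
  (_root_.continuous_apply w).comp (continuous_adele_fst.comp Units.continuous_val)

lemma finite_valued_finiteComp_ne_one (x : IdeleGroup K) :
    {v | Valued.v (finiteComp v x : v.adicCompletion K) ≠ 1}.Finite := by
  let y : (FiniteAdeleRing (𝓞 K) K)ˣ :=
    Units.map { toFun := fun a : AdeleRing (𝓞 K) K ↦ a.2, map_one' := rfl, map_mul' := fun _ _ ↦ rfl } x
  exact (FiniteAdeleRing.isUnit_iff.mp y.isUnit).2

namespace GaussianField

variable (G : GaussianField K)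

/-- Because `(1 + i)³ = i(2 + 2i)`; being primary is thus a congruence modulo the cube of the prime
over `2`. -/
lemma span_lam_pow : G.lam.asIdeal ^ 3 = Ideal.span {G.equiv ⟨2, 2⟩} := by
  rw [G.asIdeal_eq, G.isPrimeSystem.map_lam, Ideal.span_singleton_pow, Ideal.span_singleton_eq_span_singleton,
    ← map_pow]
  refine Associated.map G.equiv.toRingHom.toMonoidHom ?_
  refine ⟨(isUnit_I.pow 3).unit, ?_⟩
  rw [IsUnit.unit_spec]
  decide

lemma valued_toUnits_sub_one_le_iff {α : GaussianInt} (h : α ≠ 0) :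
    Valued.v ((finiteCoe G.lam (G.toUnits α h) : G.lam.adicCompletion K) - 1) ≤ WithZero.exp (-3) ↔
      IsPrimary α := by
  have h1 : (finiteCoe G.lam (G.toUnits α h) : G.lam.adicCompletion K) - 1 =
      (((G.equiv (α - 1) : 𝓞 K) : K) : G.lam.adicCompletion K) := by
    change algebraMap K (G.lam.adicCompletion K) (algebraMap (𝓞 K) K (G.equiv α)) - 1 =
      algebraMap K (G.lam.adicCompletion K) (algebraMap (𝓞 K) K (G.equiv (α - 1)))
    simp only [map_sub, map_one]
  rw [h1, HeightOneSpectrum.adicCompletion.valued_coe, HeightOneSpectrum.valuation_of_algebraMap,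
    isPrimary_iff_dvd]
  have h2 := G.lam.intValuation_le_pow_iff_mem (G.equiv (α - 1)) 3
  rw [G.span_lam_pow, Ideal.mem_span_singleton] at h2
  refine h2.trans ⟨fun h ↦ ?_, fun h ↦ map_dvd G.equiv h⟩
  simpa using map_dvd G.equiv.symm h

/-- The idèles that are units at the finite places and congruent to `1` modulo the cube of the prime
over `2`. -/
noncomputable def primarySubgroup : Subgroup (IdeleGroup K) where
  carrier := {x | (∀ v, Valued.v (finiteComp v x : v.adicCompletion K) = 1) ∧
    Valued.v ((finiteComp G.lam x : G.lam.adicCompletion K) - 1) ≤ WithZero.exp (-3)}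
  one_mem' := ⟨fun v ↦ by simp, by simp⟩
  mul_mem' {x y} hx hy := by
    refine ⟨fun v ↦ by simp [hx.1 v, hy.1 v], ?_⟩
    have h : (finiteComp G.lam (x * y) : G.lam.adicCompletion K) - 1 =
        (finiteComp G.lam x : G.lam.adicCompletion K) * ((finiteComp G.lam y : G.lam.adicCompletion K) - 1) +
          ((finiteComp G.lam x : G.lam.adicCompletion K) - 1) := by
      rw [map_mul, Units.val_mul]
      ring
    rw [h]
    refine Valuation.map_add_le _ ?_ hx.2
    rw [map_mul, hx.1, one_mul]
    exact hy.2
  inv_mem' {x} hx := by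
    refine ⟨fun v ↦ by simp [hx.1 v], ?_⟩
    have h : (finiteComp G.lam x⁻¹ : G.lam.adicCompletion K) - 1 =
        -((finiteComp G.lam x : G.lam.adicCompletion K)⁻¹ * ((finiteComp G.lam x : G.lam.adicCompletion K) - 1)) := by
      rw [map_inv, Units.val_inv_eq_inv_val, mul_sub, inv_mul_cancel₀ (Units.ne_zero _)]
      ring
    rw [h, Valuation.map_neg, map_mul, map_inv₀, hx.1, inv_one, one_mul]
    exact hx.2

lemma mem_primarySubgroup {x : IdeleGroup K} : x ∈ G.primarySubgroup ↔
    (∀ v, Valued.v (finiteComp v x : v.adicCompletion K) = 1) ∧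
      Valued.v ((finiteComp G.lam x : G.lam.adicCompletion K) - 1) ≤ WithZero.exp (-3) := Iff.rfl

lemma isOpen_lam_ball : IsOpen {x : G.lam.adicCompletion K | Valued.v (x - 1) ≤ WithZero.exp (-3)} := by
  have h := isOpen_adicCompletion_closedBall (v := G.lam)
    ((finiteCoe G.lam (G.genUnit G.lam) : G.lam.adicCompletion K) ^ 3) (pow_ne_zero 3 (Units.ne_zero _))
  rwa [map_pow, valued_finiteCoe, G.valuation_genUnit_self, ← WithZero.exp_nsmul] at h

lemma isOpen_primarySubgroup : IsOpen (G.primarySubgroup : Set (IdeleGroup K)) :=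
  isOpen_finiteComp_valued_eq_one.inter (G.isOpen_lam_ball.preimage (continuous_finiteComp G.lam))

/-- An element of valuation one everywhere is a unit of `ℤ[i]`, and a primary unit is `1`. -/
lemma eq_one_of_principalIdele_mem {a : Kˣ} (h : principalIdele a ∈ G.primarySubgroup) : a = 1 := by
  have h1 (v : HeightOneSpectrum (𝓞 K)) : v.valuation K (a : K) = 1 := by
    have := h.1 v
    rwa [finiteComp_principalIdele, valued_finiteCoe] at this
  obtain ⟨r, hr⟩ := HeightOneSpectrum.mem_integers_of_valuation_le_one K (a : K) fun v ↦ (h1 v).le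
  obtain ⟨α, rfl⟩ := G.equiv.surjective r
  have hα : α ≠ 0 := by
    rintro rfl
    rw [map_zero, map_zero] at hr
    exact a.ne_zero hr.symm
  obtain rfl : G.toUnits α hα = a := Units.ext hr
  have hp := (G.valued_toUnits_sub_one_le_iff hα).mp h.2
  have hu : IsUnit α := by
    by_contra hu
    obtain ⟨q, hq, hd⟩ := WfDvdMonoid.exists_irreducible_factor hu hα
    obtain ⟨v, hv⟩ := G.isPrimeSystem.exists_associated q hq.prime
    exact (G.valuation_toUnits_eq_one_iff hα v).mp (h1 v) (hv.dvd.trans hd)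
  refine Units.ext ?_
  change ((G.equiv α : 𝓞 K) : K) = 1
  rw [hp.eq_one_of_isUnit hu, map_one]
  rfl

lemma exists_valuation_eq (G : GaussianField K) (x : IdeleGroup K) :
    ∃ a : Kˣ, ∀ v, v.valuation K (a : K) = Valued.v (finiteComp v x : v.adicCompletion K) := by
  let n (v : HeightOneSpectrum (𝓞 K)) : ℤ := WithZero.log (Valued.v (finiteComp v x : v.adicCompletion K))
  have hS := finite_valued_finiteComp_ne_one x
  -- Class number one provides generators; the minus sign is there because a generator has
  -- multiplicative valuation `exp (-1)`.
  refine ⟨∏ v ∈ hS.toFinset, G.genUnit v ^ (-n v), fun w ↦ ?_⟩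
  have h0 : Valued.v (finiteComp w x : w.adicCompletion K) ≠ 0 := by simp
  rw [Units.coe_prod, map_prod]
  have h1 (v) (hv : v ≠ w) : w.valuation K ((G.genUnit v ^ (-n v) : Kˣ) : K) = 1 := by
    rw [Units.val_zpow_eq_zpow_val, map_zpow₀, G.valuation_genUnit_of_ne hv.symm, one_zpow]
  by_cases hw : w ∈ hS.toFinset
  · rw [Finset.prod_eq_single w (fun v _ hv ↦ h1 v hv) fun h ↦ absurd hw h, Units.val_zpow_eq_zpow_val, map_zpow₀,
      G.valuation_genUnit_self, ← WithZero.exp_zsmul]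
    simp [n, WithZero.exp_log h0]
  · rw [Finset.prod_eq_one fun v hv ↦ h1 v fun h ↦ hw (h ▸ hv)]
    simpa [eq_comm] using hw

/-- Units modulo `(1+i)³` are represented by powers of `i`. Approximate `y` first by an element of
`K`, then by a Gaussian integer, and take the primary associate of the latter. -/
lemma exists_pow_unitI_mul (y : (G.lam.adicCompletion K)ˣ) (hy : Valued.v (y : G.lam.adicCompletion K) = 1) :
    ∃ n : ℕ, Valued.v ((y * finiteCoe G.lam (G.unitI ^ n) : (G.lam.adicCompletion K)ˣ) - 1 : G.lam.adicCompletion K) ≤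
      WithZero.exp (-3) := by
  have hopen := G.isOpen_lam_ball.preimage
    ((continuous_id (X := G.lam.adicCompletion K)).sub (continuous_const (y := (y : G.lam.adicCompletion K) - 1)))
  obtain ⟨b, hb⟩ := (HeightOneSpectrum.denseRange_algebraMap K G.lam).exists_mem_open hopen
    ⟨(y : G.lam.adicCompletion K), by simp⟩
  have hb' : Valued.v ((b : G.lam.adicCompletion K) - y) ≤ WithZero.exp (-3) := by
    have h0 : algebraMap K (G.lam.adicCompletion K) b - ((y : G.lam.adicCompletion K) - 1) - 1 = (b : G.lam.adicCompletion K) - y := by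
      change algebraMap K (G.lam.adicCompletion K) b - ((y : G.lam.adicCompletion K) - 1) - 1 =
        algebraMap K (G.lam.adicCompletion K) b - y
      ring
    rw [← h0]
    exact hb
  have hlt : (WithZero.exp (-3) : WithZero (Multiplicative ℤ)) < 1 := by
    rw [← WithZero.exp_zero, WithZero.exp_lt_exp]
    norm_num
  have hb1 : G.lam.valuation K b = 1 := by
    rw [← HeightOneSpectrum.adicCompletion.valued_coe, ← hy]
    refine Valuation.map_eq_of_sub_lt _ ?_
    rw [hy]
    exact hb'.trans_lt hlt
  -- Strictly below `exp (-2)` is the same as at most `exp (-3)`, since the valuation is discrete.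
  obtain ⟨β, hβ⟩ := G.lam.exists_valuation_sub_lt_of_integer hb1.le (Units.mk0 (WithZero.exp (-2)) WithZero.exp_ne_zero)
  have hβ' : G.lam.valuation K ((β : K) - b) ≤ WithZero.exp (-3) := by
    rw [← WithZero.lt_mul_exp_iff_le WithZero.exp_ne_zero, ← WithZero.exp_add]
    exact hβ
  obtain ⟨α, rfl⟩ := G.equiv.surjective β
  have hα1 : G.lam.valuation K (G.equiv α : K) = 1 := by
    rw [← hb1]
    refine Valuation.map_eq_of_sub_lt _ ?_
    rw [hb1]
    exact hβ'.trans_lt hlt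
  have hα0 : α ≠ 0 := by
    rintro rfl
    simp at hα1
  have hd : ¬ oneAddI ∣ α := by
    rw [← G.isPrimeSystem.map_lam, ← G.valuation_toUnits_eq_one_iff hα0]
    exact hα1
  obtain ⟨n, hn⟩ := exists_isPrimary_mul hd
  refine ⟨n, ?_⟩
  have h1 := (G.valued_toUnits_sub_one_le_iff hn.ne_zero).mpr hn
  have h2 : (finiteCoe G.lam (G.toUnits _ hn.ne_zero) : G.lam.adicCompletion K) =
      finiteCoe G.lam (G.unitI ^ n) * finiteCoe G.lam (G.toUnits α hα0) := by
    rw [← Units.val_mul, ← map_mul]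
    congr 2
    refine Units.ext ?_
    change ((G.equiv (⟨0, 1⟩ ^ n * α) : 𝓞 K) : K) = ((G.unitI ^ n : Kˣ) : K) * ((G.equiv α : 𝓞 K) : K)
    rw [map_mul, map_pow, Units.val_pow_eq_pow_val]
    exact (map_mul (algebraMap (𝓞 K) K) _ _).trans
      (congrArg (· * ((G.equiv α : 𝓞 K) : K)) (map_pow (algebraMap (𝓞 K) K) _ _))
  have hI : Valued.v (finiteCoe G.lam (G.unitI ^ n) : G.lam.adicCompletion K) = 1 := by
    rw [valued_finiteCoe, Units.val_pow_eq_pow_val, map_pow, G.valuation_unitI, one_pow]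
  have h3 : Valued.v ((finiteCoe G.lam (G.toUnits α hα0) : G.lam.adicCompletion K) - (b : G.lam.adicCompletion K)) ≤
      WithZero.exp (-3) := by
    have h0 : (finiteCoe G.lam (G.toUnits α hα0) : G.lam.adicCompletion K) - (b : G.lam.adicCompletion K) =
        ((((G.equiv α : 𝓞 K) : K) - b : K) : G.lam.adicCompletion K) :=
      (map_sub (algebraMap K (G.lam.adicCompletion K)) _ _).symm
    rwa [h0, HeightOneSpectrum.adicCompletion.valued_coe]
  rw [h2] at h1
  set I := (finiteCoe G.lam (G.unitI ^ n) : G.lam.adicCompletion K)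
  set A := (finiteCoe G.lam (G.toUnits α hα0) : G.lam.adicCompletion K)
  have h4 : ((y * finiteCoe G.lam (G.unitI ^ n) : (G.lam.adicCompletion K)ˣ) - 1 : G.lam.adicCompletion K) =
      (I * A - 1) + (-(I * (A - (b : G.lam.adicCompletion K))) + -(I * ((b : G.lam.adicCompletion K) - y))) := by
    rw [Units.val_mul]
    change y * I - 1 = _
    ring
  rw [h4]
  refine Valuation.map_add_le _ h1 (Valuation.map_add_le _ ?_ ?_)
  · rwa [Valuation.map_neg, map_mul, hI, one_mul]
  · rwa [Valuation.map_neg, map_mul, hI, one_mul]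

/-- One element of `K` corrects all valuations, then a power of `i` corrects the residue modulo
`(1+i)³`. The component at infinity is unrestricted. -/
lemma exists_mul_inv_mem (x : IdeleGroup K) : ∃ a : Kˣ, x * (principalIdele a)⁻¹ ∈ G.primarySubgroup := by
  obtain ⟨a, ha⟩ := G.exists_valuation_eq x
  have h1 (v : HeightOneSpectrum (𝓞 K)) :
      Valued.v (finiteComp v (x * (principalIdele a)⁻¹) : v.adicCompletion K) = 1 := by
    rw [map_mul, map_inv, Units.val_mul, Units.val_inv_eq_inv_val, map_mul, map_inv₀, finiteComp_principalIdele,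
      valued_finiteCoe, ha, mul_inv_cancel₀ (by simp)]
  obtain ⟨n, hn⟩ := G.exists_pow_unitI_mul _ (h1 G.lam)
  have h2 : x * (principalIdele (a * (G.unitI ^ n)⁻¹))⁻¹ = x * (principalIdele a)⁻¹ * principalIdele (G.unitI ^ n) := by
    rw [map_mul, mul_inv, map_inv, inv_inv, mul_assoc]
  refine ⟨a * (G.unitI ^ n)⁻¹, ?_⟩
  rw [h2, mem_primarySubgroup]
  refine ⟨fun v ↦ ?_, ?_⟩
  · rw [map_mul, Units.val_mul, map_mul, h1, one_mul, finiteComp_principalIdele, valued_finiteCoe,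
      Units.val_pow_eq_pow_val, map_pow, G.valuation_unitI, one_pow]
  · rw [map_mul, finiteComp_principalIdele]
    exact hn

lemma principalPart_unique {x : IdeleGroup K} {a b : Kˣ} (ha : x * (principalIdele a)⁻¹ ∈ G.primarySubgroup)
    (hb : x * (principalIdele b)⁻¹ ∈ G.primarySubgroup) : a = b := by
  have h := G.primarySubgroup.mul_mem (G.primarySubgroup.inv_mem ha) hb
  rw [mul_inv, inv_inv, mul_mul_mul_comm, inv_mul_cancel, one_mul, ← map_inv, ← map_mul] at h
  exact mul_inv_eq_one.mp (G.eq_one_of_principalIdele_mem h)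

end GaussianField

end Existence

/-! ### Construction of the standard character -/

section StandardCharacter

variable {K : Type*} [Field K] [NumberField K]

open IsPrimeSystem (signValue signValue_of_ne signValue_lam)

/-- The multiplicative function `z ↦ (z / |z|)⁻¹`. -/
noncomputable def signInv : ℂ →* ℂ where
  toFun z := (z / (‖z‖ : ℂ))⁻¹
  map_one' := by simp
  map_mul' z w := by rw [norm_mul, Complex.ofReal_mul, mul_div_mul_comm, mul_inv]

namespace GaussianField

variable (G : GaussianField K)

/-- The component at infinity of the standard character. -/
noncomputable def infiniteSign : (G.infPlace.Completion)ˣ →* ℂˣ :=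
  (Units.map signInv).comp (Units.map (InfinitePlace.Completion.extensionEmbedding G.infPlace).toMonoidHom)

lemma coe_infiniteSign (z : (G.infPlace.Completion)ˣ) : (G.infiniteSign z : ℂ) =
    (InfinitePlace.Completion.extensionEmbedding G.infPlace (z : G.infPlace.Completion) /
      (‖InfinitePlace.Completion.extensionEmbedding G.infPlace (z : G.infPlace.Completion)‖ : ℂ))⁻¹ := rfl

lemma coe_infiniteSign_toUnits {α : GaussianInt} (h : α ≠ 0) :
    (G.infiniteSign (infiniteCoe G.infPlace (G.toUnits α h)) : ℂ) = (gaussSign α)⁻¹ := by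
  rw [coe_infiniteSign, G.extensionEmbedding_toUnits]
  rfl

lemma continuous_infiniteSign_infiniteComp :
    Continuous fun x : IdeleGroup K ↦ G.infiniteSign (infiniteComp G.infPlace x) := by
  rw [Units.isEmbedding_val₀.continuous_iff]
  have h1 : Continuous fun x : IdeleGroup K ↦ InfinitePlace.Completion.extensionEmbedding G.infPlace
      (infiniteComp G.infPlace x : G.infPlace.Completion) :=
    (InfinitePlace.Completion.isometry_extensionEmbedding G.infPlace).continuous.comp
      (continuous_infiniteComp G.infPlace)
  have h0 (x : IdeleGroup K) : InfinitePlace.Completion.extensionEmbedding G.infPlace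
      (infiniteComp G.infPlace x : G.infPlace.Completion) ≠ 0 := by simp
  have h2 (x : IdeleGroup K) : (‖InfinitePlace.Completion.extensionEmbedding G.infPlace
      (infiniteComp G.infPlace x : G.infPlace.Completion)‖ : ℂ) ≠ 0 := by
    simpa only [ne_eq, Complex.ofReal_eq_zero, norm_eq_zero] using h0 x
  exact (h1.div (Complex.continuous_ofReal.comp h1.norm) h2).inv₀ fun x ↦ div_ne_zero (h0 x) (h2 x)

/-- The element of `Kˣ` generating the idèle modulo the subgroup of primary idèles. -/
noncomputable def principalPart : IdeleGroup K →* Kˣ :=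
  MonoidHom.mk' (fun x ↦ (G.exists_mul_inv_mem x).choose) fun x y ↦
    G.principalPart_unique (G.exists_mul_inv_mem (x * y)).choose_spec (by
      rw [map_mul, mul_inv, mul_mul_mul_comm]
      exact G.primarySubgroup.mul_mem (G.exists_mul_inv_mem x).choose_spec (G.exists_mul_inv_mem y).choose_spec)

lemma principalPart_eq {x : IdeleGroup K} {a : Kˣ} (h : x * (principalIdele a)⁻¹ ∈ G.primarySubgroup) :
    G.principalPart x = a :=
  G.principalPart_unique (G.exists_mul_inv_mem x).choose_spec h

/-- The standard character as a homomorphism. -/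
noncomputable def characterHom : IdeleGroup K →* ℂˣ :=
  G.infiniteSign.comp (infiniteComp G.infPlace) *
    ((G.infiniteSign.comp (infiniteCoe G.infPlace)).comp G.principalPart)⁻¹

lemma characterHom_apply {x : IdeleGroup K} {a : Kˣ} (h : x * (principalIdele a)⁻¹ ∈ G.primarySubgroup) :
    G.characterHom x = G.infiniteSign (infiniteComp G.infPlace x) *
      (G.infiniteSign (infiniteCoe G.infPlace a))⁻¹ := by
  rw [← G.principalPart_eq h]
  rfl

lemma characterHom_apply_of_mem {x : IdeleGroup K} (h : x ∈ G.primarySubgroup) :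
    G.characterHom x = G.infiniteSign (infiniteComp G.infPlace x) := by
  rw [G.characterHom_apply (a := 1) (by rwa [map_one, inv_one, mul_one]), map_one, map_one, inv_one, mul_one]

/-- The idèle class character `ψ` with `ψ_v(π) = π / |π|` for the primary generator `π` of an odd prime. -/
noncomputable def character : IdeleGroup K →ₜ* ℂˣ where
  toMonoidHom := G.characterHom
  continuous_toFun := by
    -- On the open subgroup of primary idèles the character is just the sign at infinity, so
    -- continuity at `1` suffices.
    refine continuous_of_continuousAt_one G.characterHom ?_
    refine (G.continuous_infiniteSign_infiniteComp.continuousAt).congr ?_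
    filter_upwards [G.isOpen_primarySubgroup.mem_nhds G.primarySubgroup.one_mem] with x hx
    exact (G.characterHom_apply_of_mem hx).symm

lemma character_apply {x : IdeleGroup K} {a : Kˣ} (h : x * (principalIdele a)⁻¹ ∈ G.primarySubgroup) :
    G.character x = G.infiniteSign (infiniteComp G.infPlace x) *
      (G.infiniteSign (infiniteCoe G.infPlace a))⁻¹ := G.characterHom_apply h

lemma character_apply_of_mem {x : IdeleGroup K} (h : x ∈ G.primarySubgroup) :
    G.character x = G.infiniteSign (infiniteComp G.infPlace x) := G.characterHom_apply_of_mem h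

lemma isIdeleClassCharacter_character : IsIdeleClassCharacter G.character := fun a ↦ by
  have h := G.character_apply (x := principalIdele a) (a := a) (by
    rw [mul_inv_cancel]
    exact G.primarySubgroup.one_mem)
  rwa [infiniteComp_principalIdele, mul_inv_cancel] at h

lemma infiniteLocalIdele_mem (w : InfinitePlace K) (z : (w.Completion)ˣ) :
    infiniteLocalIdele w z ∈ G.primarySubgroup := by
  rw [mem_primarySubgroup]
  simp

lemma isAlgebraicOfType_character : IsAlgebraicOfType G.character 2 := by
  refine ⟨-1, by norm_num, fun w z ↦ ?_⟩
  obtain rfl := G.eq_infPlace w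
  rw [G.character_apply_of_mem (G.infiniteLocalIdele_mem _ z), infiniteComp_infiniteLocalIdele_self,
    coe_infiniteSign, zpow_neg_one]

lemma isUnramifiedAt_character {v : HeightOneSpectrum (𝓞 K)} (hv : v ≠ G.lam) :
    IsUnramifiedAt G.character v := fun u hu ↦ by
  rw [G.character_apply_of_mem, infiniteComp_finiteLocalIdele, map_one]
  rw [mem_primarySubgroup, finiteComp_finiteLocalIdele_of_ne hv.symm]
  refine ⟨fun w ↦ ?_, by simp⟩
  by_cases h : w = v
  · subst h
    rwa [finiteComp_finiteLocalIdele_self]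
  · rw [finiteComp_finiteLocalIdele_of_ne h]
    simp

/-- The local idèle `α` at `v` differs from the principal idèle `α` by a primary idèle, so `α` is
its principal part. The inverse sign chosen at infinity then produces `α/|α|` itself rather than its
conjugate. -/
lemma character_finiteLocalIdele_toUnits {v : HeightOneSpectrum (𝓞 K)} {α : GaussianInt} (hα : α ≠ 0)
    (h1 : ∀ w ≠ v, w.valuation K (G.toUnits α hα : K) = 1) (h2 : v ≠ G.lam → IsPrimary α) :
    (G.character (finiteLocalIdele v (finiteCoe v (G.toUnits α hα))) : ℂ) = gaussSign α := by
  rw [G.character_apply (a := G.toUnits α hα), infiniteComp_finiteLocalIdele, map_one, one_mul,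
    Units.val_inv_eq_inv_val, coe_infiniteSign_toUnits, inv_inv]
  rw [← G.primarySubgroup.inv_mem_iff, mul_inv, inv_inv, mem_primarySubgroup]
  refine ⟨fun w ↦ ?_, ?_⟩
  · rw [map_mul, map_inv, finiteComp_principalIdele]
    by_cases h : w = v
    · subst h
      rw [finiteComp_finiteLocalIdele_self, inv_mul_cancel]
      simp
    · rw [finiteComp_finiteLocalIdele_of_ne h, inv_one, one_mul, valued_finiteCoe, h1 w h]
  · rw [map_mul, map_inv, finiteComp_principalIdele]
    by_cases h : v = G.lam
    · subst h
      rw [finiteComp_finiteLocalIdele_self, inv_mul_cancel]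
      simp
    · rw [finiteComp_finiteLocalIdele_of_ne (Ne.symm h), inv_one, one_mul]
      exact (G.valued_toUnits_sub_one_le_iff hα).mpr (h2 h)

/-- The local unit `i` at the prime over `2` is sent to `i ≠ 1`. -/
lemma not_isUnramifiedAt_character_lam : ¬ IsUnramifiedAt G.character G.lam := fun h ↦ by
  have h1 := h (finiteCoe G.lam G.unitI) ((valued_finiteCoe _ _).trans (G.valuation_unitI _))
  have h2 := G.character_finiteLocalIdele_toUnits (v := G.lam) isUnit_I.ne_zero (fun w _ ↦ G.valuation_unitI w)
    fun h0 ↦ absurd rfl h0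
  rw [h1, gaussSign_I, Units.val_one] at h2
  simpa using congrArg Complex.re h2

lemma eulerValue_character (v : HeightOneSpectrum (𝓞 K)) : eulerValue G.character v = signValue G.gen G.lam v := by
  by_cases hv : v = G.lam
  · subst hv
    rw [eulerValue, if_neg G.not_isUnramifiedAt_character_lam, signValue_lam]
  · have h := G.isUnramifiedAt_character hv
    rw [eulerValue, if_pos h, signValue_of_ne hv, uniformizerValue_eq _ h (G.valuation_genUnit_self v)]
    exact G.character_finiteLocalIdele_toUnits _ (fun w hw ↦ G.valuation_genUnit_of_ne hw)
      fun _ ↦ G.isPrimeSystem.isPrimary v hv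

theorem isPsi_character : IsPsi G.character where
  isIdeleClassCharacter := G.isIdeleClassCharacter_character
  isAlgebraic := G.isAlgebraicOfType_character
  lFunction s hs := by
    have hs' : 1 < (s - 1 / 2).re := by
      norm_num
      linarith
    have h1 := G.isPrimeSystem.hasProd_signValue one_ne_zero hs' (by simpa only [pow_one] using hasSum_gaussSign hs')
    rw [sub_add_cancel] at h1
    refine h1.congr_fun fun v ↦ ?_
    rw [G.heckeEulerFactor_eq, G.eulerValue_character, pow_one]

end GaussianField

end StandardCharacter

theorem mainTheorem6 (K : Type*) [Field K] [NumberField K]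
    (hK : Module.finrank ℚ K = 2) (hi : ∃ i : K, i ^ 2 = -1) :
    -- the character `ψ` exists
    (∃ ψ : IdeleGroup K →ₜ* ℂˣ, IsPsi ψ) ∧
    -- `η(4τ)^6` is a cusp form of weight 3 and level 16
    ∃ η6 : CuspFormsWeightThreeLevelSixteen,
      (∀ τ : ℍ, η6 τ = ModularForm.eta (4 * (τ : ℂ)) ^ 6) ∧
      (∀ ψ : IdeleGroup K →ₜ* ℂˣ, IsPsi ψ →
        -- `L(ψ², s - 1) = L(η(4τ)^6, s)`
        IsHeckeLFunction (ψ ^ 2) (fun s ↦ cuspL η6 (s + 1)) ∧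
        -- the form `g` attached to `ψ²` is `η(4τ)^6`
        ∀ g : CuspFormsWeightThreeLevelSixteen,
          IsHeckeLFunction (ψ ^ 2) (fun s ↦ cuspL g (s + 1)) →
            ∀ τ : ℍ, g τ = ModularForm.eta (4 * (τ : ℂ)) ^ 6) ∧
      cuspL η6 2 = Complex.betaIntegral (1 / 4) (1 / 4) ^ 2 / 64 := by
  obtain ⟨G⟩ := nonempty_gaussianField hK hi
  exact ⟨⟨G.character, G.isPsi_character⟩, etaCuspForm, etaCuspForm_apply,
    fun ψ hψ ↦ ⟨G.isHeckeLFunction_sq hψ, fun g hg ↦ G.eq_etaCuspForm_of_isHeckeLFunction hψ hg⟩,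
    cuspL_etaCuspForm_two⟩
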